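/- **Conventions.** For $t\in\mathbb R$ let $P_i(x;t)$ be the scaled shifted Legendre polynomials, $P_0=1$, $P_1=2x-t$, $iP_i=(2i-1)(2x-t)P_{i-1}-(i-1)t^2P_{i-2}$ for $i\ge2$, and $P^\alpha_j(x;t)$ the scaled shifted Jacobi polynomials, $P^\alpha_0=1$, $P_1^\alpha=2x-t+\alpha x$, $a_jP^\alpha_j=b_j(c_j(2x-t)+\alpha^2t)P^\alpha_{j-1}-d_jt^2P^\alpha_{j-2}$ for $j\ge 2$, with $a_j=2j(j+\alpha)(2j+\alpha-2)$, $b_j=2j+\alpha-1$, $c_j=(2j+\alpha)(2j+\alpha-2)$, $d_j=2(j+\alpha-1)(j-1)(2j+\alpha)$. For $i,j\ge 1$ put $L_i(x;t)=\int_0^xP_{i-1}(y;t)\,dy$ and $L^\alpha_j(x;t)=\int_0^xP^\alpha_{j-1}(y;t)\,dy$. For $\psi(x;t)$ write $[\psi](s_0,s_1)=\psi(s_1;s_0+s_1)$. Put - $\phi^E_i(s_0,s_1)=[L_i](s_0,s_1)$; $\phi^\square_{ij}(s_0,s_1,t_0,t_1)=\phi^E_i(s_0,s_1)\phi^E_j(t_0,t_1)$;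 $\phi^\Delta_{ij}(s_0,s_1,s_2)=\phi_i^E(s_0,s_1)[L_j^{2i}](s_0+s_1,s_2)$; - $E^E_i(s_0,s_1)=[P_i](s_0,s_1)(s_0\nabla s_1-s_1\nabla s_0)$; $E^\square_{ij}(s_0,s_1,t_0,t_1)=\phi^E_j(t_0,t_1)E^E_i(s_0,s_1)$; $E^\Delta_{ij}(s_0,s_1,s_2)=[L_j^{2i+1}](s_0+s_1,s_2)E^E_i(s_0,s_1)$; - $V^\square_{ij}(s_0,s_1,t_0,t_1)=E^E_i(s_0,s_1)\times E^E_j(t_0,t_1)$; $V^\Delta_{ij}(s_0,s_1,s_2)=\pi_{ij}(s_0,s_1,s_2)\,(s_0\nabla s_1\times\nabla s_2+s_1\nabla s_2\times\nabla s_0+s_2\nabla s_0\times\nabla s_1)$, where $\pi_{ij}(s_0,s_1,s_2)=[P_i](s_0,s_1)[P_j^{2i+1}](s_0+s_1,s_2)$. Coordinates: $\mu_0(\xi)=1-\xi$, $\mu_1(\xi)=\xi$, $\vec\mu=(\mu_0,\mu_1)$; $\nu=(1-x_1-x_2,x_1,x_2)$; $\lambda=(1-x_1-x_2-x_3,x_1,x_2,x_3)$;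 $\nu_{ab}=(\nu_a,\nu_b)$, $\nu_{abc}=(\nu_a,\nu_b,\nu_c)$, and similarly for $\lambda$. In two dimensions $E\times F=E_1F_2-E_2F_1$. Master elements: segment $(0,1)$, quadrilateral $(0,1)^2$, hexahedron $(0,1)^3$; triangle and tetrahedron the open unit simplices $\{x_k>0,\ \sum_kx_k<1\}$; prism = triangle $\times(0,1)$ with coordinates $(x_1,x_2,z)$. Spaces: $\mathcal P^p$, resp. $\tilde{\mathcal P}^p$: polynomials of total degree $\le p$, resp. homogeneous of degree $p$ (with $0$); $\mathcal Q^{p,q(,r)}$: degree at most $p,q,(r)$ in the respective variables; in dimension $N$, $\mathcal N^p=(\mathcal P^{p-1})^N\oplus\{E\in(\tilde{\mathcal P}^p)^N: x\cdot E(x)=0\ \forall x\}$ and $\mathcal{RT}^p=(\mathcal P^{p-1})^N\oplus\{\varphi(x)\,x:\varphi\in\tilde{\mathcal P}^{p-1}\}$. On the prism, $S\otimes\mathcal P^q$ is the span of the products $f(x_1,x_2)g(z)$, $f\in S$, $g\in\mathcal P^q$, and a product $T\times S$ prescribes the first two components and the third one. **Theorem.** Let all orders $p$ (or $p_k$, or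 $p,q$) be integers $\ge1$. In each of the 22 cases below, the listed functions lie in the stated space, are linearly independent already as functions on the master element, span the space, and their number and the dimension of the space both equal the stated number; hence they form a basis. The bases are hierarchical: when the orders are increased (in any of the directions separately), the set of shape functions of the lower orders is contained in that of the higher orders. Indices such as $c,d,e$ of $\mu$ run over $\{0,1\}$, $a<b(<c)$ over vertex pairs (triples), and all ranges are inclusive. *Segment* (order $p$). - $H^1$: $\mu_a$; $\phi^E_i(\vec\mu)$, $2\le i\le p$. Space $\mathcal P^p$, dimension $p+1$. - $L^2$: $[P_i](\vec\mu)\nabla\mu_1$, $0\le i\le p-1$. Space $\mathcal P^{p-1}$, dimension $p$. *Quadrilateral* (orders $p_1,p_2$; $(a,b)=(1,2),(2,1)$). - $H^1$: $\mu_c(\xi_1)\mu_d(\xi_2)$; $\mu_c(\xi_b)\phi^E_i(\vec\mu(\xi_a))$, $2\le i\le p_a$; $\phi^\square_{ij}(\vec\mu(\xi_1),\vec\mu(\xi_2))$, $2\le i\le p_1$, $2\le j\le p_2$. Space $\mathcal Q^{p_1,p_2}$, dimension $(p_1+1)(p_2+1)$. - $H(\mathrm{curl})$: $\mu_c(\xi_b)E^E_i(\vec\mu(\xi_a))$,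 $0\le i\le p_a-1$; $E^\square_{ij}(\vec\mu(\xi_a),\vec\mu(\xi_b))$, $0\le i\le p_a-1$, $2\le j\le p_b$. Space $\mathcal Q^{p_1-1,p_2}\times\mathcal Q^{p_1,p_2-1}$, dimension $p_1(p_2+1)+(p_1+1)p_2$. - $H(\mathrm{div})$: the rotated functions $(E_2,-E_1)$, $E=(E_1,E_2)$ in the preceding list. Space $\mathcal Q^{p_1,p_2-1}\times\mathcal Q^{p_1-1,p_2}$, the same dimension. - $L^2$: $[P_i](\vec\mu(\xi_1))[P_j](\vec\mu(\xi_2))\,\nabla\mu_1(\xi_1)\times\nabla\mu_1(\xi_2)$, $0\le i\le p_1-1$, $0\le j\le p_2-1$. Space $\mathcal Q^{p_1-1,p_2-1}$, dimension $p_1p_2$. *Triangle* (order $p$). - $H^1$: $\nu_a$; $\phi^E_i(\nu_{ab})$, $a<b$, $2\le i\le p$; $\phi^\Delta_{ij}(\nu_{012})$, $i\ge2$, $j\ge1$, $i+j\le p$. Space $\mathcal P^p$, dimension $\frac12(p+2)(p+1)$. - $H(\mathrm{curl})$: $E^E_i(\nu_{ab})$, $a<b$, $0\le i\le p-1$; $E^\Delta_{ij}(\nu_{012})$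 and $E^\Delta_{ij}(\nu_{120})$, $i\ge0$, $j\ge1$, $i+j\le p-1$. Space $\mathcal N^p$, dimension $p(p+2)$. - $H(\mathrm{div})$: the rotated functions $(E_2,-E_1)$ of the preceding list. Space $\mathcal{RT}^p$, dimension $p(p+2)$. - $L^2$: $\pi_{ij}(\nu_{012})\,\nabla\nu_1\times\nabla\nu_2$, $i,j\ge0$, $i+j\le p-1$. Space $\mathcal P^{p-1}$, dimension $\frac12p(p+1)$. *Hexahedron* (orders $p_1,p_2,p_3$; $(a,b,c)$ runs over the cyclic permutations of $(1,2,3)$). - $H^1$: $\mu_{c}(\xi_1)\mu_{d}(\xi_2)\mu_{e}(\xi_3)$ with $c,d,e\in\{0,1\}$; $\mu_e(\xi_c)\mu_d(\xi_b)\phi^E_i(\vec\mu(\xi_a))$, $2\le i\le p_a$; $\mu_d(\xi_c)\phi^\square_{ij}(\vec\mu(\xi_a),\vec\mu(\xi_b))$, $2\le i\le p_a$, $2\le j\le p_b$; $\phi^\square_{ij}(\vec\mu(\xi_1),\vec\mu(\xi_2))\phi^E_k(\vec\mu(\xi_3))$, $2\le i\le p_1$, $2\le j\le p_2$, $2\le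 k\le p_3$. Space $\mathcal Q^{p_1,p_2,p_3}$, dimension $(p_1+1)(p_2+1)(p_3+1)$. - $H(\mathrm{curl})$: $\mu_e(\xi_c)\mu_d(\xi_b)E^E_i(\vec\mu(\xi_a))$, $0\le i\le p_a-1$; $\mu_d(\xi_c)E^\square_{ij}(\vec\mu(\xi_a),\vec\mu(\xi_b))$, $0\le i\le p_a-1$, $2\le j\le p_b$; $\mu_d(\xi_c)E^\square_{ij}(\vec\mu(\xi_b),\vec\mu(\xi_a))$, $0\le i\le p_b-1$, $2\le j\le p_a$; $\phi^E_k(\vec\mu(\xi_c))E^\square_{ij}(\vec\mu(\xi_a),\vec\mu(\xi_b))$, $0\le i\le p_a-1$, $2\le j\le p_b$, $2\le k\le p_c$. Space $\mathcal Q^{p_1-1,p_2,p_3}\times\mathcal Q^{p_1,p_2-1,p_3}\times\mathcal Q^{p_1,p_2,p_3-1}$, dimension $p_1(p_2+1)(p_3+1)+(p_1+1)p_2(p_3+1)+(p_1+1)(p_2+1)p_3$. - $H(\mathrm{div})$: $\mu_d(\xi_c)V^\square_{ij}(\vec\mu(\xi_a),\vec\mu(\xi_b))$, and $\phi_k^E(\vec\mu(\xi_c))V^\square_{ij}(\vec\mu(\xi_a),\vec\mu(\xi_b))$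 with $2\le k\le p_c$; $0\le i\le p_a-1$, $0\le j\le p_b-1$. Space $\mathcal Q^{p_1,p_2-1,p_3-1}\times\mathcal Q^{p_1-1,p_2,p_3-1}\times\mathcal Q^{p_1-1,p_2-1,p_3}$, dimension $(p_1+1)p_2p_3+p_1(p_2+1)p_3+p_1p_2(p_3+1)$. - $L^2$: $[P_i](\vec\mu(\xi_1))[P_j](\vec\mu(\xi_2))[P_k](\vec\mu(\xi_3))\,(\nabla\mu_1(\xi_1)\times\nabla\mu_1(\xi_2))\cdot\nabla\mu_1(\xi_3)$, $0\le i\le p_1-1$, $0\le j\le p_2-1$, $0\le k\le p_3-1$. Space $\mathcal Q^{p_1-1,p_2-1,p_3-1}$, dimension $p_1p_2p_3$. *Tetrahedron* (order $p$). - $H^1$: $\lambda_a$; $\phi^E_i(\lambda_{ab})$, $a<b$, $2\le i\le p$; $\phi^\Delta_{ij}(\lambda_{abc})$, $a<b<c$, $i\ge2$, $j\ge1$, $i+j\le p$; $\phi^\Delta_{ij}(\lambda_{012})[L_k^{2(i+j)}](1-\lambda_3,\lambda_3)$, $i\ge2$, $j,k\ge1$, $i+j+k\le p$. Space $\mathcal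 P^p$, dimension $\frac16(p+3)(p+2)(p+1)$. - $H(\mathrm{curl})$: $E^E_i(\lambda_{ab})$, $a<b$, $0\le i\le p-1$; $E^\Delta_{ij}(\lambda_{abc})$ and $E^\Delta_{ij}(\lambda_{bca})$, $a<b<c$, $i\ge0$, $j\ge1$, $i+j\le p-1$; $[L_k^{2(i+j)}](1-\lambda_d,\lambda_d)E^\Delta_{ij}(\lambda_{abc})$, $(a,b,c,d)\in\{(0,1,2,3),(1,2,3,0),(2,3,0,1)\}$, $i\ge0$, $j,k\ge1$, $i+j+k\le p-1$. Space $\mathcal N^p$, dimension $\frac12p(p+2)(p+3)$. - $H(\mathrm{div})$: $V^\Delta_{ij}(\lambda_{abc})$, $a<b<c$, $i,j\ge0$, $i+j\le p-1$; $[L_k^{2(i+j+1)}](1-\lambda_d,\lambda_d)V^\Delta_{ij}(\lambda_{abc})$ with the same three $(a,b,c,d)$, $i,j\ge0$, $k\ge1$, $i+j+k\le p-1$. Space $\mathcal{RT}^p$, dimension $\frac12p(p+1)(p+3)$. - $L^2$: $\pi_{ij}(\lambda_{012})[P_k^{2(i+j+1)}](1-\lambda_3,\lambda_3)\,(\nabla\lambda_1\times\nabla\lambda_2)\cdot\nabla\lambda_3$,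 $i,j,k\ge0$, $i+j+k\le p-1$. Space $\mathcal P^{p-1}$, dimension $\frac16p(p+1)(p+2)$. *Prism* (orders $p$ in $(x_1,x_2)$, $q$ in $z$; $\vec\mu=\vec\mu(z)$; $a<b$ vertices of the triangle in $\nu_{ab}$). - $H^1$: $\nu_a\mu_c$; $\mu_c\phi^E_i(\nu_{ab})$, $2\le i\le p$; $\nu_a\phi_i^E(\vec\mu)$, $2\le i\le q$; $\mu_c\phi^\Delta_{ij}(\nu_{012})$; $\phi^\square_{ij}(\nu_{ab},\vec\mu)$, $2\le i\le p$, $2\le j\le q$; $\phi^\Delta_{ij}(\nu_{012})\phi^E_k(\vec\mu)$, $2\le k\le q$; where $i\ge2$, $j\ge1$, $i+j\le p$ in $\phi_{ij}^\Delta$. Space $\mathcal P^p\otimes\mathcal P^q$, dimension $\frac12(p+2)(p+1)(q+1)$. - $H(\mathrm{curl})$: $\mu_cE^E_i(\nu_{ab})$, $0\le i\le p-1$; $\nu_aE^E_i(\vec\mu)$, $0\le i\le q-1$; $\mu_cE^\Delta_{ij}(\nu_{012})$, $\mu_cE^\Delta_{ij}(\nu_{120})$; $E^\square_{ij}(\nu_{ab},\vec\mu)$,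 $0\le i\le p-1$, $2\le j\le q$; $E^\square_{ij}(\vec\mu,\nu_{ab})$, $0\le i\le q-1$, $2\le j\le p$; $\phi^E_k(\vec\mu)E^\Delta_{ij}(\nu_{012})$, $\phi^E_k(\vec\mu)E^\Delta_{ij}(\nu_{120})$, $2\le k\le q$; $\phi^\Delta_{ij}(\nu_{012})E^E_k(\vec\mu)$, $i\ge2$, $j\ge1$, $i+j\le p$, $0\le k\le q-1$; where $i\ge0$, $j\ge1$, $i+j\le p-1$ in $E_{ij}^\Delta$. Space $(\mathcal N^p\otimes\mathcal P^q)\times(\mathcal P^p\otimes\mathcal P^{q-1})$, dimension $p(p+2)(q+1)+\frac12(p+2)(p+1)q$. - $H(\mathrm{div})$: $\mu_cV^\Delta_{ij}(\nu_{012})$; $V^\square_{ij}(\nu_{ab},\vec\mu)$, $0\le i\le p-1$, $0\le j\le q-1$; $E^\Delta_{ij}(\nu_{012})\times E^E_k(\vec\mu)$, $E^\Delta_{ij}(\nu_{120})\times E^E_k(\vec\mu)$, $i\ge0$, $j\ge1$, $i+j\le p-1$, $0\le k\le q-1$; $\phi^E_k(\vec\mu)V^\Delta_{ij}(\nu_{012})$,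 $2\le k\le q$; where $i,j\ge0$, $i+j\le p-1$ in $V^\Delta_{ij}$. Space $(\mathcal{RT}^p\otimes\mathcal P^{q-1})\times(\mathcal P^{p-1}\otimes\mathcal P^q)$, dimension $p(p+2)q+\frac12p(p+1)(q+1)$. - $L^2$: $\pi_{ij}(\nu_{012})[P_k](\vec\mu)\,(\nabla\nu_1\times\nabla\nu_2)\cdot\nabla\mu_1$, $i,j\ge0$, $i+j\le p-1$, $0\le k\le q-1$. Space $\mathcal P^{p-1}\otimes\mathcal P^{q-1}$, dimension $\frac12p(p+1)q$. -/

import Mathlib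

namespace ShapeFunctions

open Finset

noncomputable section

/-! Scalar- and vector-valued functions on the reference space. -/

abbrev Scal (N : ℕ) := (Fin N → ℝ) → ℝ

abbrev Vec (N : ℕ) := (Fin N → ℝ) → (Fin N → ℝ)

/-- The gradient of a scalar function, in Cartesian components. -/
def grad {N : ℕ} (s : Scal N) : Vec N := fun x i => fderiv ℝ s x (Pi.single i 1)

/-- Product of a scalar function and a vector function. -/
def mulVec {N : ℕ} (s : Scal N) (F : Vec N) : Vec N := fun x => s x • F x

/-- Cross product of vector functions in three dimensions. -/
def cross3 (F G : Vec 3) : Vec 3 := fun x => crossProduct (F x) (G x)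

/-- Scalar-valued cross product of vector functions in two dimensions. -/
def cross2 (F G : Vec 2) : Scal 2 := fun x => F x 0 * G x 1 - F x 1 * G x 0

/-- Pointwise dot product of vector functions. -/
def dotF {N : ℕ} (F G : Vec N) : Scal N := fun x => F x ⬝ᵥ G x

/-- Rotation of a planar vector function: the tangential direction becomes a normal one. -/
def rot (F : Vec 2) : Vec 2 := fun x => ![F x 1, -F x 0]

/-! Scaled (shifted) Legendre and Jacobi polynomials and their integrals. -/

/-- The scaled shifted Legendre polynomial `P_i(x;t)`. -/
def legendreP : ℕ → ℝ → ℝ → ℝ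
  | 0, _, _ => 1
  | 1, x, t => 2 * x - t
  | (n + 2), x, t =>
      ((2 * ((n : ℝ) + 2) - 1) * (2 * x - t) * legendreP (n + 1) x t
        - ((n : ℝ) + 1) * t ^ 2 * legendreP n x t) / ((n : ℝ) + 2)

/-- The integrated scaled Legendre polynomial `L_i(x;t)`, `i ≥ 1`. -/
def legendreL (i : ℕ) (x t : ℝ) : ℝ := ∫ y in (0 : ℝ)..x, legendreP (i - 1) y t

/-- The scaled shifted Jacobi polynomial `P_j^α(x;t)`, through the three-term recursion
`a_j P_j = b_j (c_j (2x - t) + α² t) P_{j-1} - d_j t² P_{j-2}` with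
`a_j = 2j(j+α)(2j+α-2)`, `b_j = 2j+α-1`, `c_j = (2j+α)(2j+α-2)`, `d_j = 2(j+α-1)(j-1)(2j+α)`. -/
def jacobiP (α : ℝ) : ℕ → ℝ → ℝ → ℝ
  | 0, _, _ => 1
  | 1, x, t => 2 * x - t + α * x
  | (n + 2), x, t =>
      let j : ℝ := (n : ℝ) + 2
      ((2 * j + α - 1) * ((2 * j + α) * (2 * j + α - 2) * (2 * x - t) + α ^ 2 * t)
            * jacobiP α (n + 1) x t
          - 2 * (j + α - 1) * (j - 1) * (2 * j + α) * t ^ 2 * jacobiP α n x t)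
        / (2 * j * (j + α) * (2 * j + α - 2))

/-- The integrated scaled Jacobi polynomial `L_j^α(x;t)`, `j ≥ 1`. -/
def jacobiL (α : ℝ) (j : ℕ) (x t : ℝ) : ℝ := ∫ y in (0 : ℝ)..x, jacobiP α (j - 1) y t

/-- Homogenization `[ψ](s₀,s₁) = ψ(s₁; s₀+s₁)`. -/
def hom {N : ℕ} (ψ : ℝ → ℝ → ℝ) (s₀ s₁ : Scal N) : Scal N :=
  fun x => ψ (s₁ x) (s₀ x + s₁ x)

/-! Ancillary functions. -/

section Ancillary

/-- `φ_i^E(s₀,s₁)` -/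
def phiE {N : ℕ} (i : ℕ) (s : Fin 2 → Scal N) : Scal N := hom (legendreL i) (s 0) (s 1)

/-- `φ_ij^□(s₀,s₁,t₀,t₁)` -/
def phiQ {N : ℕ} (i j : ℕ) (s t : Fin 2 → Scal N) : Scal N := phiE i s * phiE j t

/-- `φ_ij^Δ(s₀,s₁,s₂)` -/
def phiT {N : ℕ} (i j : ℕ) (s : Fin 3 → Scal N) : Scal N :=
  phiE i ![s 0, s 1] * hom (jacobiL ((2 * i : ℕ) : ℝ) j) (s 0 + s 1) (s 2)

/-- `E_i^E(s₀,s₁)` -/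
def fieldE {N : ℕ} (i : ℕ) (s : Fin 2 → Scal N) : Vec N :=
  mulVec (hom (legendreP i) (s 0) (s 1))
    (mulVec (s 0) (grad (s 1)) - mulVec (s 1) (grad (s 0)))

/-- `E_ij^□(s₀,s₁,t₀,t₁)` -/
def fieldQ {N : ℕ} (i j : ℕ) (s t : Fin 2 → Scal N) : Vec N := mulVec (phiE j t) (fieldE i s)

/-- `E_ij^Δ(s₀,s₁,s₂)` -/
def fieldT {N : ℕ} (i j : ℕ) (s : Fin 3 → Scal N) : Vec N :=
  mulVec (hom (jacobiL ((2 * i + 1 : ℕ) : ℝ) j) (s 0 + s 1) (s 2)) (fieldE i ![s 0, s 1])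

/-- `V_ij^□(s₀,s₁,t₀,t₁)` -/
def fluxQ (i j : ℕ) (s t : Fin 2 → Scal 3) : Vec 3 := cross3 (fieldE i s) (fieldE j t)

/-- `[P_i](s₀,s₁) [P_j^{2i+1}](s₀+s₁,s₂)` -/
def polyT {N : ℕ} (i j : ℕ) (s : Fin 3 → Scal N) : Scal N :=
  hom (legendreP i) (s 0) (s 1) * hom (jacobiP ((2 * i + 1 : ℕ) : ℝ) j) (s 0 + s 1) (s 2)

/-- `V_ij^Δ(s₀,s₁,s₂)` -/
def fluxT (i j : ℕ) (s : Fin 3 → Scal 3) : Vec 3 :=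
  mulVec (polyT i j s)
    (mulVec (s 0) (cross3 (grad (s 1)) (grad (s 2)))
      + mulVec (s 1) (cross3 (grad (s 2)) (grad (s 0)))
      + mulVec (s 2) (cross3 (grad (s 0)) (grad (s 1))))

end Ancillary

/-! Affine coordinates. -/

/-- `μ₀(ξ_k) = 1 - ξ_k`, `μ₁(ξ_k) = ξ_k`. -/
def mu {N : ℕ} (k : Fin N) : Fin 2 → Scal N := ![fun x => 1 - x k, fun x => x k]

/-- Triangle coordinates in the variables `x_k, x_l`. -/
def nu {N : ℕ} (k l : Fin N) : Fin 3 → Scal N :=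
  ![fun x => 1 - x k - x l, fun x => x k, fun x => x l]

/-- Tetrahedron coordinates. -/
def lam : Fin 4 → Scal 3 :=
  ![fun x => 1 - x 0 - x 1 - x 2, fun x => x 0, fun x => x 1, fun x => x 2]

def pick2 {N n : ℕ} (s : Fin n → Scal N) (a b : Fin n) : Fin 2 → Scal N := ![s a, s b]

def pick3 {N n : ℕ} (s : Fin n → Scal N) (a b c : Fin n) : Fin 3 → Scal N := ![s a, s b, s c]

/-! Master elements (open sets). -/

def cube (N : ℕ) : Set (Fin N → ℝ) := {x | ∀ k, 0 < x k ∧ x k < 1}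

def simplex (N : ℕ) : Set (Fin N → ℝ) := {x | (∀ k, 0 < x k) ∧ ∑ k, x k < 1}

def prism : Set (Fin 3 → ℝ) :=
  {x | 0 < x 0 ∧ 0 < x 1 ∧ x 0 + x 1 < 1 ∧ 0 < x 2 ∧ x 2 < 1}

/-! Polynomial spaces. -/

/-- The monomial function with exponents `e`. -/
def monoFun {N : ℕ} (e : Fin N → ℕ) : Scal N := fun x => ∏ k, x k ^ e k

/-- `P^p` in `N` variables: polynomials of total degree at most `p`. -/
def polyP (N p : ℕ) : Submodule ℝ (Scal N) :=
  Submodule.span ℝ {f | ∃ e : Fin N → ℕ, ∑ k, e k ≤ p ∧ f = monoFun e}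

/-- Homogeneous polynomials of degree `p` in `N` variables. -/
def polyHom (N p : ℕ) : Submodule ℝ (Scal N) :=
  Submodule.span ℝ {f | ∃ e : Fin N → ℕ, ∑ k, e k = p ∧ f = monoFun e}

/-- `Q^{d_1,…,d_N}`: polynomials of degree at most `d_k` in the `k`-th variable. -/
def polyQ {N : ℕ} (d : Fin N → ℕ) : Submodule ℝ (Scal N) :=
  Submodule.span ℝ {f | ∃ e : Fin N → ℕ, (∀ k, e k ≤ d k) ∧ f = monoFun e}

/-- `S_1 × ⋯ × S_N`: vector functions whose `k`-th component lies in `S k`. -/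
def compSpace {N : ℕ} (S : Fin N → Submodule ℝ (Scal N)) : Submodule ℝ (Vec N) where
  carrier := {F | ∀ k, (fun x => F x k) ∈ S k}
  add_mem' := fun hF hG k => (S k).add_mem (hF k) (hG k)
  zero_mem' := fun k => (S k).zero_mem
  smul_mem' := fun c _ hF k => (S k).smul_mem c (hF k)

/-- Vector fields `E` with `x · E(x) = 0` for all `x`. -/
def radialOrth (N : ℕ) : Submodule ℝ (Vec N) where
  carrier := {E | ∀ x, x ⬝ᵥ E x = 0}
  add_mem' := fun {F G} hF hG x => by
    have h1 := hF x
    have h2 := hG x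
    simp [dotProduct_add, h1, h2]
  zero_mem' := fun x => by simp
  smul_mem' := fun c F hF x => by
    have h1 := hF x
    simp [dotProduct_smul, h1]

/-- Vector fields `φ(x) x` with `φ` in `S`. -/
def radial {N : ℕ} (S : Submodule ℝ (Scal N)) : Submodule ℝ (Vec N) where
  carrier := {V | ∃ φ ∈ S, V = fun x => φ x • x}
  add_mem' := by
    rintro _ _ ⟨φ, hφ, rfl⟩ ⟨ψ, hψ, rfl⟩
    exact ⟨φ + ψ, S.add_mem hφ hψ, by funext x; simp [add_smul]⟩
  zero_mem' := ⟨0, S.zero_mem, by funext x; simp⟩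
  smul_mem' := by
    rintro c _ ⟨φ, hφ, rfl⟩
    exact ⟨c • φ, S.smul_mem c hφ, by funext x; simp [mul_smul]⟩

/-- The Nédélec space of the first kind `N^p` on simplices. -/
def nedelec (N p : ℕ) : Submodule ℝ (Vec N) :=
  compSpace (fun _ => polyP N (p - 1)) ⊔ (compSpace (fun _ => polyHom N p) ⊓ radialOrth N)

/-- The Raviart-Thomas space `RT^p` on simplices. -/
def raviartThomas (N p : ℕ) : Submodule ℝ (Vec N) :=
  compSpace (fun _ => polyP N (p - 1)) ⊔ radial (polyHom N (p - 1))

/-- `S ⊗ P^q(z)` for a space `S` of functions of `(x,y)`: sums of products `g(z) f(x,y)`. -/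
def tensorZ {W : Type} [AddCommGroup W] [Module ℝ W]
    (S : Submodule ℝ ((Fin 2 → ℝ) → W)) (q : ℕ) : Submodule ℝ ((Fin 3 → ℝ) → W) :=
  Submodule.span ℝ {h | ∃ f ∈ S, ∃ g ∈ polyP 1 q, h = fun x => g ![x 2] • f ![x 0, x 1]}

/-- `T × S`: vector functions with first two components in `T` and third component in `S`. -/
def prismProd (T : Submodule ℝ ((Fin 3 → ℝ) → (Fin 2 → ℝ))) (S : Submodule ℝ (Scal 3)) :
    Submodule ℝ (Vec 3) where
  carrier := {F | (fun x => ![F x 0, F x 1]) ∈ T ∧ (fun x => F x 2) ∈ S}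
  add_mem' := fun {F G} hF hG => by
    refine ⟨?_, S.add_mem hF.2 hG.2⟩
    have h := T.add_mem hF.1 hG.1
    convert h using 1
    funext x
    simp
  zero_mem' := by
    refine ⟨?_, S.zero_mem⟩
    convert T.zero_mem using 1
    funext x i
    fin_cases i <;> simp
  smul_mem' := fun c F hF => by
    refine ⟨?_, S.smul_mem c hF.2⟩
    have h := T.smul_mem c hF.1
    convert h using 1
    funext x
    simp

/-! Index sets. -/

/-- Pairs `(i,j)` with `i ≥ i₀`, `j ≥ j₀`, `i + j ≤ n`. -/
def triIdx (i₀ j₀ n : ℕ) : Finset (ℕ × ℕ) :=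
  (range (n + 1) ×ˢ range (n + 1)).filter fun q => i₀ ≤ q.1 ∧ j₀ ≤ q.2 ∧ q.1 + q.2 ≤ n

/-- Triples `(i,j,k)` with `i ≥ i₀`, `j ≥ j₀`, `k ≥ k₀`, `i + j + k ≤ n`. -/
def tetIdx (i₀ j₀ k₀ n : ℕ) : Finset (ℕ × ℕ × ℕ) :=
  (range (n + 1) ×ˢ range (n + 1) ×ˢ range (n + 1)).filter fun q =>
    i₀ ≤ q.1 ∧ j₀ ≤ q.2.1 ∧ k₀ ≤ q.2.2 ∧ q.1 + q.2.1 + q.2.2 ≤ n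

/-- Vertex pairs `a < b`. -/
abbrev Edges (n : ℕ) := {e : Fin n × Fin n // e.1 < e.2}

/-- Vertex triples `a < b < c`. -/
abbrev Faces (n : ℕ) := {e : Fin n × Fin n × Fin n // e.1 < e.2.1 ∧ e.2.1 < e.2.2}

/-! Segment, order `p`. -/

abbrev SegH1Idx (p : ℕ) := Fin 2 ⊕ Icc 2 p

def segH1 (p : ℕ) : SegH1Idx p → Scal 1
  | .inl a => mu 0 a
  | .inr i => phiE i.1 (mu 0)

abbrev SegL2Idx (p : ℕ) := Fin p

def segL2 (p : ℕ) : SegL2Idx p → Scal 1 :=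
  fun i => hom (legendreP i.1) (mu 0 0) (mu 0 1) * fun x => grad (mu 0 1) x 0

/-! Quadrilateral, orders `P 0`, `P 1`; the other direction of `a : Fin 2` is `a + 1`. -/

abbrev QuadH1Idx (P : Fin 2 → ℕ) :=
  (Fin 2 × Fin 2) ⊕ (Σ a : Fin 2, Fin 2 × Icc 2 (P a)) ⊕ (Icc 2 (P 0) × Icc 2 (P 1))

def quadH1 (P : Fin 2 → ℕ) : QuadH1Idx P → Scal 2
  | .inl (a, b) => mu 0 a * mu 1 b
  | .inr (.inl ⟨a, c, i⟩) => mu (a + 1) c * phiE i.1 (mu a)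
  | .inr (.inr (i, j)) => phiQ i.1 j.1 (mu 0) (mu 1)

abbrev QuadCurlIdx (P : Fin 2 → ℕ) :=
  (Σ a : Fin 2, Fin 2 × Fin (P a)) ⊕ (Σ a : Fin 2, Fin (P a) × Icc 2 (P (a + 1)))

def quadCurl (P : Fin 2 → ℕ) : QuadCurlIdx P → Vec 2
  | .inl ⟨a, c, i⟩ => mulVec (mu (a + 1) c) (fieldE i.1 (mu a))
  | .inr ⟨a, i, j⟩ => fieldQ i.1 j.1 (mu a) (mu (a + 1))

def quadDiv (P : Fin 2 → ℕ) : QuadCurlIdx P → Vec 2 := fun i => rot (quadCurl P i)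

abbrev QuadL2Idx (P : Fin 2 → ℕ) := Fin (P 0) × Fin (P 1)

def quadL2 (P : Fin 2 → ℕ) : QuadL2Idx P → Scal 2
  | (i, j) => hom (legendreP i.1) (mu 0 0) (mu 0 1) * hom (legendreP j.1) (mu 1 0) (mu 1 1)
      * cross2 (grad (mu 0 1)) (grad (mu 1 1))

/-! Triangle, order `p`. -/

abbrev TriH1Idx (p : ℕ) := Fin 3 ⊕ (Edges 3 × Icc 2 p) ⊕ triIdx 2 1 p

def triH1 (p : ℕ) : TriH1Idx p → Scal 2
  | .inl a => nu 0 1 a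
  | .inr (.inl (e, i)) => phiE i.1 (pick2 (nu 0 1) e.1.1 e.1.2)
  | .inr (.inr q) => phiT q.1.1 q.1.2 (nu 0 1)

abbrev TriCurlIdx (p : ℕ) :=
  (Edges 3 × Fin p) ⊕ triIdx 0 1 (p - 1) ⊕ triIdx 0 1 (p - 1)

def triCurl (p : ℕ) : TriCurlIdx p → Vec 2
  | .inl (e, i) => fieldE i.1 (pick2 (nu 0 1) e.1.1 e.1.2)
  | .inr (.inl q) => fieldT q.1.1 q.1.2 (pick3 (nu 0 1) 0 1 2)
  | .inr (.inr q) => fieldT q.1.1 q.1.2 (pick3 (nu 0 1) 1 2 0)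

def triDiv (p : ℕ) : TriCurlIdx p → Vec 2 := fun i => rot (triCurl p i)

abbrev TriL2Idx (p : ℕ) := triIdx 0 0 (p - 1)

def triL2 (p : ℕ) : TriL2Idx p → Scal 2 :=
  fun q => polyT q.1.1 q.1.2 (nu 0 1) * cross2 (grad (nu 0 1 1)) (grad (nu 0 1 2))

/-! Hexahedron, orders `P 0`, `P 1`, `P 2`; `(a, a + 1, a + 2)` runs through the cyclic
permutations of the directions. -/

abbrev HexH1Idx (P : Fin 3 → ℕ) :=
  (Fin 2 × Fin 2 × Fin 2) ⊕ (Σ a : Fin 3, Fin 2 × Fin 2 × Icc 2 (P a))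
    ⊕ (Σ a : Fin 3, Fin 2 × Icc 2 (P a) × Icc 2 (P (a + 1)))
    ⊕ (Icc 2 (P 0) × Icc 2 (P 1) × Icc 2 (P 2))

def hexH1 (P : Fin 3 → ℕ) : HexH1Idx P → Scal 3
  | .inl (a, b, c) => mu 0 a * mu 1 b * mu 2 c
  | .inr (.inl ⟨a, d, e, i⟩) => mu (a + 2) e * mu (a + 1) d * phiE i.1 (mu a)
  | .inr (.inr (.inl ⟨a, d, i, j⟩)) => mu (a + 2) d * phiQ i.1 j.1 (mu a) (mu (a + 1))
  | .inr (.inr (.inr (i, j, k))) => phiQ i.1 j.1 (mu 0) (mu 1) * phiE k.1 (mu 2)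

abbrev HexCurlIdx (P : Fin 3 → ℕ) :=
  (Σ a : Fin 3, Fin 2 × Fin 2 × Fin (P a))
    ⊕ (Σ a : Fin 3, Fin 2 × Fin (P a) × Icc 2 (P (a + 1)))
    ⊕ (Σ a : Fin 3, Fin 2 × Fin (P (a + 1)) × Icc 2 (P a))
    ⊕ (Σ a : Fin 3, Fin (P a) × Icc 2 (P (a + 1)) × Icc 2 (P (a + 2)))

def hexCurl (P : Fin 3 → ℕ) : HexCurlIdx P → Vec 3
  | .inl ⟨a, d, e, i⟩ => mulVec (mu (a + 2) e * mu (a + 1) d) (fieldE i.1 (mu a))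
  | .inr (.inl ⟨a, d, i, j⟩) => mulVec (mu (a + 2) d) (fieldQ i.1 j.1 (mu a) (mu (a + 1)))
  | .inr (.inr (.inl ⟨a, d, i, j⟩)) => mulVec (mu (a + 2) d) (fieldQ i.1 j.1 (mu (a + 1)) (mu a))
  | .inr (.inr (.inr ⟨a, i, j, k⟩)) =>
      mulVec (phiE k.1 (mu (a + 2))) (fieldQ i.1 j.1 (mu a) (mu (a + 1)))

abbrev HexDivIdx (P : Fin 3 → ℕ) :=
  (Σ a : Fin 3, Fin 2 × Fin (P a) × Fin (P (a + 1)))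
    ⊕ (Σ a : Fin 3, Fin (P a) × Fin (P (a + 1)) × Icc 2 (P (a + 2)))

def hexDiv (P : Fin 3 → ℕ) : HexDivIdx P → Vec 3
  | .inl ⟨a, d, i, j⟩ => mulVec (mu (a + 2) d) (fluxQ i.1 j.1 (mu a) (mu (a + 1)))
  | .inr ⟨a, i, j, k⟩ => mulVec (phiE k.1 (mu (a + 2))) (fluxQ i.1 j.1 (mu a) (mu (a + 1)))

abbrev HexL2Idx (P : Fin 3 → ℕ) := Fin (P 0) × Fin (P 1) × Fin (P 2)

def hexL2 (P : Fin 3 → ℕ) : HexL2Idx P → Scal 3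
  | (i, j, k) => hom (legendreP i.1) (mu 0 0) (mu 0 1) * hom (legendreP j.1) (mu 1 0) (mu 1 1)
      * hom (legendreP k.1) (mu 2 0) (mu 2 1)
      * dotF (cross3 (grad (mu 0 1)) (grad (mu 1 1))) (grad (mu 2 1))

/-! Tetrahedron, order `p`. The interior families use the vertex cycles
`(a,b,c,d) = (m, m+1, m+2, m+3)` modulo 4 with `m = 0, 1, 2`. -/

abbrev TetH1Idx (p : ℕ) :=
  Fin 4 ⊕ (Edges 4 × Icc 2 p) ⊕ (Faces 4 × triIdx 2 1 p) ⊕ tetIdx 2 1 1 p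

def tetH1 (p : ℕ) : TetH1Idx p → Scal 3
  | .inl a => lam a
  | .inr (.inl (e, i)) => phiE i.1 (pick2 lam e.1.1 e.1.2)
  | .inr (.inr (.inl (f, q))) => phiT q.1.1 q.1.2 (pick3 lam f.1.1 f.1.2.1 f.1.2.2)
  | .inr (.inr (.inr q)) => phiT q.1.1 q.1.2.1 (pick3 lam 0 1 2)
      * hom (jacobiL ((2 * (q.1.1 + q.1.2.1) : ℕ) : ℝ) q.1.2.2) (1 - lam 3) (lam 3)

abbrev TetCurlIdx (p : ℕ) :=
  (Edges 4 × Fin p) ⊕ (Faces 4 × triIdx 0 1 (p - 1)) ⊕ (Faces 4 × triIdx 0 1 (p - 1))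
    ⊕ (Fin 3 × tetIdx 0 1 1 (p - 1))

def tetCurl (p : ℕ) : TetCurlIdx p → Vec 3
  | .inl (e, i) => fieldE i.1 (pick2 lam e.1.1 e.1.2)
  | .inr (.inl (f, q)) => fieldT q.1.1 q.1.2 (pick3 lam f.1.1 f.1.2.1 f.1.2.2)
  | .inr (.inr (.inl (f, q))) => fieldT q.1.1 q.1.2 (pick3 lam f.1.2.1 f.1.2.2 f.1.1)
  | .inr (.inr (.inr (m, q))) =>
      let a : Fin 4 := m.castSucc
      mulVec (hom (jacobiL ((2 * (q.1.1 + q.1.2.1) : ℕ) : ℝ) q.1.2.2)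
          (1 - lam (a + 3)) (lam (a + 3)))
        (fieldT q.1.1 q.1.2.1 (pick3 lam a (a + 1) (a + 2)))

abbrev TetDivIdx (p : ℕ) := (Faces 4 × triIdx 0 0 (p - 1)) ⊕ (Fin 3 × tetIdx 0 0 1 (p - 1))

def tetDiv (p : ℕ) : TetDivIdx p → Vec 3
  | .inl (f, q) => fluxT q.1.1 q.1.2 (pick3 lam f.1.1 f.1.2.1 f.1.2.2)
  | .inr (m, q) =>
      let a : Fin 4 := m.castSucc
      mulVec (hom (jacobiL ((2 * (q.1.1 + q.1.2.1 + 1) : ℕ) : ℝ) q.1.2.2)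
          (1 - lam (a + 3)) (lam (a + 3)))
        (fluxT q.1.1 q.1.2.1 (pick3 lam a (a + 1) (a + 2)))

abbrev TetL2Idx (p : ℕ) := tetIdx 0 0 0 (p - 1)

def tetL2 (p : ℕ) : TetL2Idx p → Scal 3 :=
  fun q => polyT q.1.1 q.1.2.1 (pick3 lam 0 1 2)
    * hom (jacobiP ((2 * (q.1.1 + q.1.2.1 + 1) : ℕ) : ℝ) q.1.2.2) (1 - lam 3) (lam 3)
    * dotF (cross3 (grad (lam 1)) (grad (lam 2))) (grad (lam 3))

/-! Prism, orders `P.1` (triangle) and `P.2` (third coordinate). -/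

abbrev PriH1Idx (P : ℕ × ℕ) :=
  (Fin 3 × Fin 2) ⊕ (Fin 2 × Edges 3 × Icc 2 P.1) ⊕ (Fin 3 × Icc 2 P.2)
    ⊕ (Fin 2 × triIdx 2 1 P.1) ⊕ (Edges 3 × Icc 2 P.1 × Icc 2 P.2) ⊕ (triIdx 2 1 P.1 × Icc 2 P.2)

def priH1 (P : ℕ × ℕ) : PriH1Idx P → Scal 3
  | .inl (a, c) => nu 0 1 a * mu 2 c
  | .inr (.inl (c, e, i)) => mu 2 c * phiE i.1 (pick2 (nu 0 1) e.1.1 e.1.2)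
  | .inr (.inr (.inl (a, i))) => nu 0 1 a * phiE i.1 (mu 2)
  | .inr (.inr (.inr (.inl (c, q)))) => mu 2 c * phiT q.1.1 q.1.2 (nu 0 1)
  | .inr (.inr (.inr (.inr (.inl (e, i, j))))) =>
      phiQ i.1 j.1 (pick2 (nu 0 1) e.1.1 e.1.2) (mu 2)
  | .inr (.inr (.inr (.inr (.inr (q, k))))) => phiT q.1.1 q.1.2 (nu 0 1) * phiE k.1 (mu 2)

/-- The two triangle families `E_ij^Δ(ν₀,ν₁,ν₂)`, `E_ij^Δ(ν₁,ν₂,ν₀)` on the prism. -/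
def priFieldT (m : Fin 2) (i j : ℕ) : Vec 3 :=
  fieldT i j (![pick3 (nu 0 1) 0 1 2, pick3 (nu 0 1) 1 2 0] m)

abbrev PriCurlIdx (P : ℕ × ℕ) :=
  (Fin 2 × Edges 3 × Fin P.1) ⊕ (Fin 3 × Fin P.2)
    ⊕ (Fin 2 × Fin 2 × triIdx 0 1 (P.1 - 1))
    ⊕ (Edges 3 × Fin P.1 × Icc 2 P.2) ⊕ (Edges 3 × Fin P.2 × Icc 2 P.1)
    ⊕ (Fin 2 × triIdx 0 1 (P.1 - 1) × Icc 2 P.2) ⊕ (triIdx 2 1 P.1 × Fin P.2)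

def priCurl (P : ℕ × ℕ) : PriCurlIdx P → Vec 3
  | .inl (c, e, i) => mulVec (mu 2 c) (fieldE i.1 (pick2 (nu 0 1) e.1.1 e.1.2))
  | .inr (.inl (a, i)) => mulVec (nu 0 1 a) (fieldE i.1 (mu 2))
  | .inr (.inr (.inl (c, m, q))) => mulVec (mu 2 c) (priFieldT m q.1.1 q.1.2)
  | .inr (.inr (.inr (.inl (e, i, j)))) =>
      fieldQ i.1 j.1 (pick2 (nu 0 1) e.1.1 e.1.2) (mu 2)
  | .inr (.inr (.inr (.inr (.inl (e, i, j))))) =>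
      fieldQ i.1 j.1 (mu 2) (pick2 (nu 0 1) e.1.1 e.1.2)
  | .inr (.inr (.inr (.inr (.inr (.inl (m, q, k)))))) =>
      mulVec (phiE k.1 (mu 2)) (priFieldT m q.1.1 q.1.2)
  | .inr (.inr (.inr (.inr (.inr (.inr (q, k)))))) =>
      mulVec (phiT q.1.1 q.1.2 (nu 0 1)) (fieldE k.1 (mu 2))

abbrev PriDivIdx (P : ℕ × ℕ) :=
  (Fin 2 × triIdx 0 0 (P.1 - 1)) ⊕ (Edges 3 × Fin P.1 × Fin P.2)
    ⊕ (Fin 2 × triIdx 0 1 (P.1 - 1) × Fin P.2) ⊕ (triIdx 0 0 (P.1 - 1) × Icc 2 P.2)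

def priDiv (P : ℕ × ℕ) : PriDivIdx P → Vec 3
  | .inl (c, q) => mulVec (mu 2 c) (fluxT q.1.1 q.1.2 (nu 0 1))
  | .inr (.inl (e, i, j)) => fluxQ i.1 j.1 (pick2 (nu 0 1) e.1.1 e.1.2) (mu 2)
  | .inr (.inr (.inl (m, q, k))) => cross3 (priFieldT m q.1.1 q.1.2) (fieldE k.1 (mu 2))
  | .inr (.inr (.inr (q, k))) => mulVec (phiE k.1 (mu 2)) (fluxT q.1.1 q.1.2 (nu 0 1))

abbrev PriL2Idx (P : ℕ × ℕ) := triIdx 0 0 (P.1 - 1) × Fin P.2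

def priL2 (P : ℕ × ℕ) : PriL2Idx P → Scal 3
  | (q, k) => polyT q.1.1 q.1.2 (nu 0 1) * hom (legendreP k.1) (mu 2 0) (mu 2 1)
      * dotF (cross3 (grad (nu 0 1 1)) (grad (nu 0 1 2))) (grad (mu 2 1))

/-! The basis property. -/

/-- For every order `P ≥ 1` (in each direction), the family `f P` lies in `S P`, is linearly
independent already as a family of functions on the master element `K`, and spans `S P`; the
number of its members and the dimension of `S P` are both `dim P`; and raising the order only adds
members. -/
structure IsHierarchicalBasis {O : Type} [Preorder O] [One O] {N : ℕ}
    {W : Type} [AddCommGroup W] [Module ℝ W] {ι : O → Type}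
    (K : Set (Fin N → ℝ)) (f : (P : O) → ι P → (Fin N → ℝ) → W)
    (S : O → Submodule ℝ ((Fin N → ℝ) → W)) (dim : O → ℕ) : Prop where
  mem : ∀ P, 1 ≤ P → ∀ i, f P i ∈ S P
  linearIndependent : ∀ P, 1 ≤ P → LinearIndependent ℝ fun i => K.domRestrict (f P i)
  span_eq : ∀ P, 1 ≤ P → Submodule.span ℝ (Set.range (f P)) = S P
  count : ∀ P, 1 ≤ P → Nat.card (ι P) = dim P
  finrank_eq : ∀ P, 1 ≤ P → Module.finrank ℝ (S P) = dim P
  hierarchical : ∀ P P', 1 ≤ P → P ≤ P' → Set.range (f P) ⊆ Set.range (f P')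

end

end ShapeFunctions

/-! Orthogonality of the Legendre and Jacobi polynomials plays no role. What is used is algebraic:
P_i(x;t) and P_j^α(x;t), α ≥ 0, are homogeneous and the pure power of x has a nonzero coefficient
(`legendreP_hasLead`, `jacobiP_hasLead`); their integrals from 0 carry a factor x; and L_i with i ≥
2 also vanishes at x = t, so it carries x(t - x) (`legendreL_add_two`). Hence every shape function
on a simplex is a product of some barycentric coordinates (a bubble), possibly a Whitney edge or
face field, and homogenized polynomials with nonzero leading terms.

It suffices to prove that each family spans its space and that the number of its members is at most
the dimension. A spanning family of that size is independent, and a polynomial that vanishes on an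
open box inside the master element is zero, so independence survives restriction
(`IsHierarchicalBasis.of_span`). The hierarchy is immediate: the formula of a shape function does
not involve the order, only the index sets grow.

Spanning on a simplex is a triangular elimination. Let V be the span of the barycentric coordinates
s_a, which contains 1. The nested arguments (s_a, s_b), (s_a + s_b, s_c), (1 - s_d, s_d) match the
flag s_b, s_a + s_b, s_a + s_b + s_c, 1 of V, and the products of the three homogenized factors have
monomials in this flag as leading terms; so they generate V^n (`span_pow_le_of_interior`). With
bubbles included, the interior functions exhaust bubble times V^m. Face functions generate what
belongs to a face modulo multiples of the opposite coordinate, which are already known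
(`span_pow_le_of_face`), edge functions likewise modulo two coordinates (`span_pow_le_of_edge`), and
the vertex functions complete the argument (`span_pow_le_of_H1`). For vector functions the same
scheme runs with coefficients of fixed Whitney fields; the fields for which no interior family is
listed come from the linear relations among Whitney fields (`mulVec_whitneyEdge_mem_of_curl`,
`mulVec_whitneyFace_mem_of_div`).

The Nédélec space is generated over P^(p-1) by the constant fields and the fields x_k e_l - x_l e_k,
because homogeneous fields orthogonal to x are Koszul combinations (`inf_radialOrth_le`); the
Raviart-Thomas space is generated by the constant fields and x. These generators and the Whitney
fields of the unit simplex are combinations of each other with constant coefficients. The dimension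
of the Nédélec space is bounded below by rank-nullity (`le_finrank_nedelec`).

Segment and triangle are the same four-coordinate statements with missing coordinates set to 0,
which annihilates every function attached to a missing vertex. Quadrilateral and hexahedron use
products of functions of one variable; the prism uses the tensor product of triangle and segment,
with dimension bounded below by a Vandermonde argument (`finrank_mul_le_finrank_tensorZ`). Planar
H(div) is the rotation of planar H(curl). -/

namespace ShapeFunctions

open Finset

/-! ### Homogeneous polynomials in two real variables -/

/-- `f` is a homogeneous polynomial of degree `n` in `(x, t)`, and `x ^ n` has coefficient `a`. -/
def HasLead (n : ℕ) (a : ℝ) (f : ℝ → ℝ → ℝ) : Prop :=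
  ∃ c : ℕ → ℝ, c n = a ∧ ∀ x t, f x t = ∑ k ∈ range (n + 1), c k * x ^ k * t ^ (n - k)

namespace HasLead

variable {n : ℕ} {a b : ℝ} {f g : ℝ → ℝ → ℝ}

theorem congr (hf : HasLead n a f) (h : ∀ x t, g x t = f x t) : HasLead n a g := by
  obtain ⟨c, hc, hf⟩ := hf
  exact ⟨c, hc, fun x t => (h x t).trans (hf x t)⟩

theorem one : HasLead 0 1 fun _ _ => 1 := ⟨fun _ => 1, rfl, fun x t => by simp⟩

theorem add (hf : HasLead n a f) (hg : HasLead n b g) :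
    HasLead n (a + b) fun x t => f x t + g x t := by
  obtain ⟨c, hc, hf⟩ := hf
  obtain ⟨d, hd, hg⟩ := hg
  refine ⟨fun k => c k + d k, by simp [hc, hd], fun x t => ?_⟩
  dsimp only
  rw [hf, hg, ← sum_add_distrib]
  exact sum_congr rfl fun k _ => by ring

theorem const_mul (r : ℝ) (hf : HasLead n a f) : HasLead n (r * a) fun x t => r * f x t := by
  obtain ⟨c, hc, hf⟩ := hf
  refine ⟨fun k => r * c k, by simp [hc], fun x t => ?_⟩
  dsimp only
  rw [hf, mul_sum]
  exact sum_congr rfl fun k _ => by ring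

theorem mul_x (hf : HasLead n a f) : HasLead (n + 1) a fun x t => x * f x t := by
  obtain ⟨c, hc, hf⟩ := hf
  refine ⟨fun k => if k = 0 then 0 else c (k - 1), hc, fun x t => ?_⟩
  dsimp only
  rw [hf, sum_range_succ' _ (n + 1), mul_sum]
  simp only [if_true, zero_mul, add_zero, Nat.add_sub_add_right, Nat.succ_ne_zero, if_false, Nat.add_sub_cancel]
  exact sum_congr rfl fun k _ => by ring

/-- A factor t destroys the pure power of x. In the three-term recursions this leaves only x times
the previous polynomial to determine the leading coefficient. -/
theorem mul_t (hf : HasLead n a f) : HasLead (n + 1) 0 fun x t => t * f x t := by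
  obtain ⟨c, hc, hf⟩ := hf
  refine ⟨fun k => if k ≤ n then c k else 0, by simp, fun x t => ?_⟩
  dsimp only
  rw [hf, sum_range_succ _ (n + 1), mul_sum]
  simp only [show ¬ (n + 1 ≤ n) by omega, if_false, zero_mul, add_zero]
  refine sum_congr rfl fun k hk => ?_
  have hk : k ≤ n := by simpa [Nat.lt_succ_iff] using hk
  rw [if_pos hk, Nat.succ_sub hk, pow_succ]
  ring

theorem sum {ι : Type*} (s : Finset ι) (A : ι → ℝ) (F : ι → ℝ → ℝ → ℝ)
    (h : ∀ i ∈ s, HasLead n (A i) (F i)) :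
    HasLead n (∑ i ∈ s, A i) fun x t => ∑ i ∈ s, F i x t := by
  classical
  induction s using Finset.induction_on with
  | empty => exact ⟨fun _ => 0, by simp, fun x t => by simp⟩
  | insert i s hi ih =>
    have := (h i (mem_insert_self i s)).add (ih fun j hj => h j (mem_insert_of_mem hj))
    rw [sum_insert hi]
    exact this.congr fun x t => by rw [sum_insert hi]

theorem mul_t_pow (m : ℕ) (hf : HasLead n a f) :
    HasLead (n + m) (if m = 0 then a else 0) fun x t => t ^ m * f x t := by
  induction m with
  | zero => simpa using hf
  | succ m ih =>
    rw [if_neg m.succ_ne_zero]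
    exact ih.mul_t.congr fun x t => by ring

/-- The substitution `x ↦ t - x`. -/
theorem reflect (hf : HasLead n a f) : HasLead n ((-1) ^ n * a) fun x t => f (t - x) t := by
  obtain ⟨c, hc, hf⟩ := hf
  have hpow : ∀ k, HasLead k ((-1) ^ k) fun x t => (t - x) ^ k := by
    intro k
    induction k with
    | zero => exact one.congr fun x t => by simp
    | succ k ih =>
      have := ih.mul_t.add (ih.mul_x.const_mul (-1))
      rw [zero_add, ← pow_succ'] at this
      exact this.congr fun x t => by ring
  -- Only the term k = n has no factor t, so it alone contributes to the coefficient of x^n.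
  have key : ∀ k ∈ range (n + 1), HasLead n (if k = n then (-1) ^ n * a else 0)
      fun x t => c k * (t - x) ^ k * t ^ (n - k) := by
    intro k hk
    have hk : k ≤ n := by simpa [Nat.lt_succ_iff] using hk
    have h := ((hpow k).mul_t_pow (n - k)).const_mul (c k)
    rw [Nat.add_sub_cancel' hk] at h
    convert h.congr (g := fun x t => c k * (t - x) ^ k * t ^ (n - k)) (fun x t => by ring) using 1
    rcases eq_or_ne k n with rfl | hne
    · simp [hc, mul_comm]
    · rw [if_neg hne, if_neg (by omega), mul_zero]
  have h := HasLead.sum _ _ _ key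
  rw [sum_ite_eq' (range (n + 1)) n, if_pos (by simp)] at h
  exact h.congr fun x t => hf _ _

/-- Integrating x^k t^(n-k) from 0 leaves a factor x and a homogeneous quotient of the same degree
n; division by n + 1 keeps a nonzero leading coefficient nonzero. -/
theorem integral (hf : HasLead n a f) :
    ∃ g, HasLead n (a / (n + 1)) g ∧ ∀ x t, ∫ y in (0 : ℝ)..x, f y t = x * g x t := by
  obtain ⟨c, hc, hf⟩ := hf
  refine ⟨fun x t => ∑ k ∈ range (n + 1), c k / (k + 1) * x ^ k * t ^ (n - k),
    ⟨fun k => c k / (k + 1), by simp [hc], fun x t => rfl⟩, fun x t => ?_⟩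
  simp_rw [hf]
  rw [intervalIntegral.integral_finsetSum fun k _ =>
    (Continuous.intervalIntegrable (by fun_prop) _ _), mul_sum]
  refine sum_congr rfl fun k _ => ?_
  rw [intervalIntegral.integral_mul_const, intervalIntegral.integral_const_mul, integral_pow]
  rw [zero_pow k.succ_ne_zero]
  field_simp
  ring

/-- A homogeneous polynomial that vanishes at `x = t = 1` is divisible by `t - x`. -/
theorem exists_eq_mul (hf : HasLead (n + 1) a f) (h : f 1 1 = 0) :
    ∃ g, HasLead n (-a) g ∧ ∀ x t, f x t = (t - x) * g x t := by
  obtain ⟨c, hc, hf⟩ := hf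
  have hs : ∑ k ∈ range (n + 2), c k = 0 := by simpa [hf] using h
  -- Comparing coefficients in (t - x) g = f asks for d_k - d_(k-1) = c_k, so the coefficients of
  -- the quotient are partial sums. The full sum is f(1,1) = 0, which gives d_n = -c_(n+1) = -a.
  let d : ℕ → ℝ := fun k => ∑ l ∈ range (k + 1), c l
  have hd : d n = -a := by
    rw [sum_range_succ, hc] at hs
    simp only [d]; linarith
  refine ⟨fun x t => ∑ k ∈ range (n + 1), d k * x ^ k * t ^ (n - k), ⟨d, hd, fun _ _ => rfl⟩,
    fun x t => ?_⟩
  have e1 : t * ∑ k ∈ range (n + 1), d k * x ^ k * t ^ (n - k)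
      = ∑ k ∈ range (n + 1), d k * x ^ k * t ^ (n + 1 - k) := by
    rw [mul_sum]
    refine sum_congr rfl fun k hk => ?_
    have hk : k ≤ n := by simpa [Nat.lt_succ_iff] using hk
    rw [Nat.succ_sub hk, pow_succ]
    ring
  have e2 : x * ∑ k ∈ range (n + 1), d k * x ^ k * t ^ (n - k)
      = (∑ k ∈ range (n + 1), (d k - c k) * x ^ k * t ^ (n + 1 - k)) - a * x ^ (n + 1) := by
    have h0 : (d 0 - c 0) * x ^ 0 * t ^ (n + 1 - 0) = 0 := by simp [d]
    rw [sum_range_succ' (fun k => (d k - c k) * x ^ k * t ^ (n + 1 - k)) n, h0, add_zero,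
      sum_range_succ, hd, mul_add, mul_sum]
    have : ∀ k ∈ range n, x * (d k * x ^ k * t ^ (n - k))
        = (d (k + 1) - c (k + 1)) * x ^ (k + 1) * t ^ (n + 1 - (k + 1)) := by
      intro k _
      have : d (k + 1) = d k + c (k + 1) := sum_range_succ _ _
      rw [this, Nat.add_sub_add_right]
      ring
    rw [sum_congr rfl this]
    simp
    ring
  rw [hf, sub_mul, e1, e2, sum_range_succ, hc]
  simp only [sub_mul, sum_sub_distrib, Nat.sub_self, pow_zero, mul_one]
  ring

end HasLead

/-! ### Legendre and Jacobi polynomials -/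

/-- The recursion multiplies the leading coefficient by 2(2n+3)/(n+2); all other terms contain t.
Two consecutive degrees are carried because the recursion has two steps. -/
theorem legendreP_hasLead (n : ℕ) : ∃ a, a ≠ 0 ∧ HasLead n a (legendreP n) := by
  suffices h : (∃ a, 0 < a ∧ HasLead n a (legendreP n)) ∧
      ∃ a, 0 < a ∧ HasLead (n + 1) a (legendreP (n + 1)) by
    obtain ⟨⟨a, ha, h⟩, -⟩ := h
    exact ⟨a, ha.ne', h⟩
  induction n with
  | zero =>
    refine ⟨⟨1, one_pos, HasLead.one.congr fun x t => by simp [legendreP]⟩, 2, two_pos, ?_⟩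
    have := (HasLead.one.mul_x.const_mul 2).add (HasLead.one.mul_t.const_mul (-1))
    norm_num at this
    exact this.congr fun x t => by simp [legendreP]; ring
  | succ n ih =>
    refine ⟨ih.2, ?_⟩
    obtain ⟨⟨b, -, hb⟩, a, ha, h⟩ := ih
    refine ⟨2 * (2 * n + 3) / (n + 2) * a, by positivity, ?_⟩
    have := ((h.mul_x.const_mul (2 * (2 * n + 3) / (n + 2))).add
      (h.mul_t.const_mul (-(2 * n + 3) / (n + 2)))).add
      (hb.mul_t.mul_t.const_mul (-(n + 1) / (n + 2)))
    simp only [mul_zero, add_zero] at this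
    refine this.congr fun x t => ?_
    simp only [legendreP]
    ring

/-- The leading coefficient is multiplied by 2 b_j c_j / a_j; for α ≥ 0 and j ≥ 2 every factor,
including the denominator, is positive. -/
theorem jacobiP_hasLead {α : ℝ} (hα : 0 ≤ α) (n : ℕ) :
    ∃ a, a ≠ 0 ∧ HasLead n a (jacobiP α n) := by
  suffices h : (∃ a, 0 < a ∧ HasLead n a (jacobiP α n)) ∧
      ∃ a, 0 < a ∧ HasLead (n + 1) a (jacobiP α (n + 1)) by
    obtain ⟨⟨a, ha, h⟩, -⟩ := h
    exact ⟨a, ha.ne', h⟩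
  induction n with
  | zero =>
    refine ⟨⟨1, one_pos, HasLead.one.congr fun x t => by simp [jacobiP]⟩, 2 + α, by positivity, ?_⟩
    have := (HasLead.one.mul_x.const_mul (2 + α)).add (HasLead.one.mul_t.const_mul (-1))
    simp only [mul_zero, mul_one, add_zero] at this
    exact this.congr fun x t => by simp [jacobiP]; ring
  | succ n ih =>
    refine ⟨ih.2, ?_⟩
    obtain ⟨⟨b, -, hb⟩, a, ha, h⟩ := ih
    set j : ℝ := (n : ℝ) + 2 with hj
    have hj2 : 2 ≤ j := by simp [hj]
    have p1 : 0 < 2 * j + α - 1 := by linarith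
    have p2 : 0 < 2 * j + α - 2 := by linarith
    have p3 : 0 < 2 * j + α := by linarith
    have p4 : 0 < j + α := by linarith
    have p5 : 0 < j := by linarith
    set e : ℝ := 2 * j * (j + α) * (2 * j + α - 2) with he
    have p6 : 0 < e := by positivity
    set A : ℝ := 2 * j + α - 1
    set B : ℝ := 2 * j + α - 2
    refine ⟨2 * A * (2 * j + α) * B / e * a, by positivity, ?_⟩
    have := ((h.mul_x.const_mul (2 * A * (2 * j + α) * B / e)).add
      (h.mul_t.const_mul (A * (α ^ 2 - (2 * j + α) * B) / e))).add
      (hb.mul_t.mul_t.const_mul (-(2 * (j + α - 1) * (j - 1) * (2 * j + α)) / e))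
    simp only [mul_zero, add_zero] at this
    refine this.congr fun x t => ?_
    change (A * ((2 * j + α) * B * (2 * x - t) + α ^ 2 * t) * jacobiP α (n + 1) x t
          - 2 * (j + α - 1) * (j - 1) * (2 * j + α) * t ^ 2 * jacobiP α n x t) / e = _
    ring

theorem jacobiL_succ {α : ℝ} (hα : 0 ≤ α) (n : ℕ) :
    ∃ g a, a ≠ 0 ∧ HasLead n a g ∧ ∀ x t, jacobiL α (n + 1) x t = x * g x t := by
  obtain ⟨a, ha, h⟩ := jacobiP_hasLead hα n
  obtain ⟨g, hg, hL⟩ := h.integral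
  exact ⟨g, _, div_ne_zero ha (by positivity), hg, hL⟩

theorem legendreP_differentiable (t : ℝ) (n : ℕ) : Differentiable ℝ fun y => legendreP n y t := by
  obtain ⟨a, -, c, -, h⟩ := legendreP_hasLead n
  simp_rw [h]
  fun_prop

/-- The two identities need each other in the induction: the differentiated recursion plus n + 1
times the first identity gives n + 2 times the second one at the next index, and the first one at
the next index then follows with the recursion itself. -/
theorem legendreP_deriv (t : ℝ) (n : ℕ) (y : ℝ) :
    ((2 * y - t) * deriv (fun y => legendreP (n + 1) y t) y
        - t ^ 2 * deriv (fun y => legendreP n y t) y = 2 * (n + 1) * legendreP (n + 1) y t) ∧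
      deriv (fun y => legendreP (n + 1) y t) y
        - (2 * y - t) * deriv (fun y => legendreP n y t) y = 2 * (n + 1) * legendreP n y t := by
  have hrec (n : ℕ) : (n + 2) * deriv (fun y => legendreP (n + 2) y t) y
      = (2 * n + 3) * (2 * legendreP (n + 1) y t
          + (2 * y - t) * deriv (fun y => legendreP (n + 1) y t) y)
        - (n + 1) * t ^ 2 * deriv (fun y => legendreP n y t) y := by
    have h1 := (legendreP_differentiable t (n + 1) y).hasDerivAt
    have h0 := (legendreP_differentiable t n y).hasDerivAt
    have hX : HasDerivAt (fun y : ℝ => 2 * y - t) 2 y := by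
      simpa using ((hasDerivAt_id y).const_mul 2).sub_const t
    have h2 := ((((hX.mul h1).const_mul (2 * (n : ℝ) + 3)).sub
      (h0.const_mul ((n + 1) * t ^ 2))).div_const ((n : ℝ) + 2)).deriv
    have e : (fun y => legendreP (n + 2) y t) = fun y => ((2 * (n : ℝ) + 3) * ((2 * y - t)
        * legendreP (n + 1) y t) - (n + 1) * t ^ 2 * legendreP n y t) / ((n : ℝ) + 2) := by
      funext y
      simp only [legendreP]
      ring
    rw [e]
    refine (congrArg (((n : ℝ) + 2) * ·) h2).trans ?_
    field_simp
  induction n with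
  | zero =>
    have h1 : deriv (fun y => legendreP 1 y t) y = 2 := by
      have hX : HasDerivAt (fun y : ℝ => 2 * y - t) 2 y := by
        simpa using ((hasDerivAt_id y).const_mul 2).sub_const t
      simp [legendreP, hX.deriv]
    have h0 : deriv (fun y => legendreP 0 y t) y = 0 := by simp [legendreP]
    simp only [zero_add, h0, h1]
    constructor
    · simp [legendreP]
      ring
    · simp [legendreP]
  | succ n ih =>
    obtain ⟨ha, hb⟩ := ih
    have h2 := hrec n
    have hP : ((n : ℝ) + 2) * legendreP (n + 2) y t = (2 * n + 3) * (2 * y - t)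
        * legendreP (n + 1) y t - (n + 1) * t ^ 2 * legendreP n y t := by
      simp only [legendreP]
      field_simp
      ring
    have hn : (n : ℝ) + 2 ≠ 0 := by positivity
    set D2 := deriv (fun y => legendreP (n + 2) y t) y
    set D1 := deriv (fun y => legendreP (n + 1) y t) y
    set D0 := deriv (fun y => legendreP n y t) y
    change (2 * y - t) * D2 - t ^ 2 * D1 = 2 * (((n + 1 : ℕ) : ℝ) + 1) * legendreP (n + 2) y t ∧
      D2 - (2 * y - t) * D1 = 2 * (((n + 1 : ℕ) : ℝ) + 1) * legendreP (n + 1) y t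
    push_cast
    have hb' : D2 - (2 * y - t) * D1 = 2 * ((n : ℝ) + 1 + 1) * legendreP (n + 1) y t := by
      apply mul_left_cancel₀ hn
      linear_combination h2 + (n + 1) * ha
    refine ⟨?_, hb'⟩
    linear_combination (2 * y - t) * hb' + (2 * y - t) * ha - t ^ 2 * hb - 2 * hP

theorem legendreP_self (n : ℕ) (t : ℝ) : legendreP n t t = t ^ n := by
  induction n using Nat.twoStepInduction with
  | zero => simp [legendreP]
  | one => simp [legendreP]; ring
  | more n h0 h1 =>
    simp only [legendreP, h0, h1]
    field_simp
    ring

theorem legendreP_zero_left (n : ℕ) (t : ℝ) : legendreP n 0 t = (-t) ^ n := by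
  induction n using Nat.twoStepInduction with
  | zero => simp [legendreP]
  | one => simp [legendreP]
  | more n h0 h1 =>
    simp only [legendreP, h0, h1]
    field_simp
    ring

/-- A primitive of P_(n+1) is (P_(n+2) - t² P_n) / (2(2n+3)), obtained by adding one identity of
`legendreP_deriv` at n + 1 to the other at n. It vanishes at both endpoints, since P_n(t;t) = t^n
and P_n(0;t) = (-t)^n. -/
theorem legendreL_self (n : ℕ) (t : ℝ) : legendreL (n + 2) t t = 0 := by
  have hd : ∀ y, HasDerivAt
      (fun y => (legendreP (n + 2) y t - t ^ 2 * legendreP n y t) / (2 * (2 * n + 3)))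
      (legendreP (n + 1) y t) y := by
    intro y
    have h2 := (legendreP_differentiable t (n + 2) y).hasDerivAt
    have h0 := (legendreP_differentiable t n y).hasDerivAt
    refine ((h2.sub (h0.const_mul (t ^ 2))).div_const (2 * (2 * (n : ℝ) + 3))).congr_deriv ?_
    symm
    rw [eq_div_iff (by positivity)]
    have e1 := (legendreP_deriv t (n + 1) y).2
    have e2 := (legendreP_deriv t n y).1
    push_cast at e1
    linear_combination -e1 - e2
  change ∫ y in (0 : ℝ)..t, legendreP (n + 1) y t = 0
  rw [intervalIntegral.integral_eq_sub_of_hasDerivAt (fun y _ => hd y)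
    ((legendreP_differentiable t (n + 1)).continuous.intervalIntegrable _ _)]
  simp only [legendreP_self, legendreP_zero_left]
  ring

/-- After homogenization x and t - x become the two coordinates of an edge, so this splits off the
edge bubble and leaves a quotient that again has a nonzero leading term. -/
theorem legendreL_add_two (n : ℕ) :
    ∃ g a, a ≠ 0 ∧ HasLead n a g ∧ ∀ x t, legendreL (n + 2) x t = x * (t - x) * g x t := by
  obtain ⟨a, ha, h⟩ := legendreP_hasLead (n + 1)
  obtain ⟨g, hg, hL⟩ := h.integral
  have h1 : g 1 1 = 0 := by simpa [legendreL_self] using (hL 1 1).symm.trans (legendreL_self n 1)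
  obtain ⟨q, hq, hgq⟩ := hg.exists_eq_mul h1
  refine ⟨q, _, neg_ne_zero.mpr (div_ne_zero ha (by positivity)), hq, fun x t => ?_⟩
  change ∫ y in (0 : ℝ)..x, legendreP (n + 1) y t = _
  rw [hL, hgq, mul_assoc]

/-! ### Spanning powers of a space of functions by products with leading terms -/

section Elimination

variable {N : ℕ}

/-- The variable t turns into s₀ + s₁; this sum, rather than s₀, is the lower-order generator in the
elimination. -/
theorem HasLead.hom_eq {n : ℕ} {a : ℝ} {f : ℝ → ℝ → ℝ} (hf : HasLead n a f) :
    ∃ c : ℕ → ℝ, c n = a ∧ ∀ s₀ s₁ : Scal N,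
      hom f s₀ s₁ = ∑ k ∈ range (n + 1), c k • (s₁ ^ k * (s₀ + s₁) ^ (n - k)) := by
  obtain ⟨c, hc, h⟩ := hf
  refine ⟨c, hc, fun s₀ s₁ => ?_⟩
  funext y
  simp [hom, h, mul_assoc]

theorem HasLead.hom_mem {n : ℕ} {a : ℝ} {f : ℝ → ℝ → ℝ} (hf : HasLead n a f)
    {V : Submodule ℝ (Scal N)} {s₀ s₁ : Scal N} (h₀ : s₀ ∈ V) (h₁ : s₁ ∈ V) :
    hom f s₀ s₁ ∈ V ^ n := by
  obtain ⟨c, -, h⟩ := hf.hom_eq (N := N)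
  rw [h]
  refine Submodule.sum_mem _ fun k hk => Submodule.smul_mem _ _ ?_
  have hk : k ≤ n := by simpa [Nat.lt_succ_iff] using hk
  rw [← Nat.add_sub_cancel' hk, pow_add V, Nat.add_sub_cancel' hk]
  exact Submodule.mul_mem_mul (Submodule.pow_mem_pow _ h₁ _)
    (Submodule.pow_mem_pow _ (V.add_mem h₀ h₁) _)

/-- The n-th power of span {x} ⊔ V is the sum of the spaces x^i V^(n-i). One factor is split at a
time and absorbed into the target space, which is why U is generalized in the induction. -/
theorem sup_span_pow_le {V U : Submodule ℝ (Scal N)} {x : Scal N} {n : ℕ}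
    (h : ∀ i ≤ n, ∀ g ∈ V ^ (n - i), x ^ i * g ∈ U) : (Submodule.span ℝ {x} ⊔ V) ^ n ≤ U := by
  induction n generalizing U with
  | zero =>
    intro f hf
    simpa using h 0 le_rfl f (by simpa using hf)
  | succ n ih =>
    rw [pow_succ, Submodule.mul_le]
    intro f hf v hv
    obtain ⟨y, hy, v', hv', rfl⟩ := Submodule.mem_sup.mp hv
    obtain ⟨r, rfl⟩ := Submodule.mem_span_singleton.mp hy
    rw [mul_add]
    refine U.add_mem ?_ ?_
    · rw [mul_smul_comm]
      refine U.smul_mem _ ?_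
      have := ih (U := U.comap (LinearMap.mulRight ℝ x)) fun i hi g hg => by
        have := h (i + 1) (by omega) g (by rwa [Nat.add_sub_add_right])
        simpa [pow_succ, mul_right_comm] using this
      exact this hf
    · have := ih (U := U.comap (LinearMap.mulRight ℝ v')) fun i hi g hg => by
        have := h i (by omega) (g * v') (by
          rw [Nat.succ_sub hi, pow_succ]; exact Submodule.mul_mem_mul hg hv')
        simpa [mul_assoc] using this
      exact this hf

/-- Triangular elimination: A_i is a nonzero multiple of s₁^i plus terms s₁^k (s₀ + s₁)^(i-k) with k
< i. As s₀ + s₁ lies in V, the surplus power joins the cofactor in V^(n-k), and the lower terms are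
known by strong induction. -/
theorem sup_span_pow_le_of_lead {V U : Submodule ℝ (Scal N)} {s₀ s₁ : Scal N} {n : ℕ}
    (ht : s₀ + s₁ ∈ V) {A : ℕ → ℝ → ℝ → ℝ} (hA : ∀ i, ∃ a, a ≠ 0 ∧ HasLead i a (A i))
    (h : ∀ i ≤ n, ∀ g ∈ V ^ (n - i), hom (A i) s₀ s₁ * g ∈ U) :
    (Submodule.span ℝ {s₁} ⊔ V) ^ n ≤ U := by
  apply sup_span_pow_le
  intro i
  induction i using Nat.strong_induction_on with
  | _ i ih =>
    intro hi g hg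
    obtain ⟨a, ha, hAi⟩ := hA i
    obtain ⟨c, hc, he⟩ := hAi.hom_eq (N := N)
    have h1 := h i hi g hg
    rw [he, sum_range_succ, add_mul, sum_mul] at h1
    have h2 : ∑ k ∈ range i, c k • (s₁ ^ k * (s₀ + s₁) ^ (i - k)) * g ∈ U := by
      refine U.sum_mem fun k hk => ?_
      have hk : k < i := by simpa using hk
      rw [smul_mul_assoc, mul_assoc]
      refine U.smul_mem _ (ih k hk (by omega) _ ?_)
      rw [show n - k = (i - k) + (n - i) by omega, pow_add]
      exact Submodule.mul_mem_mul (Submodule.pow_mem_pow _ ht _) hg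
    have h3 := (U.add_mem_iff_right h2).mp h1
    rw [Nat.sub_self, pow_zero, mul_one, smul_mul_assoc, hc] at h3
    exact (U.smul_mem_iff ha).mp h3

/-- Since t = s₀ + s₁, the substitution x ↦ t - x exchanges the arguments. It turns leading powers
of the second argument into leading powers of the first. -/
theorem hom_reflect (f : ℝ → ℝ → ℝ) (s₀ s₁ : Scal N) :
    hom (fun x t => f (t - x) t) s₀ s₁ = hom f s₁ s₀ := by
  funext y
  simp [hom, add_comm]

theorem exists_hasLead_reflect {B : ℕ → ℝ → ℝ → ℝ} (hB : ∀ j, ∃ b, b ≠ 0 ∧ HasLead j b (B j)) :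
    ∀ j, ∃ b, b ≠ 0 ∧ HasLead j b fun x t => B j (t - x) t := by
  intro j
  obtain ⟨b, hb, h⟩ := hB j
  exact ⟨_, mul_ne_zero (pow_ne_zero _ (by norm_num)) hb, h.reflect⟩

/-- Variant in which the leading terms are powers of `s₀`. -/
theorem sup_span_pow_le_of_lead' {V U : Submodule ℝ (Scal N)} {s₀ s₁ : Scal N} {n : ℕ}
    (ht : s₀ + s₁ ∈ V) {A : ℕ → ℝ → ℝ → ℝ} (hA : ∀ i, ∃ a, a ≠ 0 ∧ HasLead i a (A i))
    (h : ∀ i ≤ n, ∀ g ∈ V ^ (n - i), hom (A i) s₀ s₁ * g ∈ U) :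
    (Submodule.span ℝ {s₀} ⊔ V) ^ n ≤ U := by
  refine sup_span_pow_le_of_lead (s₀ := s₁) (A := fun i x t => A i (t - x) t)
    (by rwa [add_comm]) (exists_hasLead_reflect hA) fun i hi g hg => ?_
  rw [hom_reflect]
  exact h i hi g hg

/-- The functions `g` with `f * g ∈ U`. -/
def mulComap (U : Submodule ℝ (Scal N)) (f : Scal N) : Submodule ℝ (Scal N) :=
  U.comap (LinearMap.mulLeft ℝ f)

theorem mem_mulComap {U : Submodule ℝ (Scal N)} {f g : Scal N} :
    g ∈ mulComap U f ↔ f * g ∈ U := Iff.rfl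

theorem one_pow_le {U : Submodule ℝ (Scal N)} {n : ℕ} (h : (1 : Scal N) ∈ U) :
    (1 : Submodule ℝ (Scal N)) ^ n ≤ U := by
  rw [one_pow]
  exact Submodule.one_le.mpr h

end Elimination

/-! ### Barycentric coordinates -/

section Barycentric

variable {N : ℕ}

/-- The four indices are distinct. -/
abbrev Distinct4 (a b c d : Fin 4) : Prop := a ≠ b ∧ a ≠ c ∧ a ≠ d ∧ b ≠ c ∧ b ≠ d ∧ c ≠ d

theorem Distinct4.cover {a b c d : Fin 4} (h : Distinct4 a b c d) (i : Fin 4) :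
    i = a ∨ i = b ∨ i = c ∨ i = d := by
  obtain ⟨h1, h2, h3, h4, h5, h6⟩ := h
  omega

theorem Distinct4.sum_eq {a b c d : Fin 4} (h : Distinct4 a b c d) {M : Type*} [AddCommMonoid M]
    (s : Fin 4 → M) : s a + s b + s c + s d = ∑ i, s i := by
  have hu : (univ : Finset (Fin 4)) = {a, b, c, d} := by
    ext i
    simpa using h.cover i
  obtain ⟨h1, h2, h3, h4, h5, h6⟩ := h
  rw [hu, sum_insert (by simp [*]), sum_insert (by simp [*]), sum_insert (by simp [*]),
    sum_singleton]
  simp only [add_assoc]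

theorem exists_distinct4 {a b c : Fin 4} (h1 : a ≠ b) (h2 : a ≠ c) (h3 : b ≠ c) :
    ∃ d, Distinct4 a b c d := by
  revert a b c
  decide

variable {s : Fin 4 → Scal N} {V U : Submodule ℝ (Scal N)} {n : ℕ}
  {A : ℕ → ℝ → ℝ → ℝ} {B : ℕ → ℕ → ℝ → ℝ → ℝ} {C : ℕ → ℕ → ℕ → ℝ → ℝ → ℝ}

/-- The flag is adapted to the nested arguments (s_a, s_b), (s_a + s_b, s_c), (1 - s_d, s_d): the
sum of each pair is s_a + s_b, s_a + s_b + s_c, 1 respectively, that is, the generator that remains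
after the current elimination. -/
theorem span_range_le_flag (hs : ∑ i, s i = 1) {a b c d : Fin 4} (h : Distinct4 a b c d) :
    Submodule.span ℝ (Set.range s) ≤ Submodule.span ℝ {s b} ⊔ (Submodule.span ℝ {s a + s b} ⊔
      (Submodule.span ℝ {s a + s b + s c} ⊔ 1)) := by
  rw [← h.sum_eq s] at hs
  set F := Submodule.span ℝ {s b} ⊔ (Submodule.span ℝ {s a + s b} ⊔
      (Submodule.span ℝ {s a + s b + s c} ⊔ 1)) with hF
  have hb : s b ∈ F := Submodule.mem_sup_left (Submodule.mem_span_singleton_self _)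
  have hab : s a + s b ∈ F := Submodule.mem_sup_right
    (Submodule.mem_sup_left (Submodule.mem_span_singleton_self _))
  have habc : s a + s b + s c ∈ F := Submodule.mem_sup_right (Submodule.mem_sup_right
    (Submodule.mem_sup_left (Submodule.mem_span_singleton_self _)))
  have h1 : (1 : Scal N) ∈ F := Submodule.mem_sup_right (Submodule.mem_sup_right
    (Submodule.mem_sup_right (Submodule.one_le.mp le_rfl)))
  rw [Submodule.span_le]
  rintro _ ⟨i, rfl⟩
  rcases h.cover i with rfl | rfl | rfl | rfl
  · simpa using F.sub_mem hab hb
  · exact hb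
  · simpa using F.sub_mem habc hab
  · have := F.sub_mem h1 habc
    rwa [← hs, add_sub_cancel_left] at this

theorem flag_le (hV : ∀ i, s i ∈ V) (h1 : 1 ∈ V) {a b c : Fin 4} :
    Submodule.span ℝ {s a + s b} ⊔ (Submodule.span ℝ {s a + s b + s c} ⊔ 1) ≤ V := by
  simp only [sup_le_iff, Submodule.span_singleton_le_iff_mem, Submodule.one_le]
  exact ⟨V.add_mem (hV a) (hV b), V.add_mem (V.add_mem (hV a) (hV b)) (hV c), h1⟩

theorem one_mem_span_range (hs : ∑ i, s i = 1) : (1 : Scal N) ∈ Submodule.span ℝ (Set.range s) := by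
  rw [← hs]
  exact Submodule.sum_mem _ fun i _ => Submodule.subset_span ⟨i, rfl⟩

/-- Three eliminations along the flag. The first uses powers of the second argument s_b; the other
two use powers of the first arguments s_a + s_b and 1 - s_d, hence the reflected variant. At the end
only powers of 1 are left. -/
theorem span_pow_le_of_interior (hs : ∑ i, s i = 1) {a b c d : Fin 4} (h : Distinct4 a b c d)
    (hA : ∀ i, ∃ r, r ≠ 0 ∧ HasLead i r (A i)) (hB : ∀ i j, ∃ r, r ≠ 0 ∧ HasLead j r (B i j))
    (hC : ∀ i j k, ∃ r, r ≠ 0 ∧ HasLead k r (C i j k))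
    (hU : ∀ i j k, i + j + k ≤ n → hom (A i) (s a) (s b) * hom (B i j) (s a + s b) (s c)
      * hom (C i j k) (1 - s d) (s d) ∈ U) :
    Submodule.span ℝ (Set.range s) ^ n ≤ U := by
  refine (pow_le_pow_left' (span_range_le_flag hs h) n).trans ?_
  have hd : s a + s b + s c = 1 - s d := by rw [← hs, ← h.sum_eq s]; simp
  refine sup_span_pow_le_of_lead
    (Submodule.mem_sup_left (Submodule.mem_span_singleton_self _)) hA fun i hi => ?_
  refine sup_span_pow_le_of_lead' (s₁ := s c) (U := mulComap U (hom (A i) (s a) (s b)))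
    (Submodule.mem_sup_left (Submodule.mem_span_singleton_self _)) (hB i) fun j hj => ?_
  rw [hd]
  refine sup_span_pow_le_of_lead' (s₁ := s d)
    (U := mulComap (mulComap U (hom (A i) (s a) (s b)))
      (hom (B i j) (s a + s b) (s c)))
    (by simp [(Submodule.one_le.mp le_rfl)]) (hC i j) fun k hk => ?_
  intro g hg
  refine one_pow_le (U := mulComap (mulComap (mulComap U (hom (A i) (s a) (s b)))
    (hom (B i j) (s a + s b) (s c))) (hom (C i j k) (1 - s d) (s d))) ?_ hg
  simpa only [mem_mulComap, mul_one, mul_assoc] using hU i j k (by omega)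

/-- After two eliminations the remaining generator is s_a + s_b + s_c = 1 - s_d. It equals 1 modulo
multiples of s_d, and these multiples are supplied by `hd`, the interior contribution. -/
theorem span_pow_le_of_face (hs : ∑ i, s i = 1) {a b c d : Fin 4} (h : Distinct4 a b c d)
    (hA : ∀ i, ∃ r, r ≠ 0 ∧ HasLead i r (A i)) (hB : ∀ i j, ∃ r, r ≠ 0 ∧ HasLead j r (B i j))
    (hU : ∀ i j, i + j ≤ n → hom (A i) (s a) (s b) * hom (B i j) (s a + s b) (s c) ∈ U)
    (hd : ∀ m, m + 1 ≤ n → ∀ g ∈ Submodule.span ℝ (Set.range s) ^ m, s d * g ∈ U) :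
    Submodule.span ℝ (Set.range s) ^ n ≤ U := by
  refine (pow_le_pow_left' (span_range_le_flag hs h) n).trans ?_
  set V := Submodule.span ℝ (Set.range s) with hV
  have hsV : ∀ i, s i ∈ V := fun i => Submodule.subset_span ⟨i, rfl⟩
  have h1V : (1 : Scal N) ∈ V := one_mem_span_range hs
  have hu : s a + s b + s c = 1 - s d := by rw [← hs, ← h.sum_eq s]; simp
  refine sup_span_pow_le_of_lead
    (Submodule.mem_sup_left (Submodule.mem_span_singleton_self _)) hA fun i hi => ?_
  refine sup_span_pow_le_of_lead' (s₁ := s c) (U := mulComap U (hom (A i) (s a) (s b)))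
    (Submodule.mem_sup_left (Submodule.mem_span_singleton_self _)) (hB i) fun j hj => ?_
  rw [hu]
  refine sup_span_pow_le (U := mulComap (mulComap U (hom (A i) (s a) (s b)))
      (hom (B i j) (s a + s b) (s c)))
    fun k => ?_
  induction k with
  | zero =>
    intro _ g hg
    rw [pow_zero, one_mul]
    refine one_pow_le (U := mulComap (mulComap U (hom (A i) (s a) (s b)))
      (hom (B i j) (s a + s b) (s c))) ?_ hg
    simpa only [mem_mulComap, mul_one] using hU i j (by omega)
  | succ k ih =>
    intro hk g hg
    rw [one_pow] at hg
    have h1 : hom (A i) (s a) (s b) * (hom (B i j) (s a + s b) (s c) * ((1 - s d) ^ k * g)) ∈ U :=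
      ih (by omega) g (by rwa [one_pow])
    obtain ⟨r, rfl⟩ := Submodule.mem_one.mp hg
    obtain ⟨_, -, hAi⟩ := hA i
    obtain ⟨_, -, hBij⟩ := hB i j
    -- The correction in (1 - s_d)^(k+1) = (1 - s_d)^k - s_d (1 - s_d)^k; its cofactor has degree i
    -- + j + k ≤ n - 1, within the range of `hd`.
    have h2 := hd (i + j + k) (by omega)
      (hom (A i) (s a) (s b) * hom (B i j) (s a + s b) (s c) * (1 - s d) ^ k) (by
        rw [pow_add, pow_add]
        exact Submodule.mul_mem_mul (Submodule.mul_mem_mul (hAi.hom_mem (hsV _) (hsV _))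
          (hBij.hom_mem (V.add_mem (hsV _) (hsV _)) (hsV _)))
          (Submodule.pow_mem_pow _ (V.sub_mem h1V (hsV _)) _))
    have h3 := U.sub_mem h1 (U.smul_mem r h2)
    rw [mem_mulComap, mem_mulComap]
    convert h3 using 1
    simp only [Algebra.smul_def]
    ring

/-- Modulo multiples of s_c and s_d, both s_a + s_b and s_a + s_b + s_c equal 1. So after one
elimination the remaining generators can be removed one by one, each step costing multiples of s_c
and s_d in lower degree. -/
theorem span_pow_le_of_edge (hs : ∑ i, s i = 1) {a b c d : Fin 4} (h : Distinct4 a b c d)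
    (hA : ∀ i, ∃ r, r ≠ 0 ∧ HasLead i r (A i))
    (hU : ∀ i ≤ n, hom (A i) (s a) (s b) ∈ U)
    (hc : ∀ m, m + 1 ≤ n → ∀ g ∈ Submodule.span ℝ (Set.range s) ^ m, s c * g ∈ U)
    (hd : ∀ m, m + 1 ≤ n → ∀ g ∈ Submodule.span ℝ (Set.range s) ^ m, s d * g ∈ U) :
    Submodule.span ℝ (Set.range s) ^ n ≤ U := by
  refine (pow_le_pow_left' (span_range_le_flag hs h) n).trans ?_
  set V := Submodule.span ℝ (Set.range s) with hV
  have hsV : ∀ i, s i ∈ V := fun i => Submodule.subset_span ⟨i, rfl⟩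
  have h1V : (1 : Scal N) ∈ V := one_mem_span_range hs
  refine sup_span_pow_le_of_lead
    (Submodule.mem_sup_left (Submodule.mem_span_singleton_self _)) hA fun i hi g hg => ?_
  set F := Submodule.span ℝ {s a + s b} ⊔ (Submodule.span ℝ {s a + s b + s c} ⊔ 1)
  have hFV : F ≤ V := flag_le hsV h1V
  obtain ⟨_, -, hAi⟩ := hA i
  have hAV : hom (A i) (s a) (s b) ∈ V ^ i := hAi.hom_mem (hsV _) (hsV _)
  have key : ∀ m, i + m ≤ n → ∀ g ∈ F ^ m, hom (A i) (s a) (s b) * g ∈ U := by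
    intro m
    induction m with
    | zero =>
      intro hm g hg
      refine one_pow_le (n := 0) (U := mulComap U (hom (A i) (s a) (s b))) ?_ (by simpa using hg)
      simpa only [mem_mulComap, mul_one] using hU i (by omega)
    | succ m ih =>
      intro hm g hg
      have hle : F ^ (m + 1) ≤ mulComap U (hom (A i) (s a) (s b)) := by
        rw [pow_succ, Submodule.mul_le]
        intro g hg v hv
        have h0 : hom (A i) (s a) (s b) * g ∈ U := ih (by omega) g hg
        have hgV : hom (A i) (s a) (s b) * g ∈ V ^ (i + m) := by
          rw [pow_add]
          exact Submodule.mul_mem_mul hAV (pow_le_pow_left' hFV m hg)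
        have h1 := hc (i + m) (by omega) _ hgV
        have h2 := hd (i + m) (by omega) _ hgV
        have hlin : F ≤ mulComap U (hom (A i) (s a) (s b) * g) := by
          have hsum : s a + s b + s c + s d = 1 := by rw [← hs, h.sum_eq s]
          have e2 : s a + s b + s c = 1 - s d := by rw [← hsum]; ring
          have e1 : s a + s b = 1 - s d - s c := by rw [← e2]; ring
          simp only [F, sup_le_iff, Submodule.span_singleton_le_iff_mem, Submodule.one_le]
          rw [e2, e1]
          simp only [mem_mulComap]
          refine ⟨?_, ?_, ?_⟩
          · convert U.sub_mem (U.sub_mem h0 h2) h1 using 1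
            ring
          · convert U.sub_mem h0 h2 using 1
            ring
          · simpa only [mul_one] using h0
        have := hlin hv
        simpa only [mem_mulComap, mul_assoc] using this
      exact hle hg
  exact key (n - i) (by omega) g hg

end Barycentric

/-! ### Shape functions in barycentric coordinates -/

section Factor

/-- With x = s 1 and t = s 0 + s 1 the factor x(t - x) is the edge bubble. The quotients q are
chosen once for all edges and dimensions, so that they can serve as the sequence A of the
elimination lemmas. -/
theorem exists_phiE_factor : ∃ q : ℕ → ℝ → ℝ → ℝ, (∀ i, ∃ a, a ≠ 0 ∧ HasLead i a (q i)) ∧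
    ∀ (i : ℕ) {N : ℕ} (s : Fin 2 → Scal N),
      phiE (i + 2) s = s 0 * s 1 * hom (q i) (s 0) (s 1) := by
  choose q a ha hq h using legendreL_add_two
  refine ⟨q, fun i => ⟨a i, ha i, hq i⟩, fun i N s => ?_⟩
  funext x
  simp only [phiE, hom, h, Pi.mul_apply, add_sub_cancel_right]
  ring

theorem exists_jacobiL_factor : ∃ q : ℕ → ℕ → ℝ → ℝ → ℝ,
    (∀ m j, ∃ a, a ≠ 0 ∧ HasLead j a (q m j)) ∧ ∀ (m j : ℕ) {N : ℕ} (s₀ s₁ : Scal N),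
      hom (jacobiL (m : ℝ) (j + 1)) s₀ s₁ = s₁ * hom (q m j) s₀ s₁ := by
  choose q a ha hq h using fun m : ℕ => jacobiL_succ (Nat.cast_nonneg (α := ℝ) m)
  refine ⟨q, fun m j => ⟨a m j, ha m j, hq m j⟩, fun m j N s₀ s₁ => ?_⟩
  funext x
  simp [hom, h]

theorem jacobiP_nat_hasLead (m j : ℕ) : ∃ a, a ≠ 0 ∧ HasLead j a (jacobiP (m : ℝ) j) :=
  jacobiP_hasLead (Nat.cast_nonneg m) j

end Factor

section Symmetry

/-- The two adjacent transpositions generate all permutations of three letters. -/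
theorem forall_distinct_of_sorted {Q : Fin 4 → Fin 4 → Fin 4 → Prop}
    (h₁ : ∀ a b c, Q a b c → Q b a c) (h₂ : ∀ a b c, Q a b c → Q a c b)
    (h : ∀ a b c, a < b → b < c → Q a b c) (a b c : Fin 4) (hab : a ≠ b) (hac : a ≠ c)
    (hbc : b ≠ c) : Q a b c := by
  rcases hab.lt_or_gt with hab | hab <;> rcases hac.lt_or_gt with hac | hac <;>
    rcases hbc.lt_or_gt with hbc | hbc
  · exact h _ _ _ hab hbc
  · exact h₂ _ _ _ (h _ _ _ hac hbc)
  · exact absurd (hab.trans hbc) hac.asymm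
  · exact h₂ _ _ _ (h₁ _ _ _ (h _ _ _ hac hab))
  · exact h₁ _ _ _ (h _ _ _ hab hac)
  · exact absurd (hac.trans hbc) hab.asymm
  · exact h₁ _ _ _ (h₂ _ _ _ (h _ _ _ hbc hac))
  · exact h₁ _ _ _ (h₂ _ _ _ (h₁ _ _ _ (h _ _ _ hbc hab)))

end Symmetry

/-! ### Scalar spaces: H¹ and L² functions in four barycentric coordinates -/

section Scalar

variable {N : ℕ} {s : Fin 4 → Scal N} {U : Submodule ℝ (Scal N)}

/-- A monomial in the coordinates either contains two different ones, and is given by `h1`, or is a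
pure power; since the coordinates sum to 1, a pure power reduces to one of lower degree and mixed
products. -/
theorem span_pow_le_of_vertex (hs : ∑ i, s i = 1) {p : ℕ} (h0 : ∀ a, s a ∈ U)
    (h1 : ∀ a b, a ≠ b → ∀ m, m + 2 ≤ p → ∀ f ∈ Submodule.span ℝ (Set.range s) ^ m,
      s a * s b * f ∈ U) {k : ℕ} (hk : k + 1 ≤ p) :
    Submodule.span ℝ (Set.range s) ^ (k + 1) ≤ U := by
  induction k with
  | zero =>
    rw [zero_add, pow_one, Submodule.span_le]
    rintro _ ⟨i, rfl⟩
    exact h0 i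
  | succ k ih =>
    have ih := ih (by omega)
    have key : ∀ i j, ∀ f ∈ Submodule.span ℝ (Set.range s) ^ k, s i * s j * f ∈ U := by
      intro i j f hf
      rcases eq_or_ne i j with rfl | hij
      -- This is s_i = s_i (Σ_j s_j), solved for the square of s_i.
      · have e : s i * s i * f = f * s i - ∑ j ∈ univ.erase i, s i * s j * f := by
          rw [← sum_mul, ← mul_sum, eq_sub_of_add_eq' (add_sum_erase univ s (mem_univ i)), hs]
          ring
        rw [e]
        refine U.sub_mem (ih ?_) (U.sum_mem fun j hj => h1 i j ?_ k hk f hf)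
        · rw [pow_succ]
          exact Submodule.mul_mem_mul hf (Submodule.subset_span ⟨i, rfl⟩)
        · exact (ne_of_mem_erase hj).symm
      · exact h1 i j hij k hk f hf
    rw [pow_succ, Submodule.mul_le]
    intro g hg v hv
    have hV : Submodule.span ℝ (Set.range s) ≤ mulComap U g := by
      rw [Submodule.span_le]
      rintro _ ⟨i, rfl⟩
      have : Submodule.span ℝ (Set.range s) ^ (k + 1) ≤ mulComap U (s i) := by
        rw [pow_succ, Submodule.mul_le]
        intro f hf v' hv'
        have hV' : Submodule.span ℝ (Set.range s) ≤ mulComap U (s i * f) := by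
          rw [Submodule.span_le]
          rintro _ ⟨j, rfl⟩
          have := key i j f hf
          rwa [mul_right_comm] at this
        have := hV' hv'
        rw [mem_mulComap] at this ⊢
        rwa [← mul_assoc]
      have := this hg
      change g * s i ∈ U
      rw [mem_mulComap] at this
      rwa [mul_comm]
    exact hV hv

/-- Stratification by bubbles: the interior functions give s_0 s_1 s_2 s_3 V^m with m + 4 ≤ p, then
the face functions give s_a s_b s_c V^m with m + 3 ≤ p, the edge functions s_a s_b V^m with m + 2 ≤
p, and the vertices the rest. Each stratum may be corrected by the previous ones. The coordinates
need not be independent, so some of them may be 0. -/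
theorem span_pow_le_of_H1 (hs : ∑ i, s i = 1) {p : ℕ} (hp : 1 ≤ p) (hV : ∀ a, s a ∈ U)
    (hE : ∀ a b, a < b → ∀ i, 2 ≤ i → i ≤ p → phiE i (pick2 s a b) ∈ U)
    (hF : ∀ a b c, a < b → b < c → ∀ i j, 2 ≤ i → 1 ≤ j → i + j ≤ p →
      phiT i j (pick3 s a b c) ∈ U)
    (hI : ∀ i j k, 2 ≤ i → 1 ≤ j → 1 ≤ k → i + j + k ≤ p → phiT i j (pick3 s 0 1 2)
      * hom (jacobiL ((2 * (i + j) : ℕ) : ℝ) k) (1 - s 3) (s 3) ∈ U) :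
    Submodule.span ℝ (Set.range s) ^ p ≤ U := by
  obtain ⟨q, hq, hφ⟩ := exists_phiE_factor
  obtain ⟨r, hr, hL⟩ := exists_jacobiL_factor
  have hT : ∀ i j a b c, phiT (i + 2) (j + 1) (pick3 s a b c) = s a * s b * s c
      * (hom (q i) (s a) (s b) * hom (r (2 * (i + 2)) j) (s a + s b) (s c)) := by
    intro i j a b c
    change phiE (i + 2) (pick2 s a b)
      * hom (jacobiL ((2 * (i + 2) : ℕ) : ℝ) (j + 1)) (s a + s b) (s c) = _
    rw [hφ, hL]
    change s a * s b * hom (q i) (s a) (s b) * _ = _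
    ring
  have int : ∀ m, m + 4 ≤ p → ∀ f ∈ Submodule.span ℝ (Set.range s) ^ m,
      s 0 * s 1 * s 2 * s 3 * f ∈ U := by
    intro m hm f hf
    -- The bubble is moved into the target space. It takes up degrees 2, 1, 1 of the three factors,
    -- so the Jacobi parameters are those of the shifted indices i + 2 and j + 1.
    refine span_pow_le_of_interior (U := mulComap U (s 0 * s 1 * s 2 * s 3)) hs
      (a := 0) (b := 1) (c := 2) (d := 3) (by decide) hq (fun i j => hr (2 * (i + 2)) j)
      (fun i j k => hr (2 * (i + 2 + (j + 1))) k) (fun i j k hijk => ?_) hf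
    have := hI (i + 2) (j + 1) (k + 1) (by omega) (by omega) (by omega) (by omega)
    rw [hT, hL] at this
    rw [mem_mulComap]
    convert this using 1
    ring
  have face : ∀ m, m + 3 ≤ p → ∀ f ∈ Submodule.span ℝ (Set.range s) ^ m,
      ∀ a b c, a ≠ b → a ≠ c → b ≠ c → s a * s b * s c * f ∈ U := by
    intro m hm f hf
    refine forall_distinct_of_sorted (fun a b c h => by rwa [mul_comm (s b)])
      (fun a b c h => by rwa [mul_right_comm (s a)]) fun a b c hab hbc => ?_
    obtain ⟨d, hd⟩ := exists_distinct4 hab.ne (hab.trans hbc).ne hbc.ne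
    refine span_pow_le_of_face (U := mulComap U (s a * s b * s c)) hs hd hq
      (fun i j => hr (2 * (i + 2)) j) (fun i j hij => ?_) (fun m' hm' g hg => ?_) hf
    · rw [mem_mulComap, ← hT]
      exact hF a b c hab hbc _ _ (by omega) (by omega) (by omega)
    · rw [mem_mulComap, ← mul_assoc]
      have e : s a * s b * s c * s d = s 0 * s 1 * s 2 * s 3 := by
        have hu : (univ : Finset (Fin 4)) = {a, b, c, d} := by
          ext i
          simpa using hd.cover i
        obtain ⟨h1, h2, h3, h4, h5, h6⟩ := hd
        rw [← Fin.prod_univ_four, hu, prod_insert (by simp [*]), prod_insert (by simp [*]),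
          prod_insert (by simp [*]), prod_singleton]
        ring
      rw [e]
      exact int m' (by omega) g hg
  obtain ⟨k, rfl⟩ : ∃ k, p = k + 1 := ⟨p - 1, by omega⟩
  refine span_pow_le_of_vertex hs hV (p := k + 1) ?_ le_rfl
  have edge : ∀ a b, a < b → ∀ m, m + 2 ≤ k + 1 → ∀ f ∈ Submodule.span ℝ (Set.range s) ^ m,
      s a * s b * f ∈ U := by
    intro a b hab m hm f hf
    obtain ⟨c, hac, hbc⟩ : ∃ c, a ≠ c ∧ b ≠ c := by revert a b; decide
    obtain ⟨d, hd⟩ := exists_distinct4 hab.ne hac hbc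
    refine span_pow_le_of_edge (U := mulComap U (s a * s b)) hs hd hq (fun i hi => ?_)
      (fun m' hm' g hg => ?_) (fun m' hm' g hg => ?_) hf
    · have := hE a b hab (i + 2) (by omega) (by omega)
      rwa [hφ] at this
    · rw [mem_mulComap, ← mul_assoc]
      exact face m' (by omega) g hg _ _ _ hab.ne hac hbc
    · rw [mem_mulComap, ← mul_assoc]
      exact face m' (by omega) g hg _ _ _ hab.ne hd.2.2.1 hd.2.2.2.2.1
  intro a b hab
  rcases hab.lt_or_gt with hab | hab
  · exact edge a b hab
  · intro m hm f hf
    rw [mul_comm (s a)]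
    exact edge b a hab m hm f hf

/-- No bubble occurs here: the functions are exactly the products treated by the interior
elimination. -/
theorem span_pow_le_of_L2 (hs : ∑ i, s i = 1) {n : ℕ}
    (h : ∀ i j k, i + j + k ≤ n → polyT i j (pick3 s 0 1 2)
      * hom (jacobiP ((2 * (i + j + 1) : ℕ) : ℝ) k) (1 - s 3) (s 3) ∈ U) :
    Submodule.span ℝ (Set.range s) ^ n ≤ U :=
  span_pow_le_of_interior hs (a := 0) (b := 1) (c := 2) (d := 3) (by decide) legendreP_hasLead
    (fun i j => jacobiP_nat_hasLead (2 * i + 1) j)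
    (fun i j k => jacobiP_nat_hasLead (2 * (i + j + 1)) k) h

end Scalar

/-! ### Whitney edge fields and the H(curl) functions -/

section Vector

variable {N : ℕ} {s : Fin 4 → Scal N} {W : Submodule ℝ (Vec N)} {n : ℕ}

/-- The functions `f` with `f F ∈ W`. -/
def mulVecComap (W : Submodule ℝ (Vec N)) (F : Vec N) : Submodule ℝ (Scal N) :=
  W.comap
    ({ toFun := fun f => mulVec f F
       map_add' := fun f g => by funext x; simp [mulVec, add_smul]
       map_smul' := fun c f => by funext x; simp [mulVec, mul_smul] } : Scal N →ₗ[ℝ] Vec N)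

theorem mem_mulVecComap {W : Submodule ℝ (Vec N)} {F : Vec N} {f : Scal N} :
    f ∈ mulVecComap W F ↔ mulVec f F ∈ W := Iff.rfl

theorem mulVec_mulVec (f g : Scal N) (F : Vec N) : mulVec f (mulVec g F) = mulVec (f * g) F := by
  funext x
  simp [mulVec, mul_smul]

/-- The lowest order edge function of the edge `a b`. -/
noncomputable def whitneyEdge {m : ℕ} (s : Fin m → Scal N) (a b : Fin m) : Vec N :=
  mulVec (s a) (grad (s b)) - mulVec (s b) (grad (s a))

theorem whitneyEdge_swap {m : ℕ} (s : Fin m → Scal N) (a b : Fin m) :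
    whitneyEdge s b a = -whitneyEdge s a b := by
  simp [whitneyEdge]

theorem mulVec_whitneyEdge_swap_mem {m : ℕ} {s : Fin m → Scal N} {f : Scal N} {a b : Fin m}
    (h : mulVec f (whitneyEdge s a b) ∈ W) : mulVec f (whitneyEdge s b a) ∈ W := by
  rw [whitneyEdge_swap]
  convert W.neg_mem h using 1
  funext x
  simp [mulVec]

/-- The linear relation between the edge functions of a face. -/
theorem mulVec_whitneyEdge_mem {m : ℕ} {s : Fin m → Scal N} {f : Scal N} {a b c : Fin m}
    (h₁ : mulVec (s c * f) (whitneyEdge s a b) ∈ W)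
    (h₂ : mulVec (s a * f) (whitneyEdge s b c) ∈ W) :
    mulVec (s b * f) (whitneyEdge s a c) ∈ W := by
  convert W.add_mem h₁ h₂ using 1
  funext x i
  simp [mulVec, whitneyEdge]
  ring

/-- Each function is a scalar times a Whitney edge field w_ab, with bubble s_c s_d in the interior,
s_c on a face and 1 on an edge, so the scalar scheme applies to the coefficients of a fixed w_ab.
There are fewer families than pairs (field, bubble); the relation s_c w_ab + s_a w_bc = s_b w_ac
provides the missing ones. -/
theorem mulVec_whitneyEdge_mem_of_curl (hs : ∑ i, s i = 1)
    (hE : ∀ a b, a < b → ∀ i ≤ n, fieldE i (pick2 s a b) ∈ W)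
    (hF : ∀ a b c, a < b → b < c → ∀ i j, 1 ≤ j → i + j ≤ n → fieldT i j (pick3 s a b c) ∈ W)
    (hF' : ∀ a b c, a < b → b < c → ∀ i j, 1 ≤ j → i + j ≤ n → fieldT i j (pick3 s b c a) ∈ W)
    (hI : ∀ a : Fin 4, a ≠ 3 → ∀ i j k, 1 ≤ j → 1 ≤ k → i + j + k ≤ n →
      mulVec (hom (jacobiL ((2 * (i + j) : ℕ) : ℝ) k) (1 - s (a + 3)) (s (a + 3)))
        (fieldT i j (pick3 s a (a + 1) (a + 2))) ∈ W) (a b : Fin 4) :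
    ∀ f ∈ Submodule.span ℝ (Set.range s) ^ n, mulVec f (whitneyEdge s a b) ∈ W := by
  obtain ⟨r, hr, hL⟩ := exists_jacobiL_factor
  set V := Submodule.span ℝ (Set.range s) with hV
  have hT : ∀ i j a b c, fieldT i (j + 1) (pick3 s a b c) = mulVec (s c *
      (hom (legendreP i) (s a) (s b) * hom (r (2 * i + 1) j) (s a + s b) (s c)))
      (whitneyEdge s a b) := by
    intro i j a b c
    change mulVec (hom (jacobiL ((2 * i + 1 : ℕ) : ℝ) (j + 1)) (s a + s b) (s c))
      (mulVec (hom (legendreP i) (s a) (s b)) (whitneyEdge s a b)) = _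
    rw [mulVec_mulVec, hL, mul_right_comm, ← mul_assoc]
  have int₀ : ∀ a : Fin 4, a ≠ 3 → ∀ m, m + 2 ≤ n → ∀ f ∈ V ^ m,
      mulVec (s (a + 2) * s (a + 3) * f) (whitneyEdge s a (a + 1)) ∈ W := by
    intro a ha m hm f hf
    have hd : Distinct4 a (a + 1) (a + 2) (a + 3) := by revert a; decide
    refine span_pow_le_of_interior (U := mulComap (mulVecComap W (whitneyEdge s a (a + 1)))
      (s (a + 2) * s (a + 3))) hs hd legendreP_hasLead (fun i j => hr (2 * i + 1) j)
      (fun i j k => hr (2 * (i + (j + 1))) k) (fun i j k hijk => ?_) hf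
    have := hI a ha i (j + 1) (k + 1) (by omega) (by omega) (by omega)
    rw [hT, mulVec_mulVec, hL] at this
    rw [mem_mulComap, mem_mulVecComap]
    convert this using 2
    ring
  have int : ∀ m, m + 2 ≤ n → ∀ f ∈ V ^ m, ∀ a b c, a < b → b < c → ∀ d, Distinct4 a b c d →
      mulVec (s c * (s d * f)) (whitneyEdge s a b) ∈ W ∧
        mulVec (s a * (s d * f)) (whitneyEdge s b c) ∈ W := by
    intro m hm f hf
    have h01 : mulVec (s 2 * s 3 * f) (whitneyEdge s 0 1) ∈ W := int₀ 0 (by decide) m hm f hf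
    have h12 : mulVec (s 0 * s 3 * f) (whitneyEdge s 1 2) ∈ W := by
      have : mulVec (s 3 * s 0 * f) (whitneyEdge s 1 2) ∈ W := int₀ 1 (by decide) m hm f hf
      rwa [mul_comm (s 0)]
    have h23 : mulVec (s 0 * s 1 * f) (whitneyEdge s 2 3) ∈ W := int₀ 2 (by decide) m hm f hf
    -- The interior families cover the edges of the path 0-1-2-3. The other three edges arise by
    -- composing along the path with the face relation.
    have h02 : mulVec (s 1 * s 3 * f) (whitneyEdge s 0 2) ∈ W := by
      rw [mul_assoc] at *
      exact mulVec_whitneyEdge_mem h01 h12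
    have h13 : mulVec (s 0 * s 2 * f) (whitneyEdge s 1 3) ∈ W := by
      rw [mul_assoc, mul_left_comm] at *
      refine mulVec_whitneyEdge_mem ?_ ?_
      · convert h12 using 2
      · convert h23 using 2
    have h03 : mulVec (s 1 * s 2 * f) (whitneyEdge s 0 3) ∈ W := by
      rw [mul_assoc]
      refine mulVec_whitneyEdge_mem ?_ ?_
      · convert h01 using 2; ring
      · convert h13 using 2; ring
    intro a b c hab hbc d hd
    have habc : (a = 0 ∧ b = 1 ∧ c = 2 ∧ d = 3) ∨ (a = 0 ∧ b = 1 ∧ c = 3 ∧ d = 2) ∨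
        (a = 0 ∧ b = 2 ∧ c = 3 ∧ d = 1) ∨ (a = 1 ∧ b = 2 ∧ c = 3 ∧ d = 0) := by
      revert a b c d; decide
    rcases habc with ⟨rfl, rfl, rfl, rfl⟩ | ⟨rfl, rfl, rfl, rfl⟩ | ⟨rfl, rfl, rfl, rfl⟩ |
      ⟨rfl, rfl, rfl, rfl⟩
    · exact ⟨by rwa [← mul_assoc], by rwa [← mul_assoc]⟩
    · exact ⟨by rwa [← mul_assoc, mul_comm (s 3)], by rwa [← mul_assoc]⟩
    · exact ⟨by rwa [← mul_assoc, mul_comm (s 3)], by rwa [← mul_assoc]⟩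
    · exact ⟨by rwa [← mul_assoc, mul_comm (s 3)], by rwa [← mul_assoc, mul_comm (s 1)]⟩
  have face₀ : ∀ a b c d, a ≠ b → a ≠ c → b ≠ c → Distinct4 a b c d →
      (∀ i j, 1 ≤ j → i + j ≤ n → fieldT i j (pick3 s a b c) ∈ W) →
      (∀ m, m + 2 ≤ n → ∀ f ∈ V ^ m, mulVec (s c * (s d * f)) (whitneyEdge s a b) ∈ W) →
      ∀ m, m + 1 ≤ n → ∀ f ∈ V ^ m, mulVec (s c * f) (whitneyEdge s a b) ∈ W := by
    intro a b c d hab hac hbc hd hFabc hint m hm f hf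
    refine span_pow_le_of_face (U := mulComap (mulVecComap W (whitneyEdge s a b)) (s c)) hs hd
      legendreP_hasLead (fun i j => hr (2 * i + 1) j) (fun i j hij => ?_)
      (fun m' hm' g hg => ?_) hf
    · rw [mem_mulComap, mem_mulVecComap, ← hT]
      exact hFabc _ _ (by omega) (by omega)
    · exact hint m' (by omega) g hg
  have face : ∀ m, m + 1 ≤ n → ∀ f ∈ V ^ m, ∀ a b c, a ≠ b → a ≠ c → b ≠ c →
      mulVec (s c * f) (whitneyEdge s a b) ∈ W ∧ mulVec (s a * f) (whitneyEdge s b c) ∈ W ∧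
        mulVec (s b * f) (whitneyEdge s a c) ∈ W := by
    intro m hm f hf
    -- All three edges of the face are carried together, so that reordering the vertices only
    -- permutes the claims up to sign. For sorted vertices two edges have their own family and the
    -- third follows from the face relation.
    refine forall_distinct_of_sorted ?_ ?_ ?_
    · rintro a b c ⟨h1, h2, h3⟩
      exact ⟨mulVec_whitneyEdge_swap_mem h1, h3, h2⟩
    · rintro a b c ⟨h1, h2, h3⟩
      exact ⟨h3, mulVec_whitneyEdge_swap_mem h2, h1⟩
    · intro a b c hab hbc
      have hac := hab.trans hbc
      obtain ⟨d, hd⟩ := exists_distinct4 hab.ne hac.ne hbc.ne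
      have h1 := face₀ a b c d hab.ne hac.ne hbc.ne hd (hF a b c hab hbc)
        (fun m hm f hf => (int m hm f hf a b c hab hbc d hd).1) m hm f hf
      have hd' : Distinct4 b c a d := by
        obtain ⟨g1, g2, g3, g4, g5, g6⟩ := hd
        exact ⟨g4, g1.symm, g5, g2.symm, g6, g3⟩
      have h2 := face₀ b c a d hbc.ne hab.ne' hac.ne' hd' (hF' a b c hab hbc)
        (fun m hm f hf => (int m hm f hf a b c hab hbc d hd).2) m hm f hf
      exact ⟨h1, h2, mulVec_whitneyEdge_mem h1 h2⟩
  have edge : ∀ a b, a < b → ∀ f ∈ V ^ n, mulVec f (whitneyEdge s a b) ∈ W := by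
    intro a b hab f hf
    obtain ⟨c, hac, hbc⟩ : ∃ c, a ≠ c ∧ b ≠ c := by revert a b; decide
    obtain ⟨d, hd⟩ := exists_distinct4 hab.ne hac hbc
    exact span_pow_le_of_edge (U := mulVecComap W (whitneyEdge s a b)) hs hd legendreP_hasLead
      (fun i hi => hE a b hab i hi) (fun m hm g hg => (face m hm g hg a b c hab.ne hac hbc).1)
      (fun m hm g hg => (face m hm g hg a b d hab.ne hd.2.2.1 hd.2.2.2.2.1).1) hf
  intro f hf
  rcases lt_trichotomy a b with hab | rfl | hab
  · exact edge a b hab f hf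
  · convert W.zero_mem
    funext x
    simp [mulVec, whitneyEdge]
  · exact mulVec_whitneyEdge_swap_mem (edge b a hab f hf)

end Vector

/-! ### Whitney face fields and the H(div) functions -/

section Flux

variable {s : Fin 4 → Scal 3} {W : Submodule ℝ (Vec 3)} {n : ℕ}

/-- The lowest order face function of the face `a b c`. -/
noncomputable def whitneyFace {m : ℕ} (s : Fin m → Scal 3) (a b c : Fin m) : Vec 3 :=
  mulVec (s a) (cross3 (grad (s b)) (grad (s c))) + mulVec (s b) (cross3 (grad (s c)) (grad (s a)))
    + mulVec (s c) (cross3 (grad (s a)) (grad (s b)))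

/-- Each function is a scalar times a Whitney face field, with bubble s_d in the interior and none
on the face. Three interior families suffice for the four faces because the fields s_d W_abc satisfy
one alternating linear relation. -/
theorem mulVec_whitneyFace_mem_of_div (hs : ∑ i, s i = 1)
    (hF : ∀ a b c, a < b → b < c → ∀ i j, i + j ≤ n → fluxT i j (pick3 s a b c) ∈ W)
    (hI : ∀ a : Fin 4, a ≠ 3 → ∀ i j k, 1 ≤ k → i + j + k ≤ n →
      mulVec (hom (jacobiL ((2 * (i + j + 1) : ℕ) : ℝ) k) (1 - s (a + 3)) (s (a + 3)))
        (fluxT i j (pick3 s a (a + 1) (a + 2))) ∈ W) :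
    ∀ a b c, a < b → b < c → ∀ f ∈ Submodule.span ℝ (Set.range s) ^ n,
      mulVec f (whitneyFace s a b c) ∈ W := by
  obtain ⟨r, hr, hL⟩ := exists_jacobiL_factor
  set V := Submodule.span ℝ (Set.range s) with hV
  have hT : ∀ i j a b c, fluxT i j (pick3 s a b c) = mulVec
      (hom (legendreP i) (s a) (s b) * hom (jacobiP ((2 * i + 1 : ℕ) : ℝ) j) (s a + s b) (s c))
      (whitneyFace s a b c) := fun i j a b c => rfl
  have int₀ : ∀ a : Fin 4, a ≠ 3 → ∀ m, m + 1 ≤ n → ∀ f ∈ V ^ m,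
      mulVec (s (a + 3) * f) (whitneyFace s a (a + 1) (a + 2)) ∈ W := by
    intro a ha m hm f hf
    have hd : Distinct4 a (a + 1) (a + 2) (a + 3) := by revert a; decide
    refine span_pow_le_of_interior (U := mulComap (mulVecComap W
      (whitneyFace s a (a + 1) (a + 2))) (s (a + 3))) hs hd legendreP_hasLead
      (fun i j => jacobiP_nat_hasLead (2 * i + 1) j)
      (fun i j k => hr (2 * (i + j + 1)) k) (fun i j k hijk => ?_) hf
    have := hI a ha i j (k + 1) (by omega) (by omega)
    rw [hT, mulVec_mulVec, hL] at this
    rw [mem_mulComap, mem_mulVecComap]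
    convert this using 2
    ring
  have int : ∀ m, m + 1 ≤ n → ∀ f ∈ V ^ m, ∀ a b c, a < b → b < c → ∀ d, Distinct4 a b c d →
      mulVec (s d * f) (whitneyFace s a b c) ∈ W := by
    intro m hm f hf
    have h0 : mulVec (s 3 * f) (whitneyFace s 0 1 2) ∈ W := int₀ 0 (by decide) m hm f hf
    have h1 : mulVec (s 0 * f) (whitneyFace s 1 2 3) ∈ W := int₀ 1 (by decide) m hm f hf
    have h2 : mulVec (s 1 * f) (whitneyFace s 0 2 3) ∈ W := by
      have : mulVec (s 1 * f) (whitneyFace s 2 3 0) ∈ W := int₀ 2 (by decide) m hm f hf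
      convert this using 2
      simp only [whitneyFace]
      abel
    -- The relation s_2 W_013 = s_3 W_012 - s_0 W_123 + s_1 W_023.
    have h3 : mulVec (s 2 * f) (whitneyFace s 0 1 3) ∈ W := by
      convert W.add_mem (W.sub_mem h0 h1) h2 using 1
      funext x i
      fin_cases i <;> simp [mulVec, whitneyFace, cross3, crossProduct] <;> ring
    intro a b c hab hbc d hd
    have habc : (a = 0 ∧ b = 1 ∧ c = 2 ∧ d = 3) ∨ (a = 0 ∧ b = 1 ∧ c = 3 ∧ d = 2) ∨
        (a = 0 ∧ b = 2 ∧ c = 3 ∧ d = 1) ∨ (a = 1 ∧ b = 2 ∧ c = 3 ∧ d = 0) := by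
      revert a b c d; decide
    rcases habc with ⟨rfl, rfl, rfl, rfl⟩ | ⟨rfl, rfl, rfl, rfl⟩ | ⟨rfl, rfl, rfl, rfl⟩ |
      ⟨rfl, rfl, rfl, rfl⟩
    · exact h0
    · exact h3
    · exact h2
    · exact h1
  intro a b c hab hbc f hf
  obtain ⟨d, hd⟩ := exists_distinct4 hab.ne (hab.trans hbc).ne hbc.ne
  refine span_pow_le_of_face (U := mulVecComap W (whitneyFace s a b c)) hs hd
    legendreP_hasLead (fun i j => jacobiP_nat_hasLead (2 * i + 1) j) (fun i j hij => ?_)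
    (fun m' hm' g hg => ?_) hf
  · exact hF a b c hab hbc i j hij
  · exact int m' hm' g hg a b c hab hbc d hd

end Flux

/-! ### Cardinalities of the index sets -/

theorem mem_triIdx {i₀ j₀ n : ℕ} {q : ℕ × ℕ} :
    q ∈ triIdx i₀ j₀ n ↔ i₀ ≤ q.1 ∧ j₀ ≤ q.2 ∧ q.1 + q.2 ≤ n := by
  simp only [triIdx, mem_filter, mem_product, mem_range]
  omega

theorem mem_tetIdx {i₀ j₀ k₀ n : ℕ} {q : ℕ × ℕ × ℕ} :
    q ∈ tetIdx i₀ j₀ k₀ n ↔ i₀ ≤ q.1 ∧ j₀ ≤ q.2.1 ∧ k₀ ≤ q.2.2 ∧ q.1 + q.2.1 + q.2.2 ≤ n := by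
  simp only [tetIdx, mem_filter, mem_product, mem_range]
  omega

/-- Raising n adds the diagonal i + j = n + 1 with its n + 2 - i₀ - j₀ points; the sum is Pascal's
rule. Truncated subtraction also covers the empty range. -/
theorem card_triIdx (i₀ j₀ n : ℕ) : #(triIdx i₀ j₀ n) = (n + 2 - i₀ - j₀).choose 2 := by
  induction n with
  | zero =>
    rcases Nat.eq_zero_or_pos (i₀ + j₀) with h | h
    · obtain ⟨rfl, rfl⟩ : i₀ = 0 ∧ j₀ = 0 := by omega
      rfl
    · rw [Nat.choose_eq_zero_of_lt (by omega), card_eq_zero]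
      ext q
      simp only [mem_triIdx, notMem_empty, iff_false]
      omega
  | succ n ih =>
    have hu : triIdx i₀ j₀ (n + 1) = triIdx i₀ j₀ n ∪
        (range (n + 2 - i₀ - j₀)).image fun i => (i₀ + i, n + 1 - i₀ - i) := by
      ext ⟨i, j⟩
      simp only [mem_union, mem_triIdx, mem_image, mem_range, Prod.mk.injEq]
      constructor
      · intro h
        by_cases hn : i + j ≤ n
        · exact Or.inl ⟨h.1, h.2.1, hn⟩
        · exact Or.inr ⟨i - i₀, by omega, by omega, by omega⟩
      · rintro (h | ⟨k, hk, rfl, rfl⟩) <;> omega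
    have hd : Disjoint (triIdx i₀ j₀ n)
        ((range (n + 2 - i₀ - j₀)).image fun i => (i₀ + i, n + 1 - i₀ - i)) := by
      rw [disjoint_left]
      rintro ⟨i, j⟩
      simp only [mem_triIdx, mem_image, mem_range, Prod.mk.injEq]
      rintro h ⟨k, hk, rfl, rfl⟩
      omega
    rw [hu, card_union_of_disjoint hd, ih, card_image_of_injective, card_range]
    · rcases le_or_gt (i₀ + j₀) (n + 2) with h | h
      · rw [show n + 1 + 2 - i₀ - j₀ = (n + 2 - i₀ - j₀) + 1 by omega,
          Nat.choose_succ_succ' _ 1, Nat.choose_one_right, add_comm]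
      · rw [show n + 1 + 2 - i₀ - j₀ = 0 by omega, show n + 2 - i₀ - j₀ = 0 by omega]
        rfl
    · intro i j h
      simpa using congrArg Prod.fst h

/-- The layer i + j + k = n + 1 projects bijectively onto the pairs with i + j ≤ n + 1 - k₀. The
restriction on k₀ makes this difference a true one for every n. -/
theorem card_tetIdx (i₀ j₀ k₀ n : ℕ) (hk : k₀ ≤ 1) :
    #(tetIdx i₀ j₀ k₀ n) = (n + 3 - i₀ - j₀ - k₀).choose 3 := by
  induction n with
  | zero =>
    rcases Nat.eq_zero_or_pos (i₀ + j₀ + k₀) with h | h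
    · obtain ⟨rfl, rfl, rfl⟩ : i₀ = 0 ∧ j₀ = 0 ∧ k₀ = 0 := by omega
      rfl
    · rw [Nat.choose_eq_zero_of_lt (by omega), card_eq_zero]
      ext q
      simp only [mem_tetIdx, notMem_empty, iff_false]
      omega
  | succ n ih =>
    have hu : tetIdx i₀ j₀ k₀ (n + 1) = tetIdx i₀ j₀ k₀ n ∪
        (triIdx i₀ j₀ (n + 1 - k₀)).image fun q => (q.1, q.2, n + 1 - q.1 - q.2) := by
      ext ⟨i, j, k⟩
      simp only [mem_union, mem_tetIdx, mem_image, mem_triIdx, Prod.mk.injEq, Prod.exists]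
      constructor
      · intro h
        by_cases hn : i + j + k ≤ n
        · exact Or.inl ⟨h.1, h.2.1, h.2.2.1, hn⟩
        · exact Or.inr ⟨i, j, by omega, rfl, rfl, by omega⟩
      · rintro (h | ⟨i', j', h, rfl, rfl, rfl⟩) <;> omega
    have hd : Disjoint (tetIdx i₀ j₀ k₀ n)
        ((triIdx i₀ j₀ (n + 1 - k₀)).image fun q => (q.1, q.2, n + 1 - q.1 - q.2)) := by
      rw [disjoint_left]
      rintro ⟨i, j, k⟩
      simp only [mem_tetIdx, mem_image, mem_triIdx, Prod.mk.injEq, Prod.exists]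
      rintro h ⟨i', j', h', rfl, rfl, rfl⟩
      omega
    rw [hu, card_union_of_disjoint hd, ih, card_image_of_injective, card_triIdx]
    · rcases le_or_gt (i₀ + j₀ + k₀) (n + 3) with h | h
      · rw [show n + 1 + 3 - i₀ - j₀ - k₀ = (n + 3 - i₀ - j₀ - k₀) + 1 by omega,
          Nat.choose_succ_succ' _ 2, add_comm,
          show n + 1 - k₀ + 2 - i₀ - j₀ = n + 3 - i₀ - j₀ - k₀ by omega]
      · rw [show n + 1 + 3 - i₀ - j₀ - k₀ = 0 by omega, show n + 3 - i₀ - j₀ - k₀ = 0 by omega,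
          show n + 1 - k₀ + 2 - i₀ - j₀ = 0 by omega]
        rfl
    · rintro ⟨i, j⟩ ⟨i', j'⟩ h
      simp only [Prod.mk.injEq] at h ⊢
      exact ⟨h.1, h.2.1⟩

/-! ### Polynomial functions -/

section Polynomial

variable {N : ℕ}

/-- The polynomial functions in `N` variables. -/
def polyAll (N : ℕ) : Submodule ℝ (Scal N) := Submodule.span ℝ (Set.range monoFun)

theorem polyP_le_polyAll (N p : ℕ) : polyP N p ≤ polyAll N :=
  Submodule.span_mono fun _ ⟨e, _, h⟩ => ⟨e, h.symm⟩

theorem polyHom_le_polyAll (N p : ℕ) : polyHom N p ≤ polyAll N :=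
  Submodule.span_mono fun _ ⟨e, _, h⟩ => ⟨e, h.symm⟩

theorem polyQ_le_polyAll (d : Fin N → ℕ) : polyQ d ≤ polyAll N :=
  Submodule.span_mono fun _ ⟨e, _, h⟩ => ⟨e, h.symm⟩

/-- The polynomial function of a formal polynomial. -/
noncomputable def evalFun (N : ℕ) : MvPolynomial (Fin N) ℝ →ₗ[ℝ] Scal N where
  toFun P := fun x => MvPolynomial.eval x P
  map_add' P Q := by funext x; simp
  map_smul' c P := by funext x; simp

theorem evalFun_monomial (e : Fin N → ℕ) :
    evalFun N (MvPolynomial.monomial (Finsupp.equivFunOnFinite.symm e) 1) = monoFun e := by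
  funext x
  simp [evalFun, monoFun, MvPolynomial.eval_monomial, Finsupp.prod_fintype]

theorem exists_evalFun_eq {f : Scal N} (hf : f ∈ polyAll N) : ∃ P, evalFun N P = f := by
  have : polyAll N ≤ LinearMap.range (evalFun N) := by
    rw [polyAll, Submodule.span_le]
    rintro _ ⟨e, rfl⟩
    exact ⟨_, evalFun_monomial e⟩
  exact this hf

theorem evalFun_eq_zero {P : MvPolynomial (Fin N) ℝ} {s : Fin N → Set ℝ} (hs : ∀ i, (s i).Infinite)
    (h : ∀ x ∈ Set.pi .univ s, evalFun N P x = 0) : P = 0 :=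
  MvPolynomial.funext_set s hs fun x hx => (h x hx).trans (map_zero _).symm

theorem evalFun_injective (N : ℕ) : Function.Injective (evalFun N) := by
  rw [← LinearMap.ker_eq_bot, LinearMap.ker_eq_bot']
  intro P hP
  exact evalFun_eq_zero (s := fun _ => Set.univ) (fun _ => Set.infinite_univ)
    fun x _ => congrFun hP x

/-- This carries linear independence from ℝ^N to the master element: each master element contains a
box, that is, a product of infinite sets. -/
theorem eq_zero_of_mem_polyAll {f : Scal N} (hf : f ∈ polyAll N) {s : Fin N → Set ℝ}
    (hs : ∀ i, (s i).Infinite) (h : ∀ x ∈ Set.pi .univ s, f x = 0) : f = 0 := by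
  obtain ⟨P, rfl⟩ := exists_evalFun_eq hf
  rw [evalFun_eq_zero hs h, map_zero]

/-- Transported from the monomial basis of formal polynomials along the injective evaluation;
dimensions thereby become counts of exponent vectors. -/
theorem linearIndependent_monoFun (N : ℕ) : LinearIndependent ℝ (monoFun (N := N)) := by
  have h := (MvPolynomial.basisMonomials (Fin N) ℝ).linearIndependent.map' (evalFun N)
    (LinearMap.ker_eq_bot.mpr (evalFun_injective N))
  have h' := h.comp Finsupp.equivFunOnFinite.symm (Equiv.injective _)
  have e : monoFun (N := N) = (evalFun N ∘ MvPolynomial.basisMonomials (Fin N) ℝ) ∘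
      Finsupp.equivFunOnFinite.symm := by
    funext e
    simp [evalFun_monomial]
  rwa [e]

theorem finrank_span_monoFun (p : (Fin N → ℕ) → Prop) [Finite {e // p e}] :
    Module.finrank ℝ (Submodule.span ℝ {f | ∃ e : Fin N → ℕ, p e ∧ f = monoFun e})
      = Nat.card {e // p e} := by
  have hset : {f | ∃ e : Fin N → ℕ, p e ∧ f = monoFun e}
      = Set.range fun e : {e // p e} => monoFun e.1 := by
    ext f
    constructor
    · rintro ⟨e, he, rfl⟩
      exact ⟨⟨e, he⟩, rfl⟩
    · rintro ⟨e, rfl⟩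
      exact ⟨e.1, e.2, rfl⟩
  have := Fintype.ofFinite {e // p e}
  have hli : LinearIndependent ℝ fun e : {e // p e} => monoFun e.1 :=
    (linearIndependent_monoFun N).comp _ Subtype.val_injective
  rw [hset, finrank_span_eq_card hli, Nat.card_eq_fintype_card]

theorem finite_span_monoFun (p : (Fin N → ℕ) → Prop) [Finite {e // p e}] :
    FiniteDimensional ℝ (Submodule.span ℝ {f | ∃ e : Fin N → ℕ, p e ∧ f = monoFun e}) := by
  apply FiniteDimensional.span_of_finite
  refine (Set.finite_range fun e : {e // p e} => monoFun e.1).subset ?_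
  rintro _ ⟨e, he, rfl⟩
  exact ⟨⟨e, he⟩, rfl⟩

instance finite_exponents_le (d : Fin N → ℕ) : Finite {e : Fin N → ℕ // ∀ k, e k ≤ d k} :=
  Set.finite_Iic d

instance finite_exponents_sum_le (n : ℕ) : Finite {e : Fin N → ℕ // ∑ k, e k ≤ n} :=
  (Set.finite_Iic fun _ => n).subset fun _ he k =>
    (single_le_sum (fun _ _ => Nat.zero_le _) (mem_univ k)).trans he

instance finite_exponents_sum_eq (n : ℕ) : Finite {e : Fin N → ℕ // ∑ k, e k = n} :=
  (Set.finite_Iic fun _ => n).subset fun _ he k =>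
    (single_le_sum (fun _ _ => Nat.zero_le _) (mem_univ k)).trans he.le

instance finiteDimensional_polyP (N p : ℕ) : FiniteDimensional ℝ (polyP N p) :=
  finite_span_monoFun _

instance finiteDimensional_polyHom (N p : ℕ) : FiniteDimensional ℝ (polyHom N p) :=
  finite_span_monoFun _

instance finiteDimensional_polyQ (d : Fin N → ℕ) : FiniteDimensional ℝ (polyQ d) :=
  finite_span_monoFun _

theorem finrank_polyQ (d : Fin N → ℕ) : Module.finrank ℝ (polyQ d) = ∏ k, (d k + 1) := by
  rw [polyQ, finrank_span_monoFun]
  change Nat.card (Set.Iic d) = _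
  simp [Pi.card_Iic]

theorem finrank_polyP_one (n : ℕ) : Module.finrank ℝ (polyP 1 n) = n + 1 := by
  have : polyP 1 n = polyQ fun _ => n := by simp [polyP, polyQ]
  rw [this, finrank_polyQ]
  simp

theorem finrank_polyP_two (n : ℕ) : Module.finrank ℝ (polyP 2 n) = (n + 2).choose 2 := by
  -- The rewrites produce n + 2 - 0 - 0, the shape in which `card_triIdx 0 0 n` states the count.
  rw [polyP, finrank_span_monoFun, ← Nat.sub_zero (n + 2), ← Nat.sub_zero (n + 2 - 0),
    ← card_triIdx 0 0 n, ← Fintype.card_coe, ← Nat.card_eq_fintype_card]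
  exact Nat.card_congr
    { toFun := fun e => ⟨(e.1 0, e.1 1), by simpa [mem_triIdx, Fin.sum_univ_two] using e.2⟩
      invFun := fun q => ⟨![q.1.1, q.1.2], by
        simpa [Fin.sum_univ_two] using (mem_triIdx.mp q.2).2.2⟩
      left_inv := fun e => by
        ext k
        fin_cases k <;> rfl
      right_inv := fun q => rfl }

theorem finrank_polyP_three (n : ℕ) : Module.finrank ℝ (polyP 3 n) = (n + 3).choose 3 := by
  rw [polyP, finrank_span_monoFun, ← Nat.sub_zero (n + 3), ← Nat.sub_zero (n + 3 - 0),
    ← Nat.sub_zero (n + 3 - 0 - 0), ← card_tetIdx 0 0 0 n (by omega), ← Fintype.card_coe, ← Nat.card_eq_fintype_card]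
  exact Nat.card_congr
    { toFun := fun e => ⟨(e.1 0, e.1 1, e.1 2),
        by simpa [mem_tetIdx, Fin.sum_univ_three] using e.2⟩
      invFun := fun q => ⟨![q.1.1, q.1.2.1, q.1.2.2],
        by simpa [Fin.sum_univ_three] using (mem_tetIdx.mp q.2).2.2.2⟩
      left_inv := fun e => by
        ext k
        fin_cases k <;> rfl
      right_inv := fun q => rfl }

theorem finrank_polyHom_two (n : ℕ) : Module.finrank ℝ (polyHom 2 n) = n + 1 := by
  rw [polyHom, finrank_span_monoFun, ← Nat.card_fin (n + 1)]
  exact Nat.card_congr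
    { toFun := fun e => ⟨e.1 0, by have := e.2; rw [Fin.sum_univ_two] at this; omega⟩
      invFun := fun q => ⟨![q.1, n - q.1], by
        have := q.2
        simp [Fin.sum_univ_two]
        omega⟩
      left_inv := fun e => by
        have := e.2
        rw [Fin.sum_univ_two] at this
        ext k
        fin_cases k
        · rfl
        · simp
          omega
      right_inv := fun q => rfl }

theorem finrank_polyHom_three (n : ℕ) : Module.finrank ℝ (polyHom 3 n) = (n + 2).choose 2 := by
  rw [polyHom, finrank_span_monoFun, ← Nat.sub_zero (n + 2), ← Nat.sub_zero (n + 2 - 0),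
    ← card_triIdx 0 0 n, ← Fintype.card_coe, ← Nat.card_eq_fintype_card]
  exact Nat.card_congr
    { toFun := fun e => ⟨(e.1 0, e.1 1), by
        have := e.2
        rw [Fin.sum_univ_three] at this
        simp [mem_triIdx]
        omega⟩
      invFun := fun q => ⟨![q.1.1, q.1.2, n - q.1.1 - q.1.2], by
        have := (mem_triIdx.mp q.2).2.2
        simp [Fin.sum_univ_three]
        omega⟩
      left_inv := fun e => by
        have := e.2
        rw [Fin.sum_univ_three] at this
        ext k
        fin_cases k
        · rfl
        · rfl
        · simp
          omega
      right_inv := fun q => rfl }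

theorem monoFun_mul (e e' : Fin N → ℕ) : monoFun e * monoFun e' = monoFun (e + e') := by
  funext x
  simp [monoFun, pow_add, prod_mul_distrib]

theorem monoFun_zero : monoFun (0 : Fin N → ℕ) = 1 := by
  funext x
  simp [monoFun]

theorem monoFun_single (k : Fin N) : monoFun (Pi.single k 1) = fun x => x k := by
  funext x
  rw [monoFun, prod_eq_single k (fun l _ hl => by simp [hl]) (by simp)]
  simp

theorem monoFun_mem_polyP {e : Fin N → ℕ} {n : ℕ} (h : ∑ k, e k ≤ n) : monoFun e ∈ polyP N n :=
  Submodule.subset_span ⟨e, h, rfl⟩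

theorem monoFun_mem_polyHom {e : Fin N → ℕ} {n : ℕ} (h : ∑ k, e k = n) :
    monoFun e ∈ polyHom N n :=
  Submodule.subset_span ⟨e, h, rfl⟩

theorem polyP_mono {m n : ℕ} (h : m ≤ n) : polyP N m ≤ polyP N n :=
  Submodule.span_mono fun _ ⟨e, he, hf⟩ => ⟨e, he.trans h, hf⟩

theorem polyHom_le_polyP (n : ℕ) : polyHom N n ≤ polyP N n :=
  Submodule.span_mono fun _ ⟨e, he, hf⟩ => ⟨e, he.le, hf⟩

theorem coord_mem_polyP (k : Fin N) : (fun x => x k : Scal N) ∈ polyP N 1 := by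
  rw [← monoFun_single]
  exact monoFun_mem_polyP (by simp)

theorem one_mem_polyP (n : ℕ) : (1 : Scal N) ∈ polyP N n := by
  rw [← monoFun_zero]
  exact monoFun_mem_polyP (by simp)

theorem polyP_mul_le (m n : ℕ) : polyP N m * polyP N n ≤ polyP N (m + n) := by
  rw [polyP, polyP, Submodule.span_mul_span, Submodule.span_le]
  rintro _ ⟨_, ⟨e, he, rfl⟩, _, ⟨e', he', rfl⟩, rfl⟩
  change monoFun e * monoFun e' ∈ _
  rw [monoFun_mul]
  refine monoFun_mem_polyP ?_
  simp only [Pi.add_apply, sum_add_distrib]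
  omega

theorem polyHom_mul_le (m n : ℕ) : polyHom N m * polyHom N n ≤ polyHom N (m + n) := by
  rw [polyHom, polyHom, Submodule.span_mul_span, Submodule.span_le]
  rintro _ ⟨_, ⟨e, he, rfl⟩, _, ⟨e', he', rfl⟩, rfl⟩
  change monoFun e * monoFun e' ∈ _
  rw [monoFun_mul]
  refine monoFun_mem_polyHom ?_
  simp only [Pi.add_apply, sum_add_distrib]
  omega

/-- The elimination lemmas speak of powers of the span of the coordinates; on the unit simplex that
span is P^1. -/
theorem polyP_one_pow (n : ℕ) : polyP N 1 ^ n = polyP N n := by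
  apply le_antisymm
  · induction n with
    | zero =>
      rw [pow_zero, Submodule.one_le]
      exact one_mem_polyP 0
    | succ n ih =>
      rw [pow_succ]
      exact (mul_le_mul_left ih _).trans (polyP_mul_le n 1)
  · rw [polyP, Submodule.span_le]
    rintro _ ⟨e, he, rfl⟩
    have h1 : (1 : Submodule ℝ (Scal N)) ≤ polyP N 1 := by
      rw [Submodule.one_le]
      exact one_mem_polyP 1
    refine pow_le_pow_right' h1 he ?_
    have : monoFun e = ∏ k, (fun x => x k : Scal N) ^ e k := by
      funext x
      simp [monoFun]
    rw [this]
    induction (univ : Finset (Fin N)) using Finset.induction_on with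
    | empty => simp
    | insert k t hk ih =>
      rw [prod_insert hk, sum_insert hk, pow_add]
      exact Submodule.mul_mem_mul (Submodule.pow_mem_pow _ (coord_mem_polyP k) _) ih

end Polynomial

/-! ### A criterion for hierarchical bases -/

/-- A spanning family has at least as many members as the dimension; with the opposite inequality
`hdim` the two agree and the family is independent. Restriction to K is injective on the space by
`hK`, so independence persists there. -/
theorem IsHierarchicalBasis.of_span {O : Type} [Preorder O] [One O] {N : ℕ}
    {W : Type} [AddCommGroup W] [Module ℝ W] {ι : O → Type} [∀ P, Finite (ι P)]
    {K : Set (Fin N → ℝ)} {f : (P : O) → ι P → (Fin N → ℝ) → W}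
    {S : O → Submodule ℝ ((Fin N → ℝ) → W)} {dim : O → ℕ}
    (hspan : ∀ P, 1 ≤ P → Submodule.span ℝ (Set.range (f P)) = S P)
    (hK : ∀ P, 1 ≤ P → ∀ F ∈ S P, (∀ x ∈ K, F x = 0) → F = 0)
    (hcard : ∀ P, 1 ≤ P → Nat.card (ι P) = dim P)
    (hdim : ∀ P, 1 ≤ P → dim P ≤ Module.finrank ℝ (S P))
    (hmono : ∀ P P', 1 ≤ P → P ≤ P' → Set.range (f P) ⊆ Set.range (f P')) :
    IsHierarchicalBasis K f S dim := by
  have hfin : ∀ P, 1 ≤ P → Module.finrank ℝ (S P) = dim P := by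
    intro P hP
    have := Fintype.ofFinite (ι P)
    refine le_antisymm ?_ (hdim P hP)
    rw [← hspan P hP, ← hcard P hP, Nat.card_eq_fintype_card]
    exact finrank_range_le_card (f P)
  refine ⟨fun P hP i => ?_, fun P hP => ?_, hspan, hcard, hfin, hmono⟩
  · rw [← hspan P hP]
    exact Submodule.subset_span ⟨i, rfl⟩
  · have := Fintype.ofFinite (ι P)
    have hli : LinearIndependent ℝ (f P) := by
      rw [linearIndependent_iff_card_eq_finrank_span, Set.finrank, hspan P hP, hfin P hP,
        ← hcard P hP, Nat.card_eq_fintype_card]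
    let R : ((Fin N → ℝ) → W) →ₗ[ℝ] (K → W) :=
      { toFun := fun F x => F x.1
        map_add' := fun _ _ => rfl
        map_smul' := fun _ _ => rfl }
    refine hli.map (f := R) ?_
    rw [hspan P hP, Submodule.disjoint_def]
    intro F hF hR
    exact hK P hP F hF fun x hx => congrFun hR ⟨x, hx⟩

/-! ### Spaces of vector functions -/

section VectorSpaces

variable {N : ℕ}

/-- The constant vector function `e_k`. -/
def unitVec (k : Fin N) : Vec N := fun _ => Pi.single k 1

/-- The vector function `x_k e_l - x_l e_k`. -/
def koszul (k l : Fin N) : Vec N := fun x => x k • Pi.single l 1 - x l • Pi.single k 1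

theorem eq_sum_mulVec_unitVec (F : Vec N) : F = ∑ k, mulVec (fun x => F x k) (unitVec k) := by
  funext x i
  simp [mulVec, unitVec, Pi.single_apply]

theorem compSpace_le {S : Fin N → Submodule ℝ (Scal N)} {W : Submodule ℝ (Vec N)}
    (h : ∀ k, ∀ f ∈ S k, mulVec f (unitVec k) ∈ W) : compSpace S ≤ W := by
  intro F hF
  rw [eq_sum_mulVec_unitVec F]
  exact W.sum_mem fun k _ => h k _ (hF k)

theorem mulVec_unitVec_mem_compSpace {S : Fin N → Submodule ℝ (Scal N)} {k : Fin N} {f : Scal N}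
    (hf : f ∈ S k) : mulVec f (unitVec k) ∈ compSpace S := by
  intro l
  rcases eq_or_ne l k with rfl | h
  · simpa [mulVec, unitVec] using hf
  · convert (S l).zero_mem
    simp [mulVec, unitVec, h]

theorem exists_isHomogeneous {f : Scal N} {n : ℕ} (hf : f ∈ polyHom N n) :
    ∃ P : MvPolynomial (Fin N) ℝ, P.IsHomogeneous n ∧ evalFun N P = f := by
  have : polyHom N n ≤ (MvPolynomial.homogeneousSubmodule (Fin N) ℝ n).map (evalFun N) := by
    rw [polyHom, Submodule.span_le]
    rintro _ ⟨e, he, rfl⟩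
    refine ⟨_, ?_, evalFun_monomial e⟩
    refine MvPolynomial.isHomogeneous_monomial _ ?_
    simpa [Finsupp.degree_eq_sum] using he
  exact this hf

theorem evalFun_mem_polyHom {P : MvPolynomial (Fin N) ℝ} {n : ℕ} (hP : P.IsHomogeneous n) :
    evalFun N P ∈ polyHom N n := by
  rw [P.as_sum, map_sum]
  refine Submodule.sum_mem _ fun d hd => ?_
  have h : MvPolynomial.monomial d (P.coeff d) = P.coeff d •
      MvPolynomial.monomial (Finsupp.equivFunOnFinite.symm (d : Fin N → ℕ)) 1 := by
    rw [MvPolynomial.smul_monomial, smul_eq_mul, mul_one]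
    congr 2
    ext
    rfl
  rw [h, map_smul, evalFun_monomial]
  refine Submodule.smul_mem _ _ (monoFun_mem_polyHom ?_)
  have := hP (MvPolynomial.mem_support_iff.mp hd)
  simpa [Finsupp.weight_apply, Finsupp.sum_fintype] using this

/-- Homogeneous vector fields orthogonal to `x` are combinations of Koszul fields. -/
theorem inf_radialOrth_le {W : Submodule ℝ (Vec N)} {n : ℕ}
    (hk : ∀ k l, ∀ f ∈ polyHom N n, mulVec f (koszul k l) ∈ W) :
    compSpace (fun _ => polyHom N (n + 1)) ⊓ radialOrth N ≤ W := by
  rintro F ⟨hF, hx⟩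
  choose P hP hPF using fun k => exists_isHomogeneous (hF k)
  have hsum : ∑ k, MvPolynomial.X k * P k = 0 := by
    apply evalFun_injective N
    funext x
    rw [map_zero]
    have h1 : ∀ k, MvPolynomial.eval x (P k) = F x k := fun k => congrFun (hPF k) x
    simpa [evalFun, h1, dotProduct] using hx x
  -- Euler's identity gives Σ_l x_l ∂_l P_k = (n+1) P_k, and differentiating Σ_l x_l P_l = 0 in x_k
  -- gives Σ_l x_l ∂_k P_l = -P_k. The difference is the claim.
  have hcurl : ∀ k, ∑ l, MvPolynomial.X l * (MvPolynomial.pderiv l (P k)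
      - MvPolynomial.pderiv k (P l)) = ((n : ℝ) + 2) • P k := by
    intro k
    have h1 := (hP k).sum_X_mul_pderiv
    have h2 := congrArg (MvPolynomial.pderiv k) hsum
    simp only [map_sum, Derivation.leibniz, MvPolynomial.pderiv_X, smul_eq_mul, map_zero,
      sum_add_distrib] at h2
    have h3 : ∑ l, P l * (Pi.single k 1 : Fin N → MvPolynomial (Fin N) ℝ) l = P k := by
      simp [Pi.single_apply]
    simp only [mul_sub, sum_sub_distrib]
    have h5 : ((n : ℝ) + 2) • P k = (n + 1) • P k + P k := by
      rw [← Nat.cast_smul_eq_nsmul ℝ]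
      push_cast
      module
    rw [h5, ← h1]
    rw [h3] at h2
    linear_combination -h2
  -- The explicit Koszul representation; the factor 2 appears because the double sum counts every
  -- pair k, l twice.
  have e : F = (2 * ((n : ℝ) + 2))⁻¹ • ∑ l, ∑ k, mulVec (evalFun N
      (MvPolynomial.pderiv l (P k) - MvPolynomial.pderiv k (P l))) (koszul l k) := by
    have hn : (n : ℝ) + 2 ≠ 0 := by positivity
    rw [eq_inv_smul_iff₀ (by positivity)]
    funext x i
    have h1 : MvPolynomial.eval x (P i) = F x i := congrFun (hPF i) x
    have h2 := congrArg (MvPolynomial.eval x) (hcurl i)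
    simp only [map_sum, map_mul, map_sub, MvPolynomial.eval_X, MvPolynomial.smul_eval, h1] at h2
    simp only [Pi.smul_apply, smul_eq_mul, Finset.sum_apply, mulVec, koszul, evalFun,
      LinearMap.coe_mk, AddHom.coe_mk, map_sub, Pi.sub_apply, Pi.single_apply, mul_sub, mul_ite,
      mul_one, mul_zero, sum_sub_distrib, sum_ite_eq, mem_univ, if_true]
    rw [sum_comm (f := fun l k => if i = l then _ else _)]
    simp only [sum_ite_eq, mem_univ, if_true]
    rw [mul_assoc, ← h2, mul_sum]
    rw [← sum_sub_distrib]
    refine sum_congr rfl fun l _ => ?_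
    ring
  rw [e]
  refine W.smul_mem _ (W.sum_mem fun l _ => W.sum_mem fun k _ => hk l k _ (evalFun_mem_polyHom ?_))
  exact (hP k).pderiv.sub (hP l).pderiv

theorem nedelec_le {W : Submodule ℝ (Vec N)} {n : ℕ}
    (hc : ∀ k, ∀ f ∈ polyP N n, mulVec f (unitVec k) ∈ W)
    (hk : ∀ k l, ∀ f ∈ polyP N n, mulVec f (koszul k l) ∈ W) : nedelec N (n + 1) ≤ W :=
  sup_le (compSpace_le hc) (inf_radialOrth_le fun k l f hf => hk k l f (polyHom_le_polyP n hf))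

theorem raviartThomas_le {W : Submodule ℝ (Vec N)} {n : ℕ}
    (hc : ∀ k, ∀ f ∈ polyP N n, mulVec f (unitVec k) ∈ W)
    (hx : ∀ f ∈ polyP N n, mulVec f (fun x => x) ∈ W) : raviartThomas N (n + 1) ≤ W := by
  refine sup_le (compSpace_le hc) ?_
  rintro _ ⟨φ, hφ, rfl⟩
  exact hx φ (polyHom_le_polyP n hφ)

theorem mulVec_mem_of_monoFun {W : Submodule ℝ (Vec N)} {F : Vec N} {n : ℕ}
    (h : ∀ e : Fin N → ℕ, ∑ k, e k ≤ n → mulVec (monoFun e) F ∈ W) {f : Scal N}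
    (hf : f ∈ polyP N n) : mulVec f F ∈ W := by
  have : polyP N n ≤ mulVecComap W F := by
    rw [polyP, Submodule.span_le]
    rintro _ ⟨e, he, rfl⟩
    exact h e he
  exact this hf

theorem mulVec_unitVec_mem_nedelec {n : ℕ} {f : Scal N} (hf : f ∈ polyP N n) (k : Fin N) :
    mulVec f (unitVec k) ∈ nedelec N (n + 1) :=
  Submodule.mem_sup_left (mulVec_unitVec_mem_compSpace (S := fun _ => polyP N n) hf)

theorem mulVec_unitVec_mem_raviartThomas {n : ℕ} {f : Scal N} (hf : f ∈ polyP N n) (k : Fin N) :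
    mulVec f (unitVec k) ∈ raviartThomas N (n + 1) :=
  Submodule.mem_sup_left (mulVec_unitVec_mem_compSpace (S := fun _ => polyP N n) hf)

theorem mulVec_koszul_eq (f : Scal N) (k l : Fin N) : mulVec f (koszul k l) =
    mulVec (f * monoFun (Pi.single k 1)) (unitVec l)
      - mulVec (f * monoFun (Pi.single l 1)) (unitVec k) := by
  funext x i
  simp [mulVec, koszul, unitVec, monoFun_single, mul_assoc, mul_sub]

theorem mulVec_id_eq (f : Scal N) : mulVec f (fun x => x) =
    ∑ k, mulVec (f * monoFun (Pi.single k 1)) (unitVec k) := by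
  rw [eq_sum_mulVec_unitVec (mulVec f fun x => x)]
  refine sum_congr rfl fun k _ => ?_
  rw [monoFun_single]
  rfl

/-- Monomials of degree below n yield components of degree at most n, in the full polynomial
summand; monomials of degree exactly n yield homogeneous fields orthogonal to x. -/
theorem mulVec_koszul_mem_nedelec {n : ℕ} {f : Scal N} (hf : f ∈ polyP N n) (k l : Fin N) :
    mulVec f (koszul k l) ∈ nedelec N (n + 1) := by
  refine mulVec_mem_of_monoFun (fun e he => ?_) hf
  rcases he.lt_or_eq with he | he
  · rw [mulVec_koszul_eq]
    refine Submodule.sub_mem _ ?_ ?_ <;> refine mulVec_unitVec_mem_nedelec ?_ _ <;>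
    · rw [monoFun_mul]
      refine monoFun_mem_polyP ?_
      simp only [Pi.add_apply, sum_add_distrib, sum_pi_single', mem_univ, if_true]
      omega
  · refine Submodule.mem_sup_right ⟨?_, fun x => ?_⟩
    · rw [mulVec_koszul_eq]
      refine Submodule.sub_mem _ ?_ ?_ <;>
      refine mulVec_unitVec_mem_compSpace (S := fun _ => polyHom N (n + 1)) ?_ <;>
      · rw [monoFun_mul]
        refine monoFun_mem_polyHom ?_
        simp only [Pi.add_apply, sum_add_distrib, sum_pi_single', mem_univ, if_true]
        omega
    · simp [mulVec, koszul, dotProduct_sub, mul_comm (x k)]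

theorem mulVec_id_mem_raviartThomas {n : ℕ} {f : Scal N} (hf : f ∈ polyP N n) :
    mulVec f (fun x => x) ∈ raviartThomas N (n + 1) := by
  refine mulVec_mem_of_monoFun (fun e he => ?_) hf
  rcases he.lt_or_eq with he | he
  · rw [mulVec_id_eq]
    refine Submodule.sum_mem _ fun k _ => mulVec_unitVec_mem_raviartThomas ?_ _
    rw [monoFun_mul]
    refine monoFun_mem_polyP ?_
    simp only [Pi.add_apply, sum_add_distrib, sum_pi_single', mem_univ, if_true]
    omega
  · exact Submodule.mem_sup_right ⟨_, monoFun_mem_polyHom he, rfl⟩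

theorem radial_polyHom_le (n : ℕ) :
    radial (polyHom N n) ≤ compSpace fun _ => polyHom N (n + 1) := by
  rintro _ ⟨φ, hφ, rfl⟩ k
  have h : (fun x => x k : Scal N) ∈ polyHom N 1 := by
    rw [← monoFun_single]
    exact monoFun_mem_polyHom (by simp)
  exact polyHom_mul_le n 1 (Submodule.mul_mem_mul hφ h)

/-! ### Dimensions -/

/-- A vector function in a product space, as the family of its components. -/
def compSpaceEquiv (S : Fin N → Submodule ℝ (Scal N)) : compSpace S ≃ₗ[ℝ] ((k : Fin N) → S k) where
  toFun F k := ⟨fun x => F.1 x k, F.2 k⟩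
  invFun G := ⟨fun x k => (G k).1 x, fun k => (G k).2⟩
  map_add' _ _ := rfl
  map_smul' _ _ := rfl
  left_inv _ := rfl
  right_inv _ := rfl

instance (S : Fin N → Submodule ℝ (Scal N)) [∀ k, FiniteDimensional ℝ (S k)] :
    FiniteDimensional ℝ (compSpace S) :=
  (compSpaceEquiv S).symm.finiteDimensional

theorem finrank_compSpace (S : Fin N → Submodule ℝ (Scal N)) [∀ k, FiniteDimensional ℝ (S k)] :
    Module.finrank ℝ (compSpace S) = ∑ k, Module.finrank ℝ (S k) := by
  rw [(compSpaceEquiv S).finrank_eq, Module.finrank_pi_fintype]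

theorem disjoint_polyP_polyHom (n : ℕ) : Disjoint (polyP N n) (polyHom N (n + 1)) := by
  have h := (linearIndependent_monoFun N).disjoint_span_image
    (s := {e | ∑ k, e k ≤ n}) (t := {e | ∑ k, e k = n + 1}) (by
      rw [Set.disjoint_left]
      intro e (h : _ ≤ n) (h' : _ = n + 1)
      omega)
  refine h.mono ?_ ?_ <;>
  · refine Submodule.span_mono ?_
    rintro _ ⟨e, he, rfl⟩
    exact ⟨e, he, rfl⟩

theorem disjoint_compSpace (n : ℕ) :
    Disjoint (compSpace fun _ : Fin N => polyP N n) (compSpace fun _ => polyHom N (n + 1)) := by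
  rw [Submodule.disjoint_def]
  intro F h1 h2
  funext x k
  exact congrFun (Submodule.disjoint_def.mp (disjoint_polyP_polyHom n) _ (h1 k) (h2 k)) x

instance (p : ℕ) : FiniteDimensional ℝ (nedelec N p) := by
  unfold nedelec
  infer_instance

instance (p : ℕ) : FiniteDimensional ℝ (radial (polyHom N p)) :=
  Submodule.finiteDimensional_of_le (radial_polyHom_le p)

instance (p : ℕ) : FiniteDimensional ℝ (raviartThomas N p) := by
  unfold raviartThomas
  infer_instance

/-- The pointwise product `x · E(x)` on homogeneous vector functions. -/
def dotId (N n : ℕ) : (compSpace fun _ : Fin N => polyHom N n) →ₗ[ℝ] polyHom N (n + 1) where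
  toFun F := ⟨fun x => x ⬝ᵥ F.1 x, by
    have : (fun x => x ⬝ᵥ F.1 x) = ∑ k, (fun x => F.1 x k : Scal N) * monoFun (Pi.single k 1) := by
      funext x
      simp [dotProduct, monoFun_single, mul_comm]
    rw [this]
    exact Submodule.sum_mem _ fun k _ => polyHom_mul_le n 1
      (Submodule.mul_mem_mul (F.2 k) (monoFun_mem_polyHom (by simp)))⟩
  map_add' F G := by
    ext x
    simp [dotProduct_add]
  map_smul' c F := by
    ext x
    simp [dotProduct_smul]

/-- Rank-nullity for E ↦ x · E on homogeneous fields, whose kernel is the second summand of the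
Nédélec space. Bounding the rank by the dimension of the target suffices, as only a lower bound is
wanted; surjectivity is not needed. -/
theorem le_finrank_nedelec (n : ℕ) :
    N * Module.finrank ℝ (polyP N n) + N * Module.finrank ℝ (polyHom N (n + 1))
      ≤ Module.finrank ℝ (nedelec N (n + 1)) + Module.finrank ℝ (polyHom N (n + 2)) := by
  have hd : Disjoint (compSpace fun _ : Fin N => polyP N n)
      (compSpace (fun _ => polyHom N (n + 1)) ⊓ radialOrth N) :=
    (disjoint_compSpace n).mono_right inf_le_left
  have h1 := Submodule.finrank_sup_add_finrank_inf_eq (compSpace fun _ : Fin N => polyP N n)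
    (compSpace (fun _ => polyHom N (n + 1)) ⊓ radialOrth N)
  rw [hd.eq_bot, finrank_bot, add_zero, finrank_compSpace] at h1
  have h2 := LinearMap.finrank_range_add_finrank_ker (dotId N (n + 1))
  rw [finrank_compSpace] at h2
  have h3 := Submodule.finrank_le (LinearMap.range (dotId N (n + 1)))
  have h4 : Module.finrank ℝ (LinearMap.ker (dotId N (n + 1)))
      = Module.finrank ℝ ↥(compSpace (fun _ => polyHom N (n + 1)) ⊓ radialOrth N) := by
    rw [← Submodule.finrank_map_subtype_eq]
    have e : (LinearMap.ker (dotId N (n + 1))).map (Submodule.subtype _)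
        = compSpace (fun _ => polyHom N (n + 1)) ⊓ radialOrth N := by
      ext F
      constructor
      · rintro ⟨G, hG, rfl⟩
        exact ⟨G.2, fun x => congrFun (congrArg Subtype.val hG) x⟩
      · rintro ⟨hF, hx⟩
        exact ⟨⟨F, hF⟩, Subtype.ext (funext hx), rfl⟩
    rw [e]
  simp only [sum_const, card_univ, Fintype.card_fin, smul_eq_mul] at h1 h2
  change _ ≤ Module.finrank ℝ ↥(compSpace (fun _ : Fin N => polyP N n) ⊔
    (compSpace (fun _ => polyHom N (n + 1)) ⊓ radialOrth N)) +
      Module.finrank ℝ (polyHom N (n + 1 + 1))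
  omega

/-- The map φ ↦ φ x is injective: if φ x = 0, the k-th component shows that φ vanishes on the
positive orthant, hence everywhere. The index k expresses N ≥ 1. -/
theorem finrank_radial {S : Submodule ℝ (Scal N)} (hS : S ≤ polyAll N) (k : Fin N) :
    Module.finrank ℝ (radial S) = Module.finrank ℝ S := by
  let φ : S →ₗ[ℝ] radial S :=
    { toFun := fun f => ⟨fun x => f.1 x • x, f.1, f.2, rfl⟩
      map_add' := fun f g => by ext x; simp [add_mul]
      map_smul' := fun c f => by ext x; simp [mul_assoc] }
  refine (LinearEquiv.finrank_eq (LinearEquiv.ofBijective φ ⟨?_, ?_⟩)).symm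
  · rw [← LinearMap.ker_eq_bot, LinearMap.ker_eq_bot']
    intro f hf
    refine Subtype.ext (eq_zero_of_mem_polyAll (hS f.2) (s := fun _ => Set.Ioi 0)
      (fun _ => Set.Ioi_infinite 0) fun x hx => ?_)
    have h := congrFun (congrFun (congrArg Subtype.val hf) x) k
    have hxk : 0 < x k := hx k trivial
    simpa [φ, hxk.ne'] using h
  · rintro ⟨_, f, hf, rfl⟩
    exact ⟨⟨f, hf⟩, rfl⟩

theorem finrank_raviartThomas (n : ℕ) (k : Fin N) :
    Module.finrank ℝ (raviartThomas N (n + 1))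
      = N * Module.finrank ℝ (polyP N n) + Module.finrank ℝ (polyHom N n) := by
  have hd : Disjoint (compSpace fun _ : Fin N => polyP N n) (radial (polyHom N n)) :=
    (disjoint_compSpace n).mono_right (radial_polyHom_le n)
  have h1 := Submodule.finrank_sup_add_finrank_inf_eq (compSpace fun _ : Fin N => polyP N n)
    (radial (polyHom N n))
  rw [hd.eq_bot, finrank_bot, add_zero, finrank_compSpace,
    finrank_radial (polyHom_le_polyAll N n) k] at h1
  simp only [sum_const, card_univ, Fintype.card_fin, smul_eq_mul] at h1
  exact h1

/-! ### Functions that vanish on a box -/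

theorem compSpace_mono {S T : Fin N → Submodule ℝ (Scal N)} (h : ∀ k, S k ≤ T k) :
    compSpace S ≤ compSpace T := fun _ hF k => h k (hF k)

theorem nedelec_le_compSpace_polyAll (p : ℕ) : nedelec N p ≤ compSpace fun _ => polyAll N :=
  sup_le (compSpace_mono fun _ => polyP_le_polyAll N _)
    (inf_le_left.trans (compSpace_mono fun _ => polyHom_le_polyAll N _))

theorem raviartThomas_le_compSpace_polyAll (p : ℕ) :
    raviartThomas N p ≤ compSpace fun _ => polyAll N :=
  sup_le (compSpace_mono fun _ => polyP_le_polyAll N _)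
    ((radial_polyHom_le _).trans (compSpace_mono fun _ => polyHom_le_polyAll N _))

theorem eq_zero_of_mem_compSpace_polyAll {F : Vec N} (hF : F ∈ compSpace fun _ => polyAll N)
    {s : Fin N → Set ℝ} (hs : ∀ i, (s i).Infinite) (h : ∀ x ∈ Set.pi .univ s, F x = 0) :
    F = 0 := by
  funext x k
  exact congrFun (eq_zero_of_mem_polyAll (hF k) hs fun x hx => congrFun (h x hx) k) x

end VectorSpaces

/-! ### Tensor products with polynomials in the third coordinate -/

section Tensor

variable {W : Type} [AddCommGroup W] [Module ℝ W]

/-- The product `g(z) f(x, y)`. -/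
def tensorMul (W : Type) [AddCommGroup W] [Module ℝ W] :
    Scal 1 →ₗ[ℝ] ((Fin 2 → ℝ) → W) →ₗ[ℝ] ((Fin 3 → ℝ) → W) :=
  LinearMap.mk₂ ℝ (fun g f x => g ![x 2] • f ![x 0, x 1])
    (fun g g' f => by funext x; simp [add_smul]) (fun c g f => by funext x; simp [mul_smul])
    (fun g f f' => by funext x; simp) (fun c g f => by funext x; simp [smul_comm c])

theorem tensorMul_apply (g : Scal 1) (f : (Fin 2 → ℝ) → W) (x : Fin 3 → ℝ) :
    tensorMul W g f x = g ![x 2] • f ![x 0, x 1] := rfl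

theorem tensorZ_eq_map₂ (S : Submodule ℝ ((Fin 2 → ℝ) → W)) (q : ℕ) :
    tensorZ S q = Submodule.map₂ (tensorMul W) (polyP 1 q) S := by
  rw [Submodule.map₂_eq_span_image2, tensorZ]
  congr 1
  ext h
  constructor
  · rintro ⟨f, hf, g, hg, rfl⟩
    exact ⟨g, hg, f, hf, rfl⟩
  · rintro ⟨g, hg, f, hf, rfl⟩
    exact ⟨f, hf, g, hg, rfl⟩

theorem tensorMul_mem {S : Submodule ℝ ((Fin 2 → ℝ) → W)} {q : ℕ} {g : Scal 1}
    {f : (Fin 2 → ℝ) → W} (hg : g ∈ polyP 1 q) (hf : f ∈ S) : tensorMul W g f ∈ tensorZ S q := by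
  rw [tensorZ_eq_map₂]
  exact Submodule.apply_mem_map₂ _ hg hf

theorem tensorZ_le {S : Submodule ℝ ((Fin 2 → ℝ) → W)} {q : ℕ} {ι κ : Type*}
    {u : ι → (Fin 2 → ℝ) → W} {v : κ → Scal 1} (hu : Submodule.span ℝ (Set.range u) = S)
    (hv : Submodule.span ℝ (Set.range v) = polyP 1 q) {U : Submodule ℝ ((Fin 3 → ℝ) → W)}
    (h : ∀ i j, tensorMul W (v j) (u i) ∈ U) : tensorZ S q ≤ U := by
  rw [tensorZ_eq_map₂, ← hu, ← hv, Submodule.map₂_span_span, Submodule.span_le]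
  rintro _ ⟨_, ⟨j, rfl⟩, _, ⟨i, rfl⟩, rfl⟩
  exact h i j

instance (S : Submodule ℝ ((Fin 2 → ℝ) → W)) [FiniteDimensional ℝ S] (q : ℕ) :
    FiniteDimensional ℝ (tensorZ S q) := by
  rw [tensorZ_eq_map₂]
  exact Module.Finite.iff_fg.mpr ((Module.Finite.iff_fg.mp (finiteDimensional_polyP 1 q)).map₂ _
    (Module.Finite.iff_fg.mp ‹FiniteDimensional ℝ S›))

/-- A sum Σ z^k G_k(x,y) determines the G_k: its values at z = 0, …, q, multiplied by a left inverse
of the Vandermonde matrix, recover each of them. This works pointwise and for values in any W. The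
inequality suffices for `IsHierarchicalBasis.of_span`. -/
theorem finrank_mul_le_finrank_tensorZ (S : Submodule ℝ ((Fin 2 → ℝ) → W)) [FiniteDimensional ℝ S]
    (q : ℕ) : Module.finrank ℝ S * (q + 1) ≤ Module.finrank ℝ (tensorZ S q) := by
  have hz : ∀ k : Fin (q + 1), (monoFun (fun _ => k) : Scal 1) ∈ polyP 1 q := fun k =>
    monoFun_mem_polyP (by simpa using k.is_le)
  let φ : (Fin (q + 1) → S) →ₗ[ℝ] tensorZ S q :=
    { toFun := fun G => ∑ k : Fin (q + 1), ⟨tensorMul W (monoFun fun _ => k) (G k).1,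
        tensorMul_mem (hz k) (G k).2⟩
      map_add' := fun G H => by
        rw [← sum_add_distrib]
        refine sum_congr rfl fun k _ => Subtype.ext ?_
        simp
      map_smul' := fun c G => by
        rw [RingHom.id_apply, smul_sum]
        refine sum_congr rfl fun k _ => Subtype.ext ?_
        simp }
  have hφ : Function.Injective φ := by
    rw [← LinearMap.ker_eq_bot, LinearMap.ker_eq_bot']
    intro G hG
    have hG' : ∀ x : Fin 2 → ℝ, ∀ z : ℝ, ∑ k : Fin (q + 1), z ^ (k : ℕ) • (G k).1 x = 0 := by
      intro x z
      have h := congrFun (congrArg Subtype.val hG) ![x 0, x 1, z]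
      simp only [φ, LinearMap.coe_mk, AddHom.coe_mk, AddSubmonoidClass.coe_finsetSum,
        Finset.sum_apply, tensorMul_apply] at h
      have hx : ![x 0, x 1] = x := by
        ext i
        fin_cases i <;> rfl
      simpa [monoFun, hx] using h
    funext k
    refine Subtype.ext (funext fun x => ?_)
    have hinj : Function.Injective fun k : Fin (q + 1) => (k : ℝ) := fun i j h => by
      simpa [Fin.ext_iff] using h
    have hdet : IsUnit (Matrix.vandermonde fun k : Fin (q + 1) => (k : ℝ)) := by
      rw [Matrix.isUnit_iff_isUnit_det, isUnit_iff_ne_zero, Matrix.det_vandermonde_ne_zero_iff]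
      exact hinj
    obtain ⟨B, hB⟩ := hdet.exists_left_inv
    have h0 : (G k).1 x = ∑ i : Fin (q + 1), B k i •
        ∑ l : Fin (q + 1), ((i : ℝ)) ^ (l : ℕ) • (G l).1 x := by
      simp_rw [smul_sum, smul_smul]
      rw [sum_comm]
      simp_rw [← sum_smul]
      have hBl : ∀ l : Fin (q + 1), ∑ i : Fin (q + 1), B k i * ((i : ℝ)) ^ (l : ℕ) = if k = l then 1 else 0 := by
        intro l
        have := congrFun (congrFun hB k) l
        simpa [Matrix.mul_apply, Matrix.vandermonde_apply, Matrix.one_apply] using this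
      simp [hBl]
    rw [h0]
    simp [hG']
  have := LinearMap.finrank_le_finrank_of_injective hφ
  rw [Module.finrank_pi_fintype] at this
  simpa [mul_comm] using this

theorem tensorZ_le_polyAll {S : Submodule ℝ (Scal 2)} (hS : S ≤ polyAll 2) (q : ℕ) :
    tensorZ S q ≤ polyAll 3 := by
  rw [tensorZ_eq_map₂]
  refine (Submodule.map₂_le_map₂ (polyP_le_polyAll 1 q) hS).trans ?_
  rw [polyAll, polyAll, Submodule.map₂_span_span, Submodule.span_le]
  rintro _ ⟨_, ⟨e, rfl⟩, _, ⟨e', rfl⟩, rfl⟩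
  refine Submodule.subset_span ⟨![e' 0, e' 1, e 0], ?_⟩
  funext x
  simp [tensorMul_apply, monoFun, Fin.prod_univ_three, Fin.prod_univ_two]
  ring

theorem component_mem_polyAll {S : Submodule ℝ (Vec 2)} (hS : S ≤ compSpace fun _ => polyAll 2)
    {q : ℕ} {F : (Fin 3 → ℝ) → (Fin 2 → ℝ)} (hF : F ∈ tensorZ S q) (k : Fin 2) :
    (fun x => F x k) ∈ polyAll 3 := by
  have h : tensorZ S q ≤ (polyAll 3).comap
      ({ toFun := fun F x => F x k
         map_add' := fun _ _ => rfl
         map_smul' := fun _ _ => rfl } : ((Fin 3 → ℝ) → (Fin 2 → ℝ)) →ₗ[ℝ] Scal 3) := by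
    rw [tensorZ, Submodule.span_le]
    rintro _ ⟨f, hf, g, hg, rfl⟩
    refine tensorZ_le_polyAll (S := polyAll 2) le_rfl q ?_
    exact Submodule.subset_span ⟨_, hS hf k, g, hg, rfl⟩
  exact h hF

theorem prismProd_le_compSpace_polyAll {T : Submodule ℝ (Vec 2)} {S : Submodule ℝ (Scal 2)}
    (hT : T ≤ compSpace fun _ => polyAll 2) (hS : S ≤ polyAll 2) (q r : ℕ) :
    prismProd (tensorZ T q) (tensorZ S r) ≤ compSpace fun _ => polyAll 3 := by
  rintro F ⟨h1, h2⟩ k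
  fin_cases k
  · exact component_mem_polyAll hT h1 0
  · exact component_mem_polyAll hT h1 1
  · exact tensorZ_le_polyAll hS r h2

/-- A vector function on the prism, as the pair of its horizontal and vertical parts. -/
def prismProdEquiv (T : Submodule ℝ ((Fin 3 → ℝ) → (Fin 2 → ℝ))) (S : Submodule ℝ (Scal 3)) :
    prismProd T S ≃ₗ[ℝ] T × S where
  toFun F := (⟨fun x => ![F.1 x 0, F.1 x 1], F.2.1⟩, ⟨fun x => F.1 x 2, F.2.2⟩)
  invFun G := ⟨fun x => ![G.1.1 x 0, G.1.1 x 1, G.2.1 x], by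
    refine ⟨?_, G.2.2⟩
    convert G.1.2 using 1
    funext x i
    fin_cases i <;> rfl⟩
  map_add' F G := by
    refine Prod.ext (Subtype.ext ?_) rfl
    funext x i
    fin_cases i <;> rfl
  map_smul' c F := by
    refine Prod.ext (Subtype.ext ?_) rfl
    funext x i
    fin_cases i <;> rfl
  left_inv F := by
    refine Subtype.ext ?_
    funext x i
    fin_cases i <;> rfl
  right_inv G := by
    refine Prod.ext (Subtype.ext ?_) rfl
    funext x i
    fin_cases i <;> rfl

theorem finrank_prismProd (T : Submodule ℝ ((Fin 3 → ℝ) → (Fin 2 → ℝ))) (S : Submodule ℝ (Scal 3))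
    [FiniteDimensional ℝ T] [FiniteDimensional ℝ S] :
    Module.finrank ℝ (prismProd T S) = Module.finrank ℝ T + Module.finrank ℝ S := by
  rw [(prismProdEquiv T S).finrank_eq, Module.finrank_prod]

end Tensor

/-! ### Gradients of affine coordinates -/

section Gradient

variable {N : ℕ}

theorem grad_coord (k : Fin N) : grad (fun x : Fin N → ℝ => x k) = unitVec k := by
  funext x i
  have h := (hasFDerivAt_apply (𝕜 := ℝ) k x).fderiv
  simp only [grad]
  rw [h]
  simp [unitVec, Pi.single_apply, eq_comm]

theorem differentiable_coord (k : Fin N) : Differentiable ℝ fun x : Fin N → ℝ => x k :=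
  differentiable_apply k

theorem grad_sub {f g : Scal N} (hf : Differentiable ℝ f) (hg : Differentiable ℝ g) :
    grad (fun x => f x - g x) = grad f - grad g := by
  funext x i
  simp [grad, fderiv_fun_sub (hf x) (hg x)]

theorem grad_const (c : ℝ) : grad (fun _ : Fin N → ℝ => c) = 0 := by
  funext x i
  simp [grad]

theorem grad_zero : grad (0 : Scal N) = 0 := grad_const 0

theorem grad_mu_one (k : Fin N) : grad (mu k 1) = unitVec k := grad_coord k

theorem grad_mu_zero (k : Fin N) : grad (mu k 0) = -unitVec k := by
  have := grad_sub (differentiable_const (1 : ℝ)) (differentiable_coord k)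
  rw [grad_const, grad_coord, zero_sub] at this
  exact this

/-- Since μ₀ + μ₁ = 1, the field μ₀∇μ₁ - μ₁∇μ₀ is constant; on tensor-product elements all fields
are thus scalar multiples of unit vectors. -/
theorem fieldE_mu (i : ℕ) (k : Fin N) :
    fieldE i (mu k) = mulVec (hom (legendreP i) (mu k 0) (mu k 1)) (unitVec k) := by
  have : mulVec (mu k 0) (grad (mu k 1)) - mulVec (mu k 1) (grad (mu k 0)) = unitVec k := by
    rw [grad_mu_one, grad_mu_zero]
    funext x
    simp [mulVec, mu, sub_smul]
  rw [fieldE, this]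

end Gradient

/-! ### Degrees and degenerate arguments -/

section Degree

variable {N : ℕ}

theorem legendreL_hasLead (n : ℕ) : ∃ a, HasLead (n + 1) a (legendreL (n + 1)) := by
  obtain ⟨a, -, h⟩ := legendreP_hasLead n
  obtain ⟨g, hg, hL⟩ := h.integral
  exact ⟨_, hg.mul_x.congr hL⟩

theorem phiE_mem {V : Submodule ℝ (Scal N)} {s : Fin 2 → Scal N} (h : ∀ k, s k ∈ V) {i : ℕ}
    (hi : 1 ≤ i) : phiE i s ∈ V ^ i := by
  obtain ⟨n, rfl⟩ : ∃ n, i = n + 1 := ⟨i - 1, by omega⟩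
  obtain ⟨a, ha⟩ := legendreL_hasLead n
  exact ha.hom_mem (h 0) (h 1)

theorem legendreP_hom_mem {V : Submodule ℝ (Scal N)} {s₀ s₁ : Scal N} (h₀ : s₀ ∈ V) (h₁ : s₁ ∈ V)
    (i : ℕ) : hom (legendreP i) s₀ s₁ ∈ V ^ i := by
  obtain ⟨a, -, ha⟩ := legendreP_hasLead i
  exact ha.hom_mem h₀ h₁

theorem jacobiP_hom_mem {V : Submodule ℝ (Scal N)} {s₀ s₁ : Scal N} (h₀ : s₀ ∈ V) (h₁ : s₁ ∈ V)
    (m j : ℕ) : hom (jacobiP (m : ℝ) j) s₀ s₁ ∈ V ^ j := by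
  obtain ⟨a, -, ha⟩ := jacobiP_nat_hasLead m j
  exact ha.hom_mem h₀ h₁

theorem jacobiL_hom_mem {V : Submodule ℝ (Scal N)} {s₀ s₁ : Scal N} (h₀ : s₀ ∈ V) (h₁ : s₁ ∈ V)
    (m : ℕ) {j : ℕ} (hj : 1 ≤ j) : hom (jacobiL (m : ℝ) j) s₀ s₁ ∈ V ^ j := by
  obtain ⟨n, rfl⟩ : ∃ n, j = n + 1 := ⟨j - 1, by omega⟩
  obtain ⟨g, a, -, hg, hL⟩ := jacobiL_succ (Nat.cast_nonneg (α := ℝ) m) n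
  exact (hg.mul_x.congr hL).hom_mem h₀ h₁

theorem phiT_mem {V : Submodule ℝ (Scal N)} {s : Fin 3 → Scal N} (h : ∀ k, s k ∈ V) {i j : ℕ}
    (hi : 1 ≤ i) (hj : 1 ≤ j) : phiT i j s ∈ V ^ (i + j) := by
  rw [pow_add]
  refine Submodule.mul_mem_mul (phiE_mem (fun k => ?_) hi)
    (jacobiL_hom_mem (V.add_mem (h 0) (h 1)) (h 2) _ hj)
  fin_cases k
  · exact h 0
  · exact h 1

theorem polyT_mem {V : Submodule ℝ (Scal N)} {s : Fin 3 → Scal N} (h : ∀ k, s k ∈ V) (i j : ℕ) :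
    polyT i j s ∈ V ^ (i + j) := by
  rw [pow_add]
  exact Submodule.mul_mem_mul (legendreP_hom_mem (h 0) (h 1) i)
    (jacobiP_hom_mem (V.add_mem (h 0) (h 1)) (h 2) _ j)

/-- Such vanishing statements let segment and triangle use the four-coordinate results with
coordinates padded by 0. For i = 1 the factor s 0 is absent, hence the bound on i. -/
theorem phiE_eq_zero {i : ℕ} (hi : 2 ≤ i) {s : Fin 2 → Scal N} (h : s 0 = 0 ∨ s 1 = 0) :
    phiE i s = 0 := by
  obtain ⟨q, -, hq⟩ := exists_phiE_factor
  obtain ⟨n, rfl⟩ : ∃ n, i = n + 2 := ⟨i - 2, by omega⟩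
  rw [hq]
  rcases h with h | h <;> simp [h]

theorem jacobiL_hom_zero (m : ℕ) {j : ℕ} (hj : 1 ≤ j) (s : Scal N) :
    hom (jacobiL (m : ℝ) j) s 0 = 0 := by
  obtain ⟨q, -, hq⟩ := exists_jacobiL_factor
  obtain ⟨n, rfl⟩ : ∃ n, j = n + 1 := ⟨j - 1, by omega⟩
  rw [hq, zero_mul]

theorem phiT_eq_zero {i j : ℕ} (hi : 2 ≤ i) (hj : 1 ≤ j) {s : Fin 3 → Scal N}
    (h : s 0 = 0 ∨ s 1 = 0 ∨ s 2 = 0) : phiT i j s = 0 := by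
  rcases h with h | h | h
  · rw [phiT, phiE_eq_zero hi (Or.inl h), zero_mul]
  · rw [phiT, phiE_eq_zero hi (Or.inr h), zero_mul]
  · rw [phiT, h, jacobiL_hom_zero _ hj, mul_zero]

theorem fieldE_eq_zero (i : ℕ) {s : Fin 2 → Scal N} (h : s 0 = 0 ∨ s 1 = 0) :
    fieldE i s = 0 := by
  rcases h with h | h <;> (funext x; simp [fieldE, mulVec, h, grad_zero])

theorem fieldT_eq_zero (i : ℕ) {j : ℕ} (hj : 1 ≤ j) {s : Fin 3 → Scal N}
    (h : s 0 = 0 ∨ s 1 = 0 ∨ s 2 = 0) : fieldT i j s = 0 := by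
  rcases h with h | h | h
  · rw [fieldT, fieldE_eq_zero i (Or.inl h)]
    funext x
    simp [mulVec]
  · rw [fieldT, fieldE_eq_zero i (Or.inr h)]
    funext x
    simp [mulVec]
  · rw [fieldT, h, jacobiL_hom_zero _ hj]
    funext x
    simp [mulVec]

end Degree

/-! ### Polynomials in one coordinate -/

section Line

variable {N : ℕ}

/-- The `H¹` shape functions in the coordinate `x_k`. -/
def lineH1 (k : Fin N) (p : ℕ) : Set (Scal N) :=
  {f | (∃ c, f = mu k c) ∨ ∃ i, 2 ≤ i ∧ i ≤ p ∧ f = phiE i (mu k)}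

/-- The `L²` shape functions in the coordinate `x_k`. -/
def lineL2 (k : Fin N) (p : ℕ) : Set (Scal N) :=
  {f | ∃ i < p, f = hom (legendreP i) (mu k 0) (mu k 1)}

/-- The coordinates `μ`, extended by zero. -/
def lineCoord (k : Fin N) : Fin 4 → Scal N := ![mu k 0, mu k 1, 0, 0]

theorem sum_lineCoord (k : Fin N) : ∑ i, lineCoord k i = 1 := by
  funext x
  simp [Fin.sum_univ_four, lineCoord, mu]

theorem coord_pow_mem {U : Submodule ℝ (Scal N)} {k : Fin N} {n j : ℕ}
    (h : Submodule.span ℝ (Set.range (lineCoord k)) ^ n ≤ U) (hj : j ≤ n) :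
    (fun x => x k ^ j) ∈ U := by
  refine h (pow_le_pow_right' (Submodule.one_le.mpr (one_mem_span_range (sum_lineCoord k))) hj ?_)
  have : lineCoord k 1 ∈ Submodule.span ℝ (Set.range (lineCoord k)) :=
    Submodule.subset_span ⟨1, rfl⟩
  exact Submodule.pow_mem_pow _ this j

/-- The tetrahedral H¹ argument for the coordinates (μ₀, μ₁, 0, 0): only the edge 01 and its
vertices carry nonzero functions. -/
theorem coord_pow_mem_span_lineH1 {k : Fin N} {p j : ℕ} (hp : 1 ≤ p) (hj : j ≤ p) :
    (fun x => x k ^ j) ∈ Submodule.span ℝ (lineH1 k p) := by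
  refine coord_pow_mem (span_pow_le_of_H1 (sum_lineCoord k) hp (fun a => ?_) (fun a b hab i hi hip =>
    ?_) (fun a b c hab hbc i j hi hj hij => ?_) fun i j l hi hj hl h => ?_) hj
  · fin_cases a
    · exact Submodule.subset_span (Or.inl ⟨0, rfl⟩)
    · exact Submodule.subset_span (Or.inl ⟨1, rfl⟩)
    · exact Submodule.zero_mem _
    · exact Submodule.zero_mem _
  · have h : (a = 0 ∧ b = 1) ∨ b = 2 ∨ b = 3 := by omega
    rcases h with ⟨rfl, rfl⟩ | rfl | rfl
    · exact Submodule.subset_span (Or.inr ⟨i, hi, hip, rfl⟩)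
    · rw [phiE_eq_zero hi (Or.inr rfl)]
      exact Submodule.zero_mem _
    · rw [phiE_eq_zero hi (Or.inr rfl)]
      exact Submodule.zero_mem _
  · have h : c = 2 ∨ c = 3 := by omega
    rcases h with rfl | rfl
    · rw [phiT_eq_zero hi hj (Or.inr (Or.inr rfl))]
      exact Submodule.zero_mem _
    · rw [phiT_eq_zero hi hj (Or.inr (Or.inr rfl))]
      exact Submodule.zero_mem _
  · rw [phiT_eq_zero hi hj (Or.inr (Or.inr rfl)), zero_mul]
    exact Submodule.zero_mem _

/-- The edge elimination with s_c = s_d = 0, so that its two correction hypotheses are trivial. -/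
theorem coord_pow_mem_span_lineL2 {k : Fin N} {p j : ℕ} (hj : j < p) :
    (fun x => x k ^ j) ∈ Submodule.span ℝ (lineL2 k p) := by
  refine coord_pow_mem (n := p - 1) (span_pow_le_of_edge (sum_lineCoord k) (a := 0) (b := 1)
    (c := 2) (d := 3) (by decide) legendreP_hasLead (fun i hi => ?_) (fun m hm g hg => ?_)
    fun m hm g hg => ?_) (by omega)
  · exact Submodule.subset_span ⟨i, by omega, rfl⟩
  · simp [lineCoord]
  · simp [lineCoord]

theorem polyQ_mul_le (d d' : Fin N → ℕ) : polyQ d * polyQ d' ≤ polyQ (d + d') := by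
  rw [polyQ, polyQ, Submodule.span_mul_span, Submodule.span_le]
  rintro _ ⟨_, ⟨e, he, rfl⟩, _, ⟨e', he', rfl⟩, rfl⟩
  change monoFun e * monoFun e' ∈ _
  rw [monoFun_mul]
  exact Submodule.subset_span ⟨_, fun k => Nat.add_le_add (he k) (he' k), rfl⟩

theorem polyQ_mono {d d' : Fin N → ℕ} (h : d ≤ d') : polyQ d ≤ polyQ d' :=
  Submodule.span_mono fun _ ⟨e, he, hf⟩ => ⟨e, fun k => (he k).trans (h k), hf⟩

theorem one_mem_polyQ (d : Fin N → ℕ) : (1 : Scal N) ∈ polyQ d := by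
  rw [← monoFun_zero]
  exact Submodule.subset_span ⟨0, fun k => Nat.zero_le _, rfl⟩

theorem mu_mem_polyQ (k : Fin N) (c : Fin 2) : mu k c ∈ polyQ (Pi.single k 1) := by
  have h1 : (mu k 1 : Scal N) ∈ polyQ (Pi.single k 1) := by
    refine Submodule.subset_span ⟨Pi.single k 1, fun _ => le_rfl, ?_⟩
    rw [monoFun_single]
    rfl
  fin_cases c
  · exact Submodule.sub_mem _ (one_mem_polyQ _) h1
  · exact h1

theorem polyQ_single_pow_le (k : Fin N) (n : ℕ) :
    polyQ (Pi.single k 1 : Fin N → ℕ) ^ n ≤ polyQ (Pi.single k n) := by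
  induction n with
  | zero =>
    rw [pow_zero, Submodule.one_le]
    exact one_mem_polyQ _
  | succ n ih =>
    rw [pow_succ, Pi.single_add]
    exact (mul_le_mul_left ih _).trans (polyQ_mul_le _ _)

theorem lineH1_mem_polyQ {k : Fin N} {p : ℕ} (hp : 1 ≤ p) {f : Scal N} (hf : f ∈ lineH1 k p) :
    f ∈ polyQ (Pi.single k p) := by
  rcases hf with ⟨c, rfl⟩ | ⟨i, hi, hip, rfl⟩
  · exact polyQ_mono (Pi.single_mono k hp) (mu_mem_polyQ k c)
  · exact polyQ_mono (Pi.single_mono k hip) (polyQ_single_pow_le k i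
      (phiE_mem (mu_mem_polyQ k) (by omega)))

theorem lineL2_mem_polyQ {k : Fin N} {p : ℕ} {f : Scal N} (hf : f ∈ lineL2 k p) :
    f ∈ polyQ (Pi.single k (p - 1)) := by
  obtain ⟨i, hi, rfl⟩ := hf
  exact polyQ_mono (Pi.single_mono k (by omega)) (polyQ_single_pow_le k i
    (legendreP_hom_mem (mu_mem_polyQ k 0) (mu_mem_polyQ k 1) i))

theorem mul_mem_polyQ {d d' e : Fin N → ℕ} (h : d + d' ≤ e) {f g : Scal N} (hf : f ∈ polyQ d)
    (hg : g ∈ polyQ d') : f * g ∈ polyQ e :=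
  polyQ_mono h (polyQ_mul_le d d' (Submodule.mul_mem_mul hf hg))

theorem polyQ_one_le {U : Submodule ℝ (Scal 1)} {d : Fin 1 → ℕ} {A : Set (Scal 1)}
    (hA : ∀ j ≤ d 0, (fun x => x 0 ^ j) ∈ Submodule.span ℝ A) (h : ∀ a ∈ A, a ∈ U) :
    polyQ d ≤ U := by
  rw [polyQ, Submodule.span_le]
  rintro _ ⟨e, he, rfl⟩
  have : monoFun e = fun x => x 0 ^ e 0 := by
    funext x
    simp [monoFun]
  rw [this]
  exact Submodule.span_le.mpr h (hA _ (he 0))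

/-- A monomial is a product of powers of single coordinates, and products of spanning sets span. The
free starting direction k matches the cyclic order in which the shape functions of each component
list their factors. -/
theorem polyQ_two_le {U : Submodule ℝ (Scal 2)} {d : Fin 2 → ℕ} (k : Fin 2) {A B : Set (Scal 2)}
    (hA : ∀ j ≤ d k, (fun x => x k ^ j) ∈ Submodule.span ℝ A)
    (hB : ∀ j ≤ d (k + 1), (fun x => x (k + 1) ^ j) ∈ Submodule.span ℝ B)
    (h : ∀ a ∈ A, ∀ b ∈ B, a * b ∈ U) : polyQ d ≤ U := by
  rw [polyQ, Submodule.span_le]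
  rintro _ ⟨e, he, rfl⟩
  have : monoFun e = (fun x => x k ^ e k) * fun x => x (k + 1) ^ e (k + 1) := by
    funext x
    fin_cases k <;> simp [monoFun, Fin.prod_univ_two, mul_comm]
  rw [this]
  have hle : Submodule.span ℝ A * Submodule.span ℝ B ≤ U := by
    rw [Submodule.span_mul_span, Submodule.span_le]
    rintro _ ⟨a, ha, b, hb, rfl⟩
    exact h a ha b hb
  exact hle (Submodule.mul_mem_mul (hA _ (he _)) (hB _ (he _)))

theorem polyQ_three_le {U : Submodule ℝ (Scal 3)} {d : Fin 3 → ℕ} (k : Fin 3)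
    {A B C : Set (Scal 3)} (hA : ∀ j ≤ d k, (fun x => x k ^ j) ∈ Submodule.span ℝ A)
    (hB : ∀ j ≤ d (k + 1), (fun x => x (k + 1) ^ j) ∈ Submodule.span ℝ B)
    (hC : ∀ j ≤ d (k + 2), (fun x => x (k + 2) ^ j) ∈ Submodule.span ℝ C)
    (h : ∀ a ∈ A, ∀ b ∈ B, ∀ c ∈ C, a * b * c ∈ U) : polyQ d ≤ U := by
  rw [polyQ, Submodule.span_le]
  rintro _ ⟨e, he, rfl⟩
  have : monoFun e = (fun x => x k ^ e k) * (fun x => x (k + 1) ^ e (k + 1)) *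
      fun x => x (k + 2) ^ e (k + 2) := by
    funext x
    fin_cases k <;> simp [monoFun, Fin.prod_univ_three] <;> ring
  rw [this]
  have hle : Submodule.span ℝ A * Submodule.span ℝ B * Submodule.span ℝ C ≤ U := by
    rw [Submodule.span_mul_span, Submodule.span_mul_span, Submodule.span_le]
    rintro _ ⟨_, ⟨a, ha, b, hb, rfl⟩, c, hc, rfl⟩
    exact h a ha b hb c hc
  exact hle (Submodule.mul_mem_mul (Submodule.mul_mem_mul (hA _ (he _)) (hB _ (he _)))
    (hC _ (he _)))

theorem box_subset_cube : Set.pi .univ (fun _ : Fin N => Set.Ioo (0 : ℝ) 1) ⊆ cube N :=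
  fun _ hx k => hx k trivial

theorem infinite_unit_interval : ∀ _ : Fin N, (Set.Ioo (0 : ℝ) 1).Infinite :=
  fun _ => Set.Ioo_infinite one_pos

end Line

/-! ### Segment -/

theorem polyP_one_eq_polyQ (n : ℕ) : polyP 1 n = polyQ fun _ => n := by simp [polyP, polyQ]

theorem Icc_two_mono {p p' : ℕ} (h : p ≤ p') {i : ℕ} (hi : i ∈ Icc 2 p) : i ∈ Icc 2 p' :=
  Icc_subset_Icc_right h hi

theorem mem_lineH1_of_mem_Icc {N : ℕ} {k : Fin N} {p : ℕ} (i : Icc 2 p) :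
    phiE i.1 (mu k) ∈ lineH1 k p :=
  Or.inr ⟨i.1, (mem_Icc.mp i.2).1, (mem_Icc.mp i.2).2, rfl⟩

theorem mem_lineH1_mu {N : ℕ} {k : Fin N} {p : ℕ} (c : Fin 2) : mu k c ∈ lineH1 k p :=
  Or.inl ⟨c, rfl⟩

theorem mem_lineL2 {N : ℕ} {k : Fin N} {p : ℕ} (i : Fin p) :
    hom (legendreP i.1) (mu k 0) (mu k 1) ∈ lineL2 k p := ⟨i.1, i.2, rfl⟩

theorem span_segH1 {p : ℕ} (hp : 1 ≤ p) :
    Submodule.span ℝ (Set.range (segH1 p)) = polyP 1 p := by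
  rw [polyP_one_eq_polyQ]
  apply le_antisymm
  · rw [Submodule.span_le]
    have hd : (fun _ => p : Fin 1 → ℕ) = Pi.single 0 p := by
      funext k
      fin_cases k
      rfl
    rw [hd]
    rintro _ ⟨a | i, rfl⟩
    · exact lineH1_mem_polyQ hp (mem_lineH1_mu a)
    · exact lineH1_mem_polyQ hp (mem_lineH1_of_mem_Icc i)
  · refine polyQ_one_le (fun j hj => coord_pow_mem_span_lineH1 hp hj) ?_
    rintro _ (⟨c, rfl⟩ | ⟨i, hi, hip, rfl⟩)
    · exact Submodule.subset_span ⟨.inl c, rfl⟩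
    · exact Submodule.subset_span ⟨.inr ⟨i, mem_Icc.mpr ⟨hi, hip⟩⟩, rfl⟩

theorem segL2_apply {p : ℕ} (i : Fin p) : segL2 p i = hom (legendreP i.1) (mu 0 0) (mu 0 1) := by
  have : (fun x => grad (mu (0 : Fin 1) 1) x 0) = 1 := by
    rw [grad_mu_one]
    funext x
    simp [unitVec]
  rw [segL2, this, mul_one]

theorem span_segL2 {p : ℕ} (hp : 1 ≤ p) :
    Submodule.span ℝ (Set.range (segL2 p)) = polyP 1 (p - 1) := by
  rw [polyP_one_eq_polyQ]
  apply le_antisymm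
  · rw [Submodule.span_le]
    have hd : (fun _ => p - 1 : Fin 1 → ℕ) = Pi.single 0 (p - 1) := by
      funext k
      fin_cases k
      rfl
    rw [hd]
    rintro _ ⟨i, rfl⟩
    rw [segL2_apply]
    exact lineL2_mem_polyQ (mem_lineL2 i)
  · refine polyQ_one_le (fun j hj => coord_pow_mem_span_lineL2 (p := p) (by omega)) ?_
    rintro _ ⟨i, hi, rfl⟩
    exact Submodule.subset_span ⟨⟨i, hi⟩, segL2_apply _⟩

theorem segH1_isHierarchicalBasis :
    IsHierarchicalBasis (cube 1) segH1 (fun p => polyP 1 p) (fun p => p + 1) := by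
  refine .of_span (fun p hp => span_segH1 hp) (fun p _ F hF h => ?_) (fun p hp => ?_)
    (fun p _ => (finrank_polyP_one p).ge) (fun p p' _ hpp' => ?_)
  · exact eq_zero_of_mem_polyAll (polyP_le_polyAll _ _ hF) infinite_unit_interval
      fun x hx => h x (box_subset_cube hx)
  · simp [Nat.card_eq_fintype_card]
    omega
  · rintro _ ⟨a | i, rfl⟩
    · exact ⟨.inl a, rfl⟩
    · exact ⟨.inr ⟨i.1, Icc_two_mono hpp' i.2⟩, rfl⟩

theorem segL2_isHierarchicalBasis :
    IsHierarchicalBasis (cube 1) segL2 (fun p => polyP 1 (p - 1)) (fun p => p) := by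
  refine .of_span (fun p hp => span_segL2 hp) (fun p _ F hF h => ?_) (fun p hp => ?_)
    (fun p hp => ?_) (fun p p' _ hpp' => ?_)
  · exact eq_zero_of_mem_polyAll (polyP_le_polyAll _ _ hF) infinite_unit_interval
      fun x hx => h x (box_subset_cube hx)
  · simp
  · rw [finrank_polyP_one]
    omega
  · rintro _ ⟨i, rfl⟩
    exact ⟨⟨i.1, i.2.trans_le hpp'⟩, rfl⟩

/-! ### Quadrilateral -/

theorem exists_eq_add_one {n : ℕ} {P : Fin n → ℕ} (hP : 1 ≤ P) : ∃ m : Fin n → ℕ, P = m + 1 :=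
  ⟨P - 1, (tsub_add_cancel_of_le hP).symm⟩

theorem span_quadH1 {P : Fin 2 → ℕ} (hP : 1 ≤ P) :
    Submodule.span ℝ (Set.range (quadH1 P)) = polyQ P := by
  apply le_antisymm
  · rw [Submodule.span_le]
    have key : ∀ a b : Fin 2, a ≠ b → ∀ f ∈ lineH1 a (P a), ∀ g ∈ lineH1 b (P b),
        f * g ∈ polyQ P := by
      intro a b hab f hf g hg
      refine mul_mem_polyQ ?_ (lineH1_mem_polyQ (hP a) hf) (lineH1_mem_polyQ (hP b) hg)
      intro k
      fin_cases a <;> fin_cases b <;> fin_cases k <;> simp_all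
    rintro _ ⟨⟨a, b⟩ | ⟨a, c, i⟩ | ⟨i, j⟩, rfl⟩
    · exact key 0 1 (by decide) _ (mem_lineH1_mu a) _ (mem_lineH1_mu b)
    · exact key (a + 1) a ((by decide : ∀ a : Fin 2, a + 1 ≠ a) a) _ (mem_lineH1_mu c) _ (mem_lineH1_of_mem_Icc i)
    · exact key 0 1 (by decide) _ (mem_lineH1_of_mem_Icc i) _ (mem_lineH1_of_mem_Icc j)
  · refine polyQ_two_le 0 (fun j hj => coord_pow_mem_span_lineH1 (hP 0) hj)
      (fun j hj => coord_pow_mem_span_lineH1 (hP 1) hj) ?_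
    rintro _ (⟨c, rfl⟩ | ⟨i, hi, hip, rfl⟩) _ (⟨d, rfl⟩ | ⟨j, hj, hjp, rfl⟩) <;>
      apply Submodule.subset_span
    · exact ⟨.inl (c, d), rfl⟩
    · exact ⟨.inr (.inl ⟨1, c, j, mem_Icc.mpr ⟨hj, hjp⟩⟩), rfl⟩
    · exact ⟨.inr (.inl ⟨0, d, i, mem_Icc.mpr ⟨hi, hip⟩⟩), mul_comm _ _⟩
    · exact ⟨.inr (.inr (⟨i, mem_Icc.mpr ⟨hi, hip⟩⟩, ⟨j, mem_Icc.mpr ⟨hj, hjp⟩⟩)), rfl⟩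

theorem quadH1_isHierarchicalBasis :
    IsHierarchicalBasis (cube 2) quadH1 (fun P => polyQ P) (fun P => (P 0 + 1) * (P 1 + 1)) := by
  refine .of_span (fun P hP => span_quadH1 hP) (fun P _ F hF h => ?_) (fun P hP => ?_)
    (fun P _ => ?_) (fun P P' _ hPP' => ?_)
  · exact eq_zero_of_mem_polyAll (polyQ_le_polyAll _ hF) infinite_unit_interval
      fun x hx => h x (box_subset_cube hx)
  · obtain ⟨m, rfl⟩ := exists_eq_add_one hP
    simp [Nat.card_eq_fintype_card, Fin.sum_univ_two]
    ring
  · rw [finrank_polyQ, Fin.prod_univ_two]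
  · rintro _ ⟨⟨a, b⟩ | ⟨a, c, i⟩ | ⟨i, j⟩, rfl⟩
    · exact ⟨.inl (a, b), rfl⟩
    · exact ⟨.inr (.inl ⟨a, c, i.1, Icc_two_mono (hPP' a) i.2⟩), rfl⟩
    · exact ⟨.inr (.inr (⟨i.1, Icc_two_mono (hPP' 0) i.2⟩, ⟨j.1, Icc_two_mono (hPP' 1) j.2⟩)), rfl⟩

theorem quadCurl_inl (P : Fin 2 → ℕ) (a c : Fin 2) (i : Fin (P a)) :
    quadCurl P (.inl ⟨a, c, i⟩)
      = mulVec (mu (a + 1) c * hom (legendreP i.1) (mu a 0) (mu a 1)) (unitVec a) := by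
  rw [← mulVec_mulVec, ← fieldE_mu]
  rfl

theorem quadCurl_inr (P : Fin 2 → ℕ) (a : Fin 2) (i : Fin (P a)) (j : Icc 2 (P (a + 1))) :
    quadCurl P (.inr ⟨a, i, j⟩)
      = mulVec (phiE j.1 (mu (a + 1)) * hom (legendreP i.1) (mu a 0) (mu a 1)) (unitVec a) := by
  rw [← mulVec_mulVec, ← fieldE_mu]
  rfl

/-- Component a consists of the products of an L² function in direction a and an H¹ function in the
other direction; the two families correspond to the linear and the bubble part of the latter. -/
theorem span_quadCurl {P : Fin 2 → ℕ} (hP : 1 ≤ P) :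
    Submodule.span ℝ (Set.range (quadCurl P))
      = compSpace ![polyQ ![P 0 - 1, P 1], polyQ ![P 0, P 1 - 1]] := by
  apply le_antisymm
  · rw [Submodule.span_le]
    have key : ∀ a : Fin 2, ∀ f ∈ lineH1 (a + 1) (P (a + 1)), ∀ g ∈ lineL2 a (P a),
        mulVec (f * g) (unitVec a) ∈
          compSpace ![polyQ ![P 0 - 1, P 1], polyQ ![P 0, P 1 - 1]] := by
      intro a f hf g hg
      have h := mul_mem_polyQ le_rfl (lineH1_mem_polyQ (hP _) hf) (lineL2_mem_polyQ hg)
      refine mulVec_unitVec_mem_compSpace ?_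
      fin_cases a
      · refine polyQ_mono ?_ h
        intro k
        fin_cases k <;> simp
      · refine polyQ_mono ?_ h
        intro k
        fin_cases k <;> simp
    rintro _ ⟨⟨a, c, i⟩ | ⟨a, i, j⟩, rfl⟩
    · rw [quadCurl_inl]
      exact key a _ (mem_lineH1_mu c) _ (mem_lineL2 i)
    · rw [quadCurl_inr]
      exact key a _ (mem_lineH1_of_mem_Icc j) _ (mem_lineL2 i)
  · have key : ∀ a : Fin 2, ∀ g ∈ lineL2 a (P a), ∀ f ∈ lineH1 (a + 1) (P (a + 1)),
        g * f ∈ mulVecComap (Submodule.span ℝ (Set.range (quadCurl P))) (unitVec a) := by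
      rintro a _ ⟨i, hi, rfl⟩ _ (⟨c, rfl⟩ | ⟨j, hj, hjp, rfl⟩) <;>
        refine Submodule.subset_span ?_ <;> rw [mul_comm]
      · exact ⟨.inl ⟨a, c, i, hi⟩, quadCurl_inl P a c ⟨i, hi⟩⟩
      · exact ⟨.inr ⟨a, ⟨i, hi⟩, j, mem_Icc.mpr ⟨hj, hjp⟩⟩, quadCurl_inr P a ⟨i, hi⟩ _⟩
    refine compSpace_le fun a => ?_
    have h0 : 1 ≤ P 0 := hP 0
    have h1 : 1 ≤ P 1 := hP 1
    fin_cases a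
    · exact polyQ_two_le (U := mulVecComap _ _) (d := ![P 0 - 1, P 1]) 0
        (fun j (hj : j ≤ P 0 - 1) => coord_pow_mem_span_lineL2 (p := P 0) (by omega))
        (fun j hj => coord_pow_mem_span_lineH1 (hP 1) hj) (key 0)
    · exact polyQ_two_le (U := mulVecComap _ _) (d := ![P 0, P 1 - 1]) 1
        (fun j (hj : j ≤ P 1 - 1) => coord_pow_mem_span_lineL2 (p := P 1) (by omega))
        (fun j hj => coord_pow_mem_span_lineH1 (hP 0) hj) (key 1)

theorem quadCurl_range_mono {P P' : Fin 2 → ℕ} (h : P ≤ P') :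
    Set.range (quadCurl P) ⊆ Set.range (quadCurl P') := by
  rintro _ ⟨⟨a, c, i⟩ | ⟨a, i, j⟩, rfl⟩
  · exact ⟨.inl ⟨a, c, i.1, i.2.trans_le (h a)⟩, rfl⟩
  · exact ⟨.inr ⟨a, ⟨i.1, i.2.trans_le (h a)⟩, j.1, Icc_two_mono (h _) j.2⟩, rfl⟩

theorem card_quadCurlIdx {P : Fin 2 → ℕ} (hP : 1 ≤ P) :
    Nat.card (QuadCurlIdx P) = P 0 * (P 1 + 1) + (P 0 + 1) * P 1 := by
  obtain ⟨m, rfl⟩ := exists_eq_add_one hP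
  simp [Nat.card_eq_fintype_card, Fin.sum_univ_two]
  ring

theorem compSpace_polyQ_le_polyAll {N : ℕ} {S : Fin N → Submodule ℝ (Scal N)}
    (h : ∀ k, ∃ d, S k = polyQ d) : compSpace S ≤ compSpace fun _ => polyAll N :=
  compSpace_mono fun k => by
    obtain ⟨d, hd⟩ := h k
    rw [hd]
    exact polyQ_le_polyAll d

theorem finrank_compSpace_polyQ_two (d₀ d₁ : Fin 2 → ℕ) :
    Module.finrank ℝ (compSpace ![polyQ d₀, polyQ d₁])
      = (d₀ 0 + 1) * (d₀ 1 + 1) + (d₁ 0 + 1) * (d₁ 1 + 1) := by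
  have : ∀ k, FiniteDimensional ℝ ((![polyQ d₀, polyQ d₁] : Fin 2 → Submodule ℝ (Scal 2)) k) := by
    intro k
    fin_cases k
    · exact finiteDimensional_polyQ d₀
    · exact finiteDimensional_polyQ d₁
  rw [finrank_compSpace, Fin.sum_univ_two]
  change Module.finrank ℝ (polyQ d₀) + Module.finrank ℝ (polyQ d₁) = _
  rw [finrank_polyQ, finrank_polyQ, Fin.prod_univ_two, Fin.prod_univ_two]

theorem quadCurl_isHierarchicalBasis :
    IsHierarchicalBasis (cube 2) quadCurl
      (fun P => compSpace ![polyQ ![P 0 - 1, P 1], polyQ ![P 0, P 1 - 1]])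
      (fun P => P 0 * (P 1 + 1) + (P 0 + 1) * P 1) := by
  refine .of_span (fun P hP => span_quadCurl hP) (fun P _ F hF h => ?_)
    (fun P hP => card_quadCurlIdx hP) (fun P hP => ?_) (fun P P' _ h => quadCurl_range_mono h)
  · refine eq_zero_of_mem_compSpace_polyAll (compSpace_polyQ_le_polyAll (fun k => ?_) hF)
      infinite_unit_interval fun x hx => h x (box_subset_cube hx)
    fin_cases k
    exacts [⟨_, rfl⟩, ⟨_, rfl⟩]
  · obtain ⟨m, rfl⟩ := exists_eq_add_one hP
    rw [finrank_compSpace_polyQ_two]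
    simp

/-- The rotation as a linear equivalence. -/
def rotEquiv : Vec 2 ≃ₗ[ℝ] Vec 2 where
  toFun := rot
  invFun F := fun x => ![-F x 1, F x 0]
  map_add' F G := by
    funext x i
    fin_cases i <;> simp [rot, add_comm]
  map_smul' c F := by
    funext x i
    fin_cases i <;> simp [rot]
  left_inv F := by
    funext x i
    fin_cases i <;> simp [rot]
  right_inv F := by
    funext x i
    fin_cases i <;> simp [rot]

theorem IsHierarchicalBasis.rot {O : Type} [Preorder O] [One O] {ι : O → Type} [∀ P, Finite (ι P)]
    {K : Set (Fin 2 → ℝ)} {f : (P : O) → ι P → Vec 2} {S : O → Submodule ℝ (Vec 2)}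
    {dim : O → ℕ} (h : IsHierarchicalBasis K f S dim) {S' : O → Submodule ℝ (Vec 2)}
    {dim' : O → ℕ} (hS : ∀ P, 1 ≤ P → (S P).map rotEquiv.toLinearMap = S' P)
    (hK : ∀ P, 1 ≤ P → ∀ F ∈ S' P, (∀ x ∈ K, F x = 0) → F = 0) (hdim : ∀ P, dim P = dim' P) :
    IsHierarchicalBasis K (fun P i => ShapeFunctions.rot (f P i)) S' dim' := by
  refine .of_span (fun P hP => ?_) hK (fun P hP => (h.count P hP).trans (hdim P)) (fun P hP => ?_)
    (fun P P' hP hPP' => ?_)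
  · rw [← hS P hP, ← h.span_eq P hP, Submodule.map_span, ← Set.range_comp]
    rfl
  · rw [← hS P hP, ← hdim P, ← h.finrank_eq P hP, LinearEquiv.finrank_map_eq]
  · rintro _ ⟨i, rfl⟩
    obtain ⟨j, hj⟩ := h.hierarchical P P' hP hPP' ⟨i, rfl⟩
    exact ⟨j, congrArg ShapeFunctions.rot hj⟩

theorem map_rotEquiv_compSpace (S₀ S₁ : Submodule ℝ (Scal 2)) :
    (compSpace ![S₀, S₁]).map rotEquiv.toLinearMap = compSpace ![S₁, S₀] := by
  ext F
  constructor
  · rintro ⟨G, hG, rfl⟩ k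
    fin_cases k
    · exact hG 1
    · exact S₀.neg_mem (hG 0)
  · intro hF
    refine ⟨rotEquiv.symm F, fun k => ?_, rotEquiv.apply_symm_apply F⟩
    fin_cases k
    · exact S₀.neg_mem (hF 1)
    · exact hF 0

theorem quadDiv_isHierarchicalBasis :
    IsHierarchicalBasis (cube 2) quadDiv
      (fun P => compSpace ![polyQ ![P 0, P 1 - 1], polyQ ![P 0 - 1, P 1]])
      (fun P => (P 0 + 1) * P 1 + P 0 * (P 1 + 1)) := by
  refine quadCurl_isHierarchicalBasis.rot (fun P _ => map_rotEquiv_compSpace _ _)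
    (fun P _ F hF h => ?_) (fun P => add_comm _ _)
  refine eq_zero_of_mem_compSpace_polyAll (compSpace_polyQ_le_polyAll (fun k => ?_) hF)
    infinite_unit_interval fun x hx => h x (box_subset_cube hx)
  fin_cases k
  exacts [⟨_, rfl⟩, ⟨_, rfl⟩]

theorem quadL2_apply {P : Fin 2 → ℕ} (i : Fin (P 0)) (j : Fin (P 1)) :
    quadL2 P (i, j) = hom (legendreP i.1) (mu 0 0) (mu 0 1) * hom (legendreP j.1) (mu 1 0) (mu 1 1)
      := by
  have : cross2 (grad (mu (0 : Fin 2) 1)) (grad (mu 1 1)) = 1 := by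
    rw [grad_mu_one, grad_mu_one]
    funext x
    simp [cross2, unitVec]
  rw [quadL2, this, mul_one]

theorem span_quadL2 {P : Fin 2 → ℕ} (hP : 1 ≤ P) :
    Submodule.span ℝ (Set.range (quadL2 P)) = polyQ ![P 0 - 1, P 1 - 1] := by
  apply le_antisymm
  · rw [Submodule.span_le]
    rintro _ ⟨⟨i, j⟩, rfl⟩
    rw [quadL2_apply]
    refine mul_mem_polyQ ?_ (lineL2_mem_polyQ (mem_lineL2 i)) (lineL2_mem_polyQ (mem_lineL2 j))
    intro k
    fin_cases k <;> simp
  · have h0 : 1 ≤ P 0 := hP 0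
    have h1 : 1 ≤ P 1 := hP 1
    refine polyQ_two_le 0
      (fun j (hj : j ≤ P 0 - 1) => coord_pow_mem_span_lineL2 (p := P 0) (by omega))
      (fun j (hj : j ≤ P 1 - 1) => coord_pow_mem_span_lineL2 (p := P 1) (by omega)) ?_
    rintro _ ⟨i, hi, rfl⟩ _ ⟨j, hj, rfl⟩
    exact Submodule.subset_span ⟨(⟨i, hi⟩, ⟨j, hj⟩), quadL2_apply _ _⟩

theorem quadL2_isHierarchicalBasis :
    IsHierarchicalBasis (cube 2) quadL2 (fun P => polyQ ![P 0 - 1, P 1 - 1])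
      (fun P => P 0 * P 1) := by
  refine .of_span (fun P hP => span_quadL2 hP) (fun P _ F hF h => ?_) (fun P hP => ?_)
    (fun P hP => ?_) (fun P P' _ hPP' => ?_)
  · exact eq_zero_of_mem_polyAll (polyQ_le_polyAll _ hF) infinite_unit_interval
      fun x hx => h x (box_subset_cube hx)
  · simp
  · obtain ⟨m, rfl⟩ := exists_eq_add_one hP
    rw [finrank_polyQ, Fin.prod_univ_two]
    simp
  · rintro _ ⟨⟨i, j⟩, rfl⟩
    exact ⟨(⟨i.1, i.2.trans_le (hPP' 0)⟩, ⟨j.1, j.2.trans_le (hPP' 1)⟩), rfl⟩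

/-! ### Hexahedron -/

/-- The family is the set of all products of three one-dimensional H¹ functions; the number of
bubbles among the factors sorts them into vertex, edge, face and interior functions. -/
theorem span_hexH1 {P : Fin 3 → ℕ} (hP : 1 ≤ P) :
    Submodule.span ℝ (Set.range (hexH1 P)) = polyQ P := by
  apply le_antisymm
  · rw [Submodule.span_le]
    have key : ∀ a : Fin 3, ∀ f ∈ lineH1 a (P a), ∀ g ∈ lineH1 (a + 1) (P (a + 1)),
        ∀ h ∈ lineH1 (a + 2) (P (a + 2)), f * g * h ∈ polyQ P := by
      intro a f hf g hg h hh
      refine mul_mem_polyQ ?_ (mul_mem_polyQ le_rfl (lineH1_mem_polyQ (hP _) hf)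
        (lineH1_mem_polyQ (hP _) hg)) (lineH1_mem_polyQ (hP _) hh)
      intro k
      fin_cases a <;> fin_cases k <;> simp
    rintro _ ⟨⟨a, b, c⟩ | ⟨a, d, e, i⟩ | ⟨a, d, i, j⟩ | ⟨i, j, k⟩, rfl⟩
    · exact key 0 _ (mem_lineH1_mu a) _ (mem_lineH1_mu b) _ (mem_lineH1_mu c)
    · have h := key a _ (mem_lineH1_of_mem_Icc i) _ (mem_lineH1_mu d) _ (mem_lineH1_mu e)
      rwa [mul_assoc, mul_comm, mul_comm (mu (a + 1) d)] at h
    · have h := key a _ (mem_lineH1_of_mem_Icc i) _ (mem_lineH1_of_mem_Icc j) _ (mem_lineH1_mu d)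
      rwa [mul_comm] at h
    · exact key 0 _ (mem_lineH1_of_mem_Icc i) _ (mem_lineH1_of_mem_Icc j) _
        (mem_lineH1_of_mem_Icc k)
  · refine polyQ_three_le 0 (fun j hj => coord_pow_mem_span_lineH1 (hP 0) hj)
      (fun j hj => coord_pow_mem_span_lineH1 (hP 1) hj)
      (fun j hj => coord_pow_mem_span_lineH1 (hP 2) hj) ?_
    have e1 : ∀ (a : Fin 3) (d e : Fin 2) (i : Icc 2 (P a)),
        hexH1 P (.inr (.inl ⟨a, d, e, i⟩)) = mu (a + 2) e * mu (a + 1) d * phiE i.1 (mu a) :=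
      fun _ _ _ _ => rfl
    have e2 : ∀ (a : Fin 3) (d : Fin 2) (i : Icc 2 (P a)) (j : Icc 2 (P (a + 1))),
        hexH1 P (.inr (.inr (.inl ⟨a, d, i, j⟩)))
          = mu (a + 2) d * (phiE i.1 (mu a) * phiE j.1 (mu (a + 1))) :=
      fun _ _ _ _ => rfl
    rintro _ (⟨c, rfl⟩ | ⟨i, hi, hip, rfl⟩) _ (⟨d, rfl⟩ | ⟨j, hj, hjp, rfl⟩) _
      (⟨e, rfl⟩ | ⟨k, hk, hkp, rfl⟩) <;> apply Submodule.subset_span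
    · exact ⟨.inl (c, d, e), rfl⟩
    · refine ⟨.inr (.inl ⟨2, c, d, k, mem_Icc.mpr ⟨hk, hkp⟩⟩), ?_⟩
      exact (e1 _ _ _ _).trans (by rw [mul_comm (mu (2 + 2) d)]; rfl)
    · refine ⟨.inr (.inl ⟨1, e, c, j, mem_Icc.mpr ⟨hj, hjp⟩⟩), ?_⟩
      exact (e1 _ _ _ _).trans (mul_right_comm _ _ _)
    · refine ⟨.inr (.inr (.inl ⟨1, c, ⟨j, mem_Icc.mpr ⟨hj, hjp⟩⟩, k, mem_Icc.mpr ⟨hk, hkp⟩⟩)), ?_⟩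
      exact (e2 _ _ _ _).trans (mul_assoc _ _ _).symm
    · refine ⟨.inr (.inl ⟨0, d, e, i, mem_Icc.mpr ⟨hi, hip⟩⟩), ?_⟩
      refine (e1 _ _ _ _).trans ?_
      change mu 2 e * mu 1 d * _ = phiE i (mu 0) * mu 1 d * mu 2 e
      ring
    · refine ⟨.inr (.inr (.inl ⟨2, d, ⟨k, mem_Icc.mpr ⟨hk, hkp⟩⟩, i, mem_Icc.mpr ⟨hi, hip⟩⟩)), ?_⟩
      refine (e2 _ _ _ _).trans ?_
      change mu 1 d * (phiE k (mu 2) * phiE i (mu 0)) = phiE i (mu 0) * mu 1 d * phiE k (mu 2)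
      ring
    · refine ⟨.inr (.inr (.inl ⟨0, e, ⟨i, mem_Icc.mpr ⟨hi, hip⟩⟩, j, mem_Icc.mpr ⟨hj, hjp⟩⟩)), ?_⟩
      exact (e2 _ _ _ _).trans (mul_comm _ _)
    · exact ⟨.inr (.inr (.inr (⟨i, mem_Icc.mpr ⟨hi, hip⟩⟩, ⟨j, mem_Icc.mpr ⟨hj, hjp⟩⟩,
        ⟨k, mem_Icc.mpr ⟨hk, hkp⟩⟩))), rfl⟩

theorem hexH1_isHierarchicalBasis :
    IsHierarchicalBasis (cube 3) hexH1 (fun P => polyQ P)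
      (fun P => (P 0 + 1) * (P 1 + 1) * (P 2 + 1)) := by
  refine .of_span (fun P hP => span_hexH1 hP) (fun P _ F hF h => ?_) (fun P hP => ?_)
    (fun P _ => ?_) (fun P P' _ h => ?_)
  · exact eq_zero_of_mem_polyAll (polyQ_le_polyAll _ hF) infinite_unit_interval
      fun x hx => h x (box_subset_cube hx)
  · obtain ⟨m, rfl⟩ := exists_eq_add_one hP
    simp [Nat.card_eq_fintype_card, Fin.sum_univ_three]
    ring
  · rw [finrank_polyQ, Fin.prod_univ_three]
  · rintro _ ⟨⟨a, b, c⟩ | ⟨a, d, e, i⟩ | ⟨a, d, i, j⟩ | ⟨i, j, k⟩, rfl⟩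
    · exact ⟨.inl (a, b, c), rfl⟩
    · exact ⟨.inr (.inl ⟨a, d, e, i.1, Icc_two_mono (h _) i.2⟩), rfl⟩
    · exact ⟨.inr (.inr (.inl ⟨a, d, ⟨i.1, Icc_two_mono (h _) i.2⟩, j.1,
        Icc_two_mono (h _) j.2⟩)), rfl⟩
    · exact ⟨.inr (.inr (.inr (⟨i.1, Icc_two_mono (h _) i.2⟩, ⟨j.1, Icc_two_mono (h _) j.2⟩,
        ⟨k.1, Icc_two_mono (h _) k.2⟩))), rfl⟩

theorem finrank_compSpace_polyQ_three (d₀ d₁ d₂ : Fin 3 → ℕ) :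
    Module.finrank ℝ (compSpace ![polyQ d₀, polyQ d₁, polyQ d₂])
      = (d₀ 0 + 1) * (d₀ 1 + 1) * (d₀ 2 + 1) + (d₁ 0 + 1) * (d₁ 1 + 1) * (d₁ 2 + 1)
        + (d₂ 0 + 1) * (d₂ 1 + 1) * (d₂ 2 + 1) := by
  have : ∀ k, FiniteDimensional ℝ
      ((![polyQ d₀, polyQ d₁, polyQ d₂] : Fin 3 → Submodule ℝ (Scal 3)) k) := by
    intro k
    fin_cases k
    · exact finiteDimensional_polyQ d₀
    · exact finiteDimensional_polyQ d₁
    · exact finiteDimensional_polyQ d₂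
  rw [finrank_compSpace, Fin.sum_univ_three]
  change Module.finrank ℝ (polyQ d₀) + Module.finrank ℝ (polyQ d₁)
    + Module.finrank ℝ (polyQ d₂) = _
  simp only [finrank_polyQ, Fin.prod_univ_three]

theorem span_hexCurl {P : Fin 3 → ℕ} (hP : 1 ≤ P) :
    Submodule.span ℝ (Set.range (hexCurl P)) = compSpace ![polyQ ![P 0 - 1, P 1, P 2],
      polyQ ![P 0, P 1 - 1, P 2], polyQ ![P 0, P 1, P 2 - 1]] := by
  have e1 : ∀ (a : Fin 3) (d e : Fin 2) (i : Fin (P a)), hexCurl P (.inl ⟨a, d, e, i⟩)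
      = mulVec (hom (legendreP i.1) (mu a 0) (mu a 1) * mu (a + 1) d * mu (a + 2) e)
        (unitVec a) := by
    intro a d e i
    simp only [hexCurl, fieldE_mu, mulVec_mulVec]
    congr 1
    ring
  have e2 : ∀ (a : Fin 3) (d : Fin 2) (i : Fin (P a)) (j : Icc 2 (P (a + 1))),
      hexCurl P (.inr (.inl ⟨a, d, i, j⟩)) = mulVec (hom (legendreP i.1) (mu a 0) (mu a 1)
        * phiE j.1 (mu (a + 1)) * mu (a + 2) d) (unitVec a) := by
    intro a d i j
    simp only [hexCurl, fieldQ, fieldE_mu, mulVec_mulVec]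
    congr 1
    ring
  -- This family points in direction a + 1. Read cyclically from there, the linear factor comes
  -- second and the bubble third, since a + 1 + 2 = a.
  have e3 : ∀ (a : Fin 3) (d : Fin 2) (i : Fin (P (a + 1))) (j : Icc 2 (P a)),
      hexCurl P (.inr (.inr (.inl ⟨a, d, i, j⟩))) = mulVec (hom (legendreP i.1) (mu (a + 1) 0)
        (mu (a + 1) 1) * mu (a + 2) d * phiE j.1 (mu a)) (unitVec (a + 1)) := by
    intro a d i j
    simp only [hexCurl, fieldQ, fieldE_mu, mulVec_mulVec]
    congr 1
    ring
  have e4 : ∀ (a : Fin 3) (i : Fin (P a)) (j : Icc 2 (P (a + 1))) (k : Icc 2 (P (a + 2))),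
      hexCurl P (.inr (.inr (.inr ⟨a, i, j, k⟩))) = mulVec (hom (legendreP i.1) (mu a 0) (mu a 1)
        * phiE j.1 (mu (a + 1)) * phiE k.1 (mu (a + 2))) (unitVec a) := by
    intro a i j k
    simp only [hexCurl, fieldQ, fieldE_mu, mulVec_mulVec]
    congr 1
    ring
  apply le_antisymm
  · rw [Submodule.span_le]
    have key : ∀ a : Fin 3, ∀ f ∈ lineL2 a (P a), ∀ g ∈ lineH1 (a + 1) (P (a + 1)),
        ∀ h ∈ lineH1 (a + 2) (P (a + 2)), mulVec (f * g * h) (unitVec a) ∈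
          compSpace ![polyQ ![P 0 - 1, P 1, P 2], polyQ ![P 0, P 1 - 1, P 2],
            polyQ ![P 0, P 1, P 2 - 1]] := by
      intro a f hf g hg h hh
      have h := mul_mem_polyQ le_rfl (mul_mem_polyQ le_rfl (lineL2_mem_polyQ hf)
        (lineH1_mem_polyQ (hP _) hg)) (lineH1_mem_polyQ (hP _) hh)
      refine mulVec_unitVec_mem_compSpace ?_
      fin_cases a <;>
      · refine polyQ_mono ?_ h
        intro k
        fin_cases k <;> simp
    rintro _ ⟨⟨a, d, e, i⟩ | ⟨a, d, i, j⟩ | ⟨a, d, i, j⟩ | ⟨a, i, j, k⟩, rfl⟩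
    · rw [e1]
      exact key a _ (mem_lineL2 i) _ (mem_lineH1_mu d) _ (mem_lineH1_mu e)
    · rw [e2]
      exact key a _ (mem_lineL2 i) _ (mem_lineH1_of_mem_Icc j) _ (mem_lineH1_mu d)
    · rw [e3]
      have h1 : a + 1 + 1 = a + 2 := (by decide : ∀ a : Fin 3, a + 1 + 1 = a + 2) a
      have h2 : a + 1 + 2 = a := (by decide : ∀ a : Fin 3, a + 1 + 2 = a) a
      have := key (a + 1)
      rw [h1, h2] at this
      exact this _ (mem_lineL2 i) _ (mem_lineH1_mu d) _ (mem_lineH1_of_mem_Icc j)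
    · rw [e4]
      exact key a _ (mem_lineL2 i) _ (mem_lineH1_of_mem_Icc j) _ (mem_lineH1_of_mem_Icc k)
  · have key : ∀ a : Fin 3, ∀ f ∈ lineL2 a (P a), ∀ g ∈ lineH1 (a + 1) (P (a + 1)),
        ∀ h ∈ lineH1 (a + 2) (P (a + 2)),
        f * g * h ∈ mulVecComap (Submodule.span ℝ (Set.range (hexCurl P))) (unitVec a) := by
      rintro a _ ⟨i, hi, rfl⟩ _ (⟨c, rfl⟩ | ⟨j, hj, hjp, rfl⟩) _ (⟨d, rfl⟩ | ⟨k, hk, hkp, rfl⟩) <;>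
        refine Submodule.subset_span ?_
      · exact ⟨.inl ⟨a, c, d, i, hi⟩, e1 a c d ⟨i, hi⟩⟩
      · obtain ⟨b, rfl⟩ : ∃ b : Fin 3, a = b + 1 := ⟨a + 2, (by decide : ∀ a : Fin 3, a = a + 2 + 1) a⟩
        have h1 : b + 1 + 1 = b + 2 := (by decide : ∀ a : Fin 3, a + 1 + 1 = a + 2) b
        have h2 : b + 1 + 2 = b := (by decide : ∀ a : Fin 3, a + 1 + 2 = a) b
        rw [h2] at hkp
        rw [h1, h2]
        exact ⟨.inr (.inr (.inl ⟨b, c, ⟨i, hi⟩, k, mem_Icc.mpr ⟨hk, hkp⟩⟩)),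
          e3 b c ⟨i, hi⟩ ⟨k, mem_Icc.mpr ⟨hk, hkp⟩⟩⟩
      · exact ⟨.inr (.inl ⟨a, d, ⟨i, hi⟩, j, mem_Icc.mpr ⟨hj, hjp⟩⟩), e2 a d ⟨i, hi⟩ _⟩
      · exact ⟨.inr (.inr (.inr ⟨a, ⟨i, hi⟩, ⟨j, mem_Icc.mpr ⟨hj, hjp⟩⟩,
          k, mem_Icc.mpr ⟨hk, hkp⟩⟩)), e4 a ⟨i, hi⟩ _ _⟩
    refine compSpace_le fun a => ?_
    have h0 : 1 ≤ P 0 := hP 0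
    have h1 : 1 ≤ P 1 := hP 1
    have h2 : 1 ≤ P 2 := hP 2
    fin_cases a
    · exact polyQ_three_le (U := mulVecComap _ _) (d := ![P 0 - 1, P 1, P 2]) 0
        (fun j (hj : j ≤ P 0 - 1) => coord_pow_mem_span_lineL2 (p := P 0) (by omega))
        (fun j hj => coord_pow_mem_span_lineH1 (hP 1) hj)
        (fun j hj => coord_pow_mem_span_lineH1 (hP 2) hj) (key 0)
    · exact polyQ_three_le (U := mulVecComap _ _) (d := ![P 0, P 1 - 1, P 2]) 1
        (fun j (hj : j ≤ P 1 - 1) => coord_pow_mem_span_lineL2 (p := P 1) (by omega))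
        (fun j hj => coord_pow_mem_span_lineH1 (hP 2) hj)
        (fun j hj => coord_pow_mem_span_lineH1 (hP 0) hj) (key 1)
    · exact polyQ_three_le (U := mulVecComap _ _) (d := ![P 0, P 1, P 2 - 1]) 2
        (fun j (hj : j ≤ P 2 - 1) => coord_pow_mem_span_lineL2 (p := P 2) (by omega))
        (fun j hj => coord_pow_mem_span_lineH1 (hP 0) hj)
        (fun j hj => coord_pow_mem_span_lineH1 (hP 1) hj) (key 2)

theorem hexCurl_isHierarchicalBasis :
    IsHierarchicalBasis (cube 3) hexCurl
      (fun P => compSpace ![polyQ ![P 0 - 1, P 1, P 2], polyQ ![P 0, P 1 - 1, P 2],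
        polyQ ![P 0, P 1, P 2 - 1]])
      (fun P => P 0 * (P 1 + 1) * (P 2 + 1) + (P 0 + 1) * P 1 * (P 2 + 1)
        + (P 0 + 1) * (P 1 + 1) * P 2) := by
  refine .of_span (fun P hP => span_hexCurl hP) (fun P _ F hF h => ?_) (fun P hP => ?_)
    (fun P hP => ?_) (fun P P' _ h => ?_)
  · refine eq_zero_of_mem_compSpace_polyAll (compSpace_polyQ_le_polyAll (fun k => ?_) hF)
      infinite_unit_interval fun x hx => h x (box_subset_cube hx)
    fin_cases k
    exacts [⟨_, rfl⟩, ⟨_, rfl⟩, ⟨_, rfl⟩]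
  · obtain ⟨m, rfl⟩ := exists_eq_add_one hP
    rw [Nat.card_eq_fintype_card]
    simp only [Fintype.card_sum, Fintype.card_sigma, Fintype.card_prod, Fintype.card_fin,
      Fintype.card_coe, Nat.card_Icc, Fin.sum_univ_three, Fin.isValue, Fin.reduceAdd, Pi.add_apply,
      Pi.one_apply, Nat.reduceSubDiff]
    ring
  · obtain ⟨m, rfl⟩ := exists_eq_add_one hP
    rw [finrank_compSpace_polyQ_three]
    simp
  · rintro _ ⟨⟨a, d, e, i⟩ | ⟨a, d, i, j⟩ | ⟨a, d, i, j⟩ | ⟨a, i, j, k⟩, rfl⟩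
    · exact ⟨.inl ⟨a, d, e, i.1, i.2.trans_le (h _)⟩, rfl⟩
    · exact ⟨.inr (.inl ⟨a, d, ⟨i.1, i.2.trans_le (h _)⟩, j.1, Icc_two_mono (h _) j.2⟩), rfl⟩
    · exact ⟨.inr (.inr (.inl ⟨a, d, ⟨i.1, i.2.trans_le (h _)⟩, j.1,
        Icc_two_mono (h _) j.2⟩)), rfl⟩
    · exact ⟨.inr (.inr (.inr ⟨a, ⟨i.1, i.2.trans_le (h _)⟩, ⟨j.1, Icc_two_mono (h _) j.2⟩, k.1,
        Icc_two_mono (h _) k.2⟩)), rfl⟩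

theorem cross3_mulVec (f g : Scal 3) (F G : Vec 3) :
    cross3 (mulVec f F) (mulVec g G) = mulVec (f * g) (cross3 F G) := by
  funext x
  simp [cross3, mulVec, smul_smul, mul_comm]

theorem cross3_unitVec (a : Fin 3) :
    cross3 (unitVec a) (unitVec (a + 1)) = unitVec (a + 2) := by
  funext x i
  fin_cases a <;> fin_cases i <;> simp [cross3, unitVec, crossProduct]

theorem fluxQ_mu (i j : ℕ) (a : Fin 3) : fluxQ i j (mu a) (mu (a + 1)) =
    mulVec (hom (legendreP i) (mu a 0) (mu a 1)
      * hom (legendreP j) (mu (a + 1) 0) (mu (a + 1) 1)) (unitVec (a + 2)) := by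
  rw [fluxQ, fieldE_mu, fieldE_mu, cross3_mulVec, cross3_unitVec]

theorem span_hexDiv {P : Fin 3 → ℕ} (hP : 1 ≤ P) :
    Submodule.span ℝ (Set.range (hexDiv P)) = compSpace ![polyQ ![P 0, P 1 - 1, P 2 - 1],
      polyQ ![P 0 - 1, P 1, P 2 - 1], polyQ ![P 0 - 1, P 1 - 1, P 2]] := by
  have e1 : ∀ (a : Fin 3) (d : Fin 2) (i : Fin (P a)) (j : Fin (P (a + 1))),
      hexDiv P (.inl ⟨a, d, i, j⟩) = mulVec (hom (legendreP i.1) (mu a 0) (mu a 1)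
        * hom (legendreP j.1) (mu (a + 1) 0) (mu (a + 1) 1) * mu (a + 2) d) (unitVec (a + 2)) := by
    intro a d i j
    simp only [hexDiv, fluxQ_mu, mulVec_mulVec]
    rw [mul_comm]
  have e2 : ∀ (a : Fin 3) (i : Fin (P a)) (j : Fin (P (a + 1))) (k : Icc 2 (P (a + 2))),
      hexDiv P (.inr ⟨a, i, j, k⟩) = mulVec (hom (legendreP i.1) (mu a 0) (mu a 1)
        * hom (legendreP j.1) (mu (a + 1) 0) (mu (a + 1) 1) * phiE k.1 (mu (a + 2)))
          (unitVec (a + 2)) := by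
    intro a i j k
    simp only [hexDiv, fluxQ_mu, mulVec_mulVec]
    rw [mul_comm]
  apply le_antisymm
  · rw [Submodule.span_le]
    have key : ∀ a : Fin 3, ∀ f ∈ lineL2 a (P a), ∀ g ∈ lineL2 (a + 1) (P (a + 1)),
        ∀ h ∈ lineH1 (a + 2) (P (a + 2)), mulVec (f * g * h) (unitVec (a + 2)) ∈
          compSpace ![polyQ ![P 0, P 1 - 1, P 2 - 1], polyQ ![P 0 - 1, P 1, P 2 - 1],
            polyQ ![P 0 - 1, P 1 - 1, P 2]] := by
      intro a f hf g hg h hh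
      have h := mul_mem_polyQ le_rfl (mul_mem_polyQ le_rfl (lineL2_mem_polyQ hf)
        (lineL2_mem_polyQ hg)) (lineH1_mem_polyQ (hP _) hh)
      refine mulVec_unitVec_mem_compSpace ?_
      fin_cases a <;>
      · refine polyQ_mono ?_ h
        intro k
        fin_cases k <;> simp
    rintro _ ⟨⟨a, d, i, j⟩ | ⟨a, i, j, k⟩, rfl⟩
    · rw [e1]
      exact key a _ (mem_lineL2 i) _ (mem_lineL2 j) _ (mem_lineH1_mu d)
    · rw [e2]
      exact key a _ (mem_lineL2 i) _ (mem_lineL2 j) _ (mem_lineH1_of_mem_Icc k)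
  · have key : ∀ a : Fin 3, ∀ f ∈ lineL2 a (P a), ∀ g ∈ lineL2 (a + 1) (P (a + 1)),
        ∀ h ∈ lineH1 (a + 2) (P (a + 2)),
        f * g * h ∈ mulVecComap (Submodule.span ℝ (Set.range (hexDiv P))) (unitVec (a + 2)) := by
      rintro a _ ⟨i, hi, rfl⟩ _ ⟨j, hj, rfl⟩ _ (⟨d, rfl⟩ | ⟨k, hk, hkp, rfl⟩) <;>
        refine Submodule.subset_span ?_
      · exact ⟨.inl ⟨a, d, ⟨i, hi⟩, j, hj⟩, e1 a d ⟨i, hi⟩ ⟨j, hj⟩⟩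
      · exact ⟨.inr ⟨a, ⟨i, hi⟩, ⟨j, hj⟩, k, mem_Icc.mpr ⟨hk, hkp⟩⟩, e2 a ⟨i, hi⟩ ⟨j, hj⟩ _⟩
    refine compSpace_le fun a => ?_
    have h0 : 1 ≤ P 0 := hP 0
    have h1 : 1 ≤ P 1 := hP 1
    have h2 : 1 ≤ P 2 := hP 2
    fin_cases a
    -- The flux built from directions a, a + 1 points in direction a + 2, so component 0 comes from
    -- a = 1, and the others are shifted likewise.
    · exact polyQ_three_le (U := mulVecComap _ _) (d := ![P 0, P 1 - 1, P 2 - 1]) 1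
        (fun j (hj : j ≤ P 1 - 1) => coord_pow_mem_span_lineL2 (p := P 1) (by omega))
        (fun j (hj : j ≤ P 2 - 1) => coord_pow_mem_span_lineL2 (p := P 2) (by omega))
        (fun j hj => coord_pow_mem_span_lineH1 (hP 0) hj) (key 1)
    · exact polyQ_three_le (U := mulVecComap _ _) (d := ![P 0 - 1, P 1, P 2 - 1]) 2
        (fun j (hj : j ≤ P 2 - 1) => coord_pow_mem_span_lineL2 (p := P 2) (by omega))
        (fun j (hj : j ≤ P 0 - 1) => coord_pow_mem_span_lineL2 (p := P 0) (by omega))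
        (fun j hj => coord_pow_mem_span_lineH1 (hP 1) hj) (key 2)
    · exact polyQ_three_le (U := mulVecComap _ _) (d := ![P 0 - 1, P 1 - 1, P 2]) 0
        (fun j (hj : j ≤ P 0 - 1) => coord_pow_mem_span_lineL2 (p := P 0) (by omega))
        (fun j (hj : j ≤ P 1 - 1) => coord_pow_mem_span_lineL2 (p := P 1) (by omega))
        (fun j hj => coord_pow_mem_span_lineH1 (hP 2) hj) (key 0)

theorem hexDiv_isHierarchicalBasis :
    IsHierarchicalBasis (cube 3) hexDiv
      (fun P => compSpace ![polyQ ![P 0, P 1 - 1, P 2 - 1], polyQ ![P 0 - 1, P 1, P 2 - 1],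
        polyQ ![P 0 - 1, P 1 - 1, P 2]])
      (fun P => (P 0 + 1) * P 1 * P 2 + P 0 * (P 1 + 1) * P 2 + P 0 * P 1 * (P 2 + 1)) := by
  refine .of_span (fun P hP => span_hexDiv hP) (fun P _ F hF h => ?_) (fun P hP => ?_)
    (fun P hP => ?_) (fun P P' _ h => ?_)
  · refine eq_zero_of_mem_compSpace_polyAll (compSpace_polyQ_le_polyAll (fun k => ?_) hF)
      infinite_unit_interval fun x hx => h x (box_subset_cube hx)
    fin_cases k
    exacts [⟨_, rfl⟩, ⟨_, rfl⟩, ⟨_, rfl⟩]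
  · obtain ⟨m, rfl⟩ := exists_eq_add_one hP
    simp [Nat.card_eq_fintype_card, Fin.sum_univ_three]
    ring
  · obtain ⟨m, rfl⟩ := exists_eq_add_one hP
    rw [finrank_compSpace_polyQ_three]
    simp
  · rintro _ ⟨⟨a, d, i, j⟩ | ⟨a, i, j, k⟩, rfl⟩
    · exact ⟨.inl ⟨a, d, ⟨i.1, i.2.trans_le (h _)⟩, j.1, j.2.trans_le (h _)⟩, rfl⟩
    · exact ⟨.inr ⟨a, ⟨i.1, i.2.trans_le (h _)⟩, ⟨j.1, j.2.trans_le (h _)⟩, k.1,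
        Icc_two_mono (h _) k.2⟩, rfl⟩

theorem hexL2_apply {P : Fin 3 → ℕ} (i : Fin (P 0)) (j : Fin (P 1)) (k : Fin (P 2)) :
    hexL2 P (i, j, k) = hom (legendreP i.1) (mu 0 0) (mu 0 1)
      * hom (legendreP j.1) (mu 1 0) (mu 1 1) * hom (legendreP k.1) (mu 2 0) (mu 2 1) := by
  have : dotF (cross3 (grad (mu (0 : Fin 3) 1)) (grad (mu 1 1))) (grad (mu 2 1)) = 1 := by
    rw [grad_mu_one, grad_mu_one, grad_mu_one]
    have : cross3 (unitVec 0) (unitVec 1) = unitVec 2 := cross3_unitVec 0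
    rw [this]
    funext x
    simp [dotF, unitVec]
  rw [hexL2, this, mul_one]

theorem span_hexL2 {P : Fin 3 → ℕ} (hP : 1 ≤ P) :
    Submodule.span ℝ (Set.range (hexL2 P)) = polyQ ![P 0 - 1, P 1 - 1, P 2 - 1] := by
  apply le_antisymm
  · rw [Submodule.span_le]
    rintro _ ⟨⟨i, j, k⟩, rfl⟩
    rw [hexL2_apply]
    refine mul_mem_polyQ ?_ (mul_mem_polyQ le_rfl (lineL2_mem_polyQ (mem_lineL2 i))
      (lineL2_mem_polyQ (mem_lineL2 j))) (lineL2_mem_polyQ (mem_lineL2 k))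
    intro k
    fin_cases k <;> simp
  · have h0 : 1 ≤ P 0 := hP 0
    have h1 : 1 ≤ P 1 := hP 1
    have h2 : 1 ≤ P 2 := hP 2
    refine polyQ_three_le 0
      (fun j (hj : j ≤ P 0 - 1) => coord_pow_mem_span_lineL2 (p := P 0) (by omega))
      (fun j (hj : j ≤ P 1 - 1) => coord_pow_mem_span_lineL2 (p := P 1) (by omega))
      (fun j (hj : j ≤ P 2 - 1) => coord_pow_mem_span_lineL2 (p := P 2) (by omega)) ?_
    rintro _ ⟨i, hi, rfl⟩ _ ⟨j, hj, rfl⟩ _ ⟨k, hk, rfl⟩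
    exact Submodule.subset_span ⟨(⟨i, hi⟩, ⟨j, hj⟩, ⟨k, hk⟩), hexL2_apply _ _ _⟩

theorem hexL2_isHierarchicalBasis :
    IsHierarchicalBasis (cube 3) hexL2 (fun P => polyQ ![P 0 - 1, P 1 - 1, P 2 - 1])
      (fun P => P 0 * P 1 * P 2) := by
  refine .of_span (fun P hP => span_hexL2 hP) (fun P _ F hF h => ?_) (fun P hP => ?_)
    (fun P hP => ?_) (fun P P' _ h => ?_)
  · exact eq_zero_of_mem_polyAll (polyQ_le_polyAll _ hF) infinite_unit_interval
      fun x hx => h x (box_subset_cube hx)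
  · simp [mul_assoc]
  · obtain ⟨m, rfl⟩ := exists_eq_add_one hP
    rw [finrank_polyQ, Fin.prod_univ_three]
    simp
  · rintro _ ⟨⟨i, j, k⟩, rfl⟩
    exact ⟨(⟨i.1, i.2.trans_le (h 0)⟩, ⟨j.1, j.2.trans_le (h 1)⟩, ⟨k.1, k.2.trans_le (h 2)⟩), rfl⟩

/-! ### Barycentric coordinates -/

section Barycentric

variable {N : ℕ}

/-- The barycentric coordinates of the unit simplex. -/
noncomputable def bary (N : ℕ) : Fin (N + 1) → Scal N :=
  Fin.cons (fun x => 1 - ∑ k, x k) fun k x => x k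

theorem nu_eq_bary : nu (N := 2) 0 1 = bary 2 := by
  funext a x
  fin_cases a
  · simp [nu, bary, Fin.sum_univ_two, sub_sub]
  · rfl
  · rfl

theorem lam_eq_bary : lam = bary 3 := by
  funext a x
  fin_cases a
  · simp [lam, bary, Fin.sum_univ_three]
    ring
  · rfl
  · rfl
  · rfl

theorem bary_mem_polyP (a : Fin (N + 1)) : bary N a ∈ polyP N 1 := by
  refine Fin.cases ?_ (fun k => ?_) a
  · have h : bary N 0 = 1 - ∑ k, fun x => x k := by
      funext x
      simp [bary]
    rw [h]
    exact Submodule.sub_mem _ (one_mem_polyP 1) (Submodule.sum_mem _ fun k _ => coord_mem_polyP k)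
  · exact coord_mem_polyP k

theorem sum_bary (N : ℕ) : ∑ a, bary N a = 1 := by
  funext x
  simp [Fin.sum_univ_succ, bary]

theorem span_bary (N : ℕ) : Submodule.span ℝ (Set.range (bary N)) = polyP N 1 := by
  apply le_antisymm
  · rw [Submodule.span_le]
    rintro _ ⟨a, rfl⟩
    exact bary_mem_polyP a
  · rw [polyP, Submodule.span_le]
    rintro _ ⟨e, he, rfl⟩
    by_cases h : ∃ k, e k ≠ 0
    · obtain ⟨k, hk⟩ := h
      have hsum := sum_erase_add univ e (mem_univ k)
      have he' : e = Pi.single k 1 := by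
        funext l
        rcases eq_or_ne l k with rfl | hl
        · rw [Pi.single_eq_same]
          omega
        · have := single_le_sum (f := e) (s := univ.erase k) (fun _ _ => Nat.zero_le _)
            (mem_erase.mpr ⟨hl, mem_univ l⟩)
          rw [Pi.single_eq_of_ne hl]
          omega
      rw [he', monoFun_single]
      exact Submodule.subset_span ⟨k.succ, rfl⟩
    · have he' : e = 0 := by
        funext k
        by_contra hk
        exact h ⟨k, hk⟩
      rw [he', monoFun_zero, ← sum_bary]
      exact Submodule.sum_mem _ fun a _ => Submodule.subset_span ⟨a, rfl⟩

theorem grad_bary_succ (k : Fin N) : grad (bary N k.succ) = unitVec k := grad_coord k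

theorem grad_bary_zero : grad (bary N 0) = -fun _ _ => 1 := by
  have hd : Differentiable ℝ fun x : Fin N → ℝ => ∑ k, x k := by fun_prop
  have h := grad_sub (differentiable_const (1 : ℝ)) hd
  rw [grad_const, zero_sub] at h
  refine h.trans (congrArg _ ?_)
  funext x i
  have h' : HasFDerivAt (fun x : Fin N → ℝ => ∑ k, x k)
      (∑ k, ContinuousLinearMap.proj (R := ℝ) k) x :=
    HasFDerivAt.fun_sum fun k _ => hasFDerivAt_apply k x
  simp [grad, h'.fderiv]

theorem whitneyEdge_bary_succ_succ (k l : Fin N) :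
    whitneyEdge (bary N) k.succ l.succ = koszul k l := by
  rw [whitneyEdge, grad_bary_succ, grad_bary_succ]
  rfl

/-- From (1 - Σ x_l) e_k + x_k Σ e_l, regrouped. Together with the edges not containing vertex 0,
which are Koszul fields, it makes Whitney fields and Nédélec generators interchangeable with
constant coefficients. -/
theorem whitneyEdge_bary_zero_succ (k : Fin N) :
    whitneyEdge (bary N) 0 k.succ = unitVec k + ∑ l, koszul k l := by
  rw [whitneyEdge, grad_bary_succ, grad_bary_zero]
  funext x i
  simp [mulVec, bary, unitVec, koszul, Pi.single_apply]
  split_ifs <;> ring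

theorem mulVec_add (f : Scal N) (F G : Vec N) : mulVec f (F + G) = mulVec f F + mulVec f G := by
  funext x
  simp [mulVec]

theorem mulVec_sub (f : Scal N) (F G : Vec N) : mulVec f (F - G) = mulVec f F - mulVec f G := by
  funext x
  simp [mulVec, smul_sub]

theorem mulVec_neg (f : Scal N) (F : Vec N) : mulVec f (-F) = -mulVec f F := by
  funext x
  simp [mulVec]

theorem mulVec_zero (f : Scal N) : mulVec f 0 = 0 := by
  funext x
  simp [mulVec]

theorem mulVec_sum {ι : Type*} (f : Scal N) (t : Finset ι) (F : ι → Vec N) :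
    mulVec f (∑ l ∈ t, F l) = ∑ l ∈ t, mulVec f (F l) := by
  funext x
  simp [mulVec, smul_sum]

theorem mulVec_whitneyEdge_bary_mem {n : ℕ} {f : Scal N} (hf : f ∈ polyP N n)
    (a b : Fin (N + 1)) : mulVec f (whitneyEdge (bary N) a b) ∈ nedelec N (n + 1) := by
  have h0 : ∀ k : Fin N, mulVec f (whitneyEdge (bary N) 0 k.succ) ∈ nedelec N (n + 1) := by
    intro k
    rw [whitneyEdge_bary_zero_succ, mulVec_add, mulVec_sum]
    exact Submodule.add_mem _ (mulVec_unitVec_mem_nedelec hf k)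
      (Submodule.sum_mem _ fun l _ => mulVec_koszul_mem_nedelec hf k l)
  refine Fin.cases ?_ (fun k => ?_) a <;> refine Fin.cases ?_ (fun l => ?_) b
  · have : whitneyEdge (bary N) 0 0 = 0 := sub_self _
    rw [this, mulVec_zero]
    exact Submodule.zero_mem _
  · exact h0 l
  · rw [whitneyEdge_swap, mulVec_neg]
    exact Submodule.neg_mem _ (h0 k)
  · rw [whitneyEdge_bary_succ_succ]
    exact mulVec_koszul_mem_nedelec hf k l

theorem nedelec_le_of_whitneyEdge {W : Submodule ℝ (Vec N)} {n : ℕ}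
    (h : ∀ a b, ∀ f ∈ polyP N n, mulVec f (whitneyEdge (bary N) a b) ∈ W) :
    nedelec N (n + 1) ≤ W := by
  have hk : ∀ k l, ∀ f ∈ polyP N n, mulVec f (koszul k l) ∈ W := by
    intro k l f hf
    rw [← whitneyEdge_bary_succ_succ]
    exact h _ _ f hf
  refine nedelec_le (fun k f hf => ?_) hk
  have e : unitVec k = whitneyEdge (bary N) 0 k.succ - ∑ l, koszul k l := by
    rw [whitneyEdge_bary_zero_succ, add_sub_cancel_right]
  rw [e, mulVec_sub, mulVec_sum]
  exact W.sub_mem (h _ _ f hf) (W.sum_mem fun l _ => hk k l f hf)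

variable {m : ℕ} {s : Fin m → Scal N}

theorem phiE_pick2_mem (hs : ∀ a, s a ∈ polyP N 1) {i p : ℕ} (hi : 2 ≤ i) (hip : i ≤ p)
    (a b : Fin m) : phiE i (pick2 s a b) ∈ polyP N p := by
  refine polyP_mono hip ?_
  rw [← polyP_one_pow]
  refine phiE_mem (fun k => ?_) (by omega)
  fin_cases k
  exacts [hs a, hs b]

theorem phiT_pick3_mem (hs : ∀ a, s a ∈ polyP N 1) {i j p : ℕ} (hi : 2 ≤ i) (hj : 1 ≤ j)
    (hp : i + j ≤ p) (a b c : Fin m) : phiT i j (pick3 s a b c) ∈ polyP N p := by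
  refine polyP_mono hp ?_
  rw [← polyP_one_pow]
  refine phiT_mem (fun k => ?_) (by omega) hj
  fin_cases k
  exacts [hs a, hs b, hs c]

theorem polyT_pick3_mem (hs : ∀ a, s a ∈ polyP N 1) {i j n : ℕ} (hn : i + j ≤ n) (a b c : Fin m) :
    polyT i j (pick3 s a b c) ∈ polyP N n := by
  refine polyP_mono hn ?_
  rw [← polyP_one_pow]
  refine polyT_mem (fun k => ?_) i j
  fin_cases k
  exacts [hs a, hs b, hs c]

variable {W : Submodule ℝ (Vec N)} {n : ℕ}

theorem fieldE_pick2_mem (hs : ∀ a, s a ∈ polyP N 1)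
    (hW : ∀ a b, ∀ f ∈ polyP N n, mulVec f (whitneyEdge s a b) ∈ W) {i : ℕ} (hi : i ≤ n)
    (a b : Fin m) : fieldE i (pick2 s a b) ∈ W := by
  refine hW a b _ (polyP_mono hi ?_)
  rw [← polyP_one_pow]
  exact legendreP_hom_mem (hs a) (hs b) i

theorem fieldT_pick3_mem (hs : ∀ a, s a ∈ polyP N 1)
    (hW : ∀ a b, ∀ f ∈ polyP N n, mulVec f (whitneyEdge s a b) ∈ W) {i j : ℕ} (hj : 1 ≤ j)
    (hn : i + j ≤ n) (a b c : Fin m) : fieldT i j (pick3 s a b c) ∈ W := by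
  have h1 : fieldT i j (pick3 s a b c) = mulVec (hom (jacobiL ((2 * i + 1 : ℕ) : ℝ) j)
      (s a + s b) (s c) * hom (legendreP i) (s a) (s b)) (whitneyEdge s a b) :=
    mulVec_mulVec _ _ _
  rw [h1]
  refine hW a b _ (polyP_mono (by omega) (polyP_mul_le j i (Submodule.mul_mem_mul ?_ ?_)))
  · rw [← polyP_one_pow j]
    exact jacobiL_hom_mem (Submodule.add_mem _ (hs a) (hs b)) (hs c) _ hj
  · rw [← polyP_one_pow i]
    exact legendreP_hom_mem (hs a) (hs b) i

end Barycentric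

/-! ### Binomial identities, boxes inside the simplices, sizes and monotonicity of index sets -/

theorem two_mul_choose_two (n : ℕ) : 2 * (n + 1).choose 2 = (n + 1) * n := by
  rw [Nat.choose_two_right, Nat.add_sub_cancel, Nat.mul_div_cancel']
  rw [mul_comm]
  exact (Nat.even_mul_succ_self n).two_dvd

theorem six_mul_choose_three (n : ℕ) : 6 * (n + 2).choose 3 = (n + 2) * (n + 1) * n := by
  have h := Nat.descFactorial_eq_factorial_mul_choose (n + 2) 3
  simp only [Nat.descFactorial, Nat.factorial] at h
  simp at h
  rw [← h]
  ring

/-- Three coordinates below 1/4 have sum below 1, so one box serves triangle, tetrahedron and prism.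
-/
theorem infinite_quarter_interval {N : ℕ} : ∀ _ : Fin N, (Set.Ioo (0 : ℝ) (1 / 4)).Infinite :=
  fun _ => Set.Ioo_infinite (by norm_num)

theorem box_subset_simplex_two :
    Set.pi .univ (fun _ : Fin 2 => Set.Ioo (0 : ℝ) (1 / 4)) ⊆ simplex 2 := by
  refine fun x hx => ⟨fun k => (hx k trivial).1, ?_⟩
  have h0 := (hx 0 trivial).2
  have h1 := (hx 1 trivial).2
  rw [Fin.sum_univ_two]
  linarith

theorem box_subset_simplex_three :
    Set.pi .univ (fun _ : Fin 3 => Set.Ioo (0 : ℝ) (1 / 4)) ⊆ simplex 3 := by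
  refine fun x hx => ⟨fun k => (hx k trivial).1, ?_⟩
  have h0 := (hx 0 trivial).2
  have h1 := (hx 1 trivial).2
  have h2 := (hx 2 trivial).2
  rw [Fin.sum_univ_three]
  linarith

theorem card_edges_three : Nat.card (Edges 3) = 3 := by
  rw [Nat.card_eq_fintype_card]
  decide

theorem card_edges_four : Nat.card (Edges 4) = 6 := by
  rw [Nat.card_eq_fintype_card]
  decide

theorem card_faces_four : Nat.card (Faces 4) = 4 := by
  rw [Nat.card_eq_fintype_card]
  decide

theorem triIdx_mono {i₀ j₀ n n' : ℕ} (h : n ≤ n') : triIdx i₀ j₀ n ⊆ triIdx i₀ j₀ n' := by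
  intro q hq
  rw [mem_triIdx] at *
  omega

theorem tetIdx_mono {i₀ j₀ k₀ n n' : ℕ} (h : n ≤ n') :
    tetIdx i₀ j₀ k₀ n ⊆ tetIdx i₀ j₀ k₀ n' := by
  intro q hq
  rw [mem_tetIdx] at *
  omega

theorem eq_pick3_nu : nu (N := 2) 0 1 = pick3 (nu 0 1) 0 1 2 := by
  funext a
  fin_cases a <;> rfl

/-! ### Triangle -/

theorem nu_mem_polyP (a : Fin 3) : nu (N := 2) 0 1 a ∈ polyP 2 1 := by
  rw [nu_eq_bary]
  exact bary_mem_polyP a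

/-- The triangle coordinates, extended by zero. -/
noncomputable def triCoord : Fin 4 → Scal 2 := ![nu 0 1 0, nu 0 1 1, nu 0 1 2, 0]

theorem sum_triCoord : ∑ a, triCoord a = 1 := by
  rw [← sum_bary 2, ← nu_eq_bary, Fin.sum_univ_four, Fin.sum_univ_three]
  simp [triCoord]

theorem span_triCoord_pow (n : ℕ) :
    Submodule.span ℝ (Set.range triCoord) ^ n = polyP 2 n := by
  rw [← polyP_one_pow, ← span_bary, ← nu_eq_bary]
  congr 1
  apply le_antisymm <;> rw [Submodule.span_le]
  · rintro _ ⟨a, rfl⟩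
    fin_cases a
    · exact Submodule.subset_span ⟨0, rfl⟩
    · exact Submodule.subset_span ⟨1, rfl⟩
    · exact Submodule.subset_span ⟨2, rfl⟩
    · exact Submodule.zero_mem _
  · rintro _ ⟨a, rfl⟩
    refine Submodule.subset_span ⟨a.castSucc, ?_⟩
    fin_cases a <;> rfl

/-- The zero coordinate in place of vertex 3 kills the edge, face and interior functions that
involve it, and what remains of the tetrahedral family is the triangle family. -/
theorem span_triH1 {p : ℕ} (hp : 1 ≤ p) :
    Submodule.span ℝ (Set.range (triH1 p)) = polyP 2 p := by
  apply le_antisymm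
  · rw [Submodule.span_le]
    rintro _ ⟨a | ⟨e, i⟩ | q, rfl⟩
    · exact polyP_mono hp (nu_mem_polyP a)
    · obtain ⟨hi, hip⟩ := mem_Icc.mp i.2
      exact phiE_pick2_mem nu_mem_polyP hi hip _ _
    · obtain ⟨hi, hj, hij⟩ := mem_triIdx.mp q.2
      change phiT _ _ (nu 0 1) ∈ _
      rw [eq_pick3_nu]
      exact phiT_pick3_mem nu_mem_polyP hi hj hij _ _ _
  · rw [← span_triCoord_pow]
    refine span_pow_le_of_H1 sum_triCoord hp (fun a => ?_) (fun a b hab i hi hip => ?_)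
      (fun a b c hab hbc i j hi hj hij => ?_) fun i j l hi hj hl h => ?_
    · fin_cases a
      · exact Submodule.subset_span ⟨.inl 0, rfl⟩
      · exact Submodule.subset_span ⟨.inl 1, rfl⟩
      · exact Submodule.subset_span ⟨.inl 2, rfl⟩
      · exact Submodule.zero_mem _
    · have h : (a = 0 ∧ b = 1) ∨ (a = 0 ∧ b = 2) ∨ (a = 1 ∧ b = 2) ∨ b = 3 := by omega
      rcases h with ⟨rfl, rfl⟩ | ⟨rfl, rfl⟩ | ⟨rfl, rfl⟩ | rfl
      · exact Submodule.subset_span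
          ⟨.inr (.inl (⟨(0, 1), by decide⟩, ⟨i, mem_Icc.mpr ⟨hi, hip⟩⟩)), rfl⟩
      · exact Submodule.subset_span
          ⟨.inr (.inl (⟨(0, 2), by decide⟩, ⟨i, mem_Icc.mpr ⟨hi, hip⟩⟩)), rfl⟩
      · exact Submodule.subset_span
          ⟨.inr (.inl (⟨(1, 2), by decide⟩, ⟨i, mem_Icc.mpr ⟨hi, hip⟩⟩)), rfl⟩
      · rw [phiE_eq_zero hi (Or.inr rfl)]
        exact Submodule.zero_mem _
    · have h : (a = 0 ∧ b = 1 ∧ c = 2) ∨ c = 3 := by omega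
      rcases h with ⟨rfl, rfl, rfl⟩ | rfl
      · refine Submodule.subset_span ⟨.inr (.inr ⟨(i, j), mem_triIdx.mpr ⟨hi, hj, hij⟩⟩), rfl⟩
      · rw [phiT_eq_zero hi hj (Or.inr (Or.inr rfl))]
        exact Submodule.zero_mem _
    · have : hom (jacobiL ((2 * (i + j) : ℕ) : ℝ) l) (1 - triCoord 3) (triCoord 3) = 0 :=
        jacobiL_hom_zero _ hl _
      rw [this, mul_zero]
      exact Submodule.zero_mem _

theorem triH1_isHierarchicalBasis :
    IsHierarchicalBasis (simplex 2) triH1 (fun p => polyP 2 p)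
      (fun p => (p + 2) * (p + 1) / 2) := by
  have hdim : ∀ p, (p + 2) * (p + 1) / 2 = (p + 2).choose 2 := fun p =>
    (Nat.choose_two_right _).symm
  refine .of_span (fun p hp => span_triH1 hp) (fun p _ F hF h => ?_) (fun p hp => ?_)
    (fun p _ => ?_) (fun p p' _ hpp' => ?_)
  · exact eq_zero_of_mem_polyAll (polyP_le_polyAll _ _ hF) infinite_quarter_interval
      fun x hx => h x (box_subset_simplex_two hx)
  · obtain ⟨n, rfl⟩ : ∃ n, p = n + 1 := ⟨p - 1, by omega⟩
    rw [hdim, Nat.card_sum, Nat.card_sum, Nat.card_prod, card_edges_three]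
    simp only [Nat.card_eq_fintype_card, Fintype.card_fin, Fintype.card_coe, card_triIdx,
      Nat.card_Icc]
    rw [show n + 1 + 2 - 2 - 1 = n by omega]
    simp [Nat.choose_succ_succ']
    ring
  · rw [hdim, finrank_polyP_two]
  · rintro _ ⟨a | ⟨e, i⟩ | q, rfl⟩
    · exact ⟨.inl a, rfl⟩
    · exact ⟨.inr (.inl (e, ⟨i.1, Icc_two_mono hpp' i.2⟩)), rfl⟩
    · exact ⟨.inr (.inr ⟨q.1, triIdx_mono hpp' q.2⟩), rfl⟩

theorem span_triCurl {p : ℕ} (hp : 1 ≤ p) :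
    Submodule.span ℝ (Set.range (triCurl p)) = nedelec 2 p := by
  obtain ⟨n, rfl⟩ : ∃ n, p = n + 1 := ⟨p - 1, by omega⟩
  apply le_antisymm
  · rw [Submodule.span_le]
    have hW : ∀ a b, ∀ f ∈ polyP 2 n, mulVec f (whitneyEdge (nu 0 1) a b) ∈ nedelec 2 (n + 1) := by
      intro a b f hf
      rw [nu_eq_bary]
      exact mulVec_whitneyEdge_bary_mem hf a b
    rintro _ ⟨⟨e, i⟩ | q | q, rfl⟩
    · exact fieldE_pick2_mem nu_mem_polyP hW (Nat.lt_succ_iff.mp i.2) _ _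
    · obtain ⟨-, hj, hij⟩ := mem_triIdx.mp q.2
      exact fieldT_pick3_mem nu_mem_polyP hW hj hij _ _ _
    · obtain ⟨-, hj, hij⟩ := mem_triIdx.mp q.2
      exact fieldT_pick3_mem nu_mem_polyP hW hj hij _ _ _
  · refine nedelec_le_of_whitneyEdge fun a b f hf => ?_
    have h := mulVec_whitneyEdge_mem_of_curl (n := n) (W := Submodule.span ℝ
      (Set.range (triCurl (n + 1)))) sum_triCoord (fun a b hab i hi => ?_)
      (fun a b c hab hbc i j hj hij => ?_) (fun a b c hab hbc i j hj hij => ?_)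
      (fun a ha i j k hj hk hijk => ?_) a.castSucc b.castSucc f (by rwa [span_triCoord_pow])
    · have e : ∀ a : Fin 3, triCoord a.castSucc = nu 0 1 a := by
        intro a
        fin_cases a <;> rfl
      rwa [whitneyEdge, e, e, nu_eq_bary] at h
    · have h : (a = 0 ∧ b = 1) ∨ (a = 0 ∧ b = 2) ∨ (a = 1 ∧ b = 2) ∨ b = 3 := by omega
      rcases h with ⟨rfl, rfl⟩ | ⟨rfl, rfl⟩ | ⟨rfl, rfl⟩ | rfl
      · exact Submodule.subset_span
          ⟨.inl (⟨(0, 1), by decide⟩, ⟨i, Nat.lt_succ_iff.mpr hi⟩), rfl⟩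
      · exact Submodule.subset_span
          ⟨.inl (⟨(0, 2), by decide⟩, ⟨i, Nat.lt_succ_iff.mpr hi⟩), rfl⟩
      · exact Submodule.subset_span
          ⟨.inl (⟨(1, 2), by decide⟩, ⟨i, Nat.lt_succ_iff.mpr hi⟩), rfl⟩
      · rw [fieldE_eq_zero i (Or.inr rfl)]
        exact Submodule.zero_mem _
    · have h : (a = 0 ∧ b = 1 ∧ c = 2) ∨ c = 3 := by omega
      rcases h with ⟨rfl, rfl, rfl⟩ | rfl
      · exact Submodule.subset_span
          ⟨.inr (.inl ⟨(i, j), mem_triIdx.mpr ⟨Nat.zero_le _, hj, hij⟩⟩), rfl⟩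
      · rw [fieldT_eq_zero i hj (Or.inr (Or.inr rfl))]
        exact Submodule.zero_mem _
    · have h : (a = 0 ∧ b = 1 ∧ c = 2) ∨ c = 3 := by omega
      rcases h with ⟨rfl, rfl, rfl⟩ | rfl
      · exact Submodule.subset_span
          ⟨.inr (.inr ⟨(i, j), mem_triIdx.mpr ⟨Nat.zero_le _, hj, hij⟩⟩), rfl⟩
      · rw [fieldT_eq_zero i hj (Or.inr (Or.inl rfl))]
        exact Submodule.zero_mem _
    -- Every interior function vanishes: vertex 3 is either the argument of the last integrated
    -- Jacobi factor or a vertex of the face.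
    · have h : a = 0 ∨ a + 1 = 3 ∨ a + 2 = 3 := by revert ha; revert a; decide
      rcases h with rfl | h | h
      · have : hom (jacobiL ((2 * (i + j) : ℕ) : ℝ) k) (1 - triCoord (0 + 3)) (triCoord (0 + 3))
            = 0 := jacobiL_hom_zero _ hk _
        rw [this]
        convert Submodule.zero_mem _
        funext x
        simp [mulVec]
      · rw [h, fieldT_eq_zero i hj (Or.inr (Or.inl rfl)), mulVec_zero]
        exact Submodule.zero_mem _
      · rw [h, fieldT_eq_zero i hj (Or.inr (Or.inr rfl)), mulVec_zero]
        exact Submodule.zero_mem _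

theorem le_finrank_nedelec_two {p : ℕ} (hp : 1 ≤ p) :
    p * (p + 2) ≤ Module.finrank ℝ (nedelec 2 p) := by
  obtain ⟨n, rfl⟩ : ∃ n, p = n + 1 := ⟨p - 1, by omega⟩
  have h := le_finrank_nedelec (N := 2) n
  have h2 := two_mul_choose_two (n + 1)
  rw [finrank_polyP_two, finrank_polyHom_two, finrank_polyHom_two] at h
  nlinarith

theorem triCurl_isHierarchicalBasis :
    IsHierarchicalBasis (simplex 2) triCurl (fun p => nedelec 2 p) (fun p => p * (p + 2)) := by
  refine .of_span (fun p hp => span_triCurl hp) (fun p _ F hF h => ?_) (fun p hp => ?_)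
    (fun p hp => le_finrank_nedelec_two hp) (fun p p' _ hpp' => ?_)
  · exact eq_zero_of_mem_compSpace_polyAll (nedelec_le_compSpace_polyAll _ hF)
      infinite_quarter_interval fun x hx => h x (box_subset_simplex_two hx)
  · obtain ⟨n, rfl⟩ : ∃ n, p = n + 1 := ⟨p - 1, by omega⟩
    rw [Nat.card_sum, Nat.card_sum, Nat.card_prod, card_edges_three]
    simp only [Nat.card_eq_fintype_card, Fintype.card_fin, Fintype.card_coe, card_triIdx,
      Nat.add_sub_cancel]
    have h2 := two_mul_choose_two n
    rw [show n + 2 - 0 - 1 = n + 1 by omega]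
    linarith
  · have hn : p - 1 ≤ p' - 1 := Nat.sub_le_sub_right hpp' 1
    rintro _ ⟨⟨e, i⟩ | q | q, rfl⟩
    · exact ⟨.inl (e, ⟨i.1, i.2.trans_le hpp'⟩), rfl⟩
    · exact ⟨.inr (.inl ⟨q.1, triIdx_mono hn q.2⟩), rfl⟩
    · exact ⟨.inr (.inr ⟨q.1, triIdx_mono hn q.2⟩), rfl⟩

/-- Rotation sends e_k to ± the other unit vector and the planar Koszul field to ± x, which gives
one inclusion on generators; the lower bound for the Nédélec dimension gives equality. -/
theorem map_rotEquiv_nedelec {p : ℕ} (hp : 1 ≤ p) :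
    (nedelec 2 p).map rotEquiv.toLinearMap = raviartThomas 2 p := by
  obtain ⟨n, rfl⟩ : ∃ n, p = n + 1 := ⟨p - 1, by omega⟩
  refine Submodule.eq_of_le_of_finrank_le ?_ ?_
  · rw [Submodule.map_le_iff_le_comap]
    refine nedelec_le (fun k f hf => ?_) fun k l f hf => ?_
    · have e : rot (mulVec f (unitVec k))
          = mulVec (if k = 0 then -f else f) (unitVec (k + 1)) := by
        funext x i
        fin_cases k <;> fin_cases i <;> simp [rot, mulVec, unitVec]
      change rot (mulVec f (unitVec k)) ∈ raviartThomas 2 (n + 1)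
      rw [e]
      refine mulVec_unitVec_mem_raviartThomas ?_ _
      split_ifs
      exacts [Submodule.neg_mem _ hf, hf]
    · change rot (mulVec f (koszul k l)) ∈ raviartThomas 2 (n + 1)
      have h := mulVec_id_mem_raviartThomas hf
      have hkl : rot (mulVec f (koszul k l)) = 0 ∨
          rot (mulVec f (koszul k l)) = mulVec f (fun x => x) ∨
          rot (mulVec f (koszul k l)) = -mulVec f fun x => x := by
        fin_cases k <;> fin_cases l
        · left
          funext x i
          fin_cases i <;> simp [rot, mulVec, koszul]
        · right; left
          funext x i
          fin_cases i <;> simp [rot, mulVec, koszul]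
        · right; right
          funext x i
          fin_cases i <;> simp [rot, mulVec, koszul]
        · left
          funext x i
          fin_cases i <;> simp [rot, mulVec, koszul]
      rcases hkl with e | e | e <;> rw [e]
      exacts [Submodule.zero_mem _, h, Submodule.neg_mem _ h]
  · rw [LinearEquiv.finrank_map_eq, finrank_raviartThomas n (0 : Fin 2), finrank_polyP_two,
      finrank_polyHom_two]
    have h := le_finrank_nedelec_two (p := n + 1) (by omega)
    have h2 := two_mul_choose_two (n + 1)
    nlinarith

theorem triDiv_isHierarchicalBasis :
    IsHierarchicalBasis (simplex 2) triDiv (fun p => raviartThomas 2 p)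
      (fun p => p * (p + 2)) :=
  triCurl_isHierarchicalBasis.rot (fun _ hp => map_rotEquiv_nedelec hp)
    (fun _ _ _ hF h => eq_zero_of_mem_compSpace_polyAll (raviartThomas_le_compSpace_polyAll _ hF)
      infinite_quarter_interval fun x hx => h x (box_subset_simplex_two hx)) fun _ => rfl

theorem grad_nu_one : grad (nu (N := 2) 0 1 1) = unitVec 0 := grad_coord 0

theorem grad_nu_two : grad (nu (N := 2) 0 1 2) = unitVec 1 := grad_coord 1

theorem triL2_apply {p : ℕ} (q : TriL2Idx p) : triL2 p q = polyT q.1.1 q.1.2 (nu 0 1) := by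
  have : cross2 (grad (nu 0 1 1)) (grad (nu 0 1 2)) = 1 := by
    rw [grad_nu_one, grad_nu_two]
    funext x
    simp [cross2, unitVec]
  rw [triL2, this, mul_one]

/-- The face elimination with s_d = 0, so that no interior correction occurs. -/
theorem span_triL2 (p : ℕ) : Submodule.span ℝ (Set.range (triL2 p)) = polyP 2 (p - 1) := by
  apply le_antisymm
  · rw [Submodule.span_le]
    rintro _ ⟨q, rfl⟩
    rw [triL2_apply, eq_pick3_nu]
    exact polyT_pick3_mem nu_mem_polyP (mem_triIdx.mp q.2).2.2 _ _ _
  · rw [← span_triCoord_pow]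
    refine span_pow_le_of_face sum_triCoord (a := 0) (b := 1) (c := 2) (d := 3) (by decide)
      legendreP_hasLead (fun i j => jacobiP_nat_hasLead (2 * i + 1) j) (fun i j hij => ?_)
      fun m hm g hg => ?_
    · refine Submodule.subset_span
        ⟨⟨(i, j), mem_triIdx.mpr ⟨Nat.zero_le _, Nat.zero_le _, hij⟩⟩, ?_⟩
      rw [triL2_apply]
      rfl
    · have : triCoord 3 = 0 := rfl
      rw [this, zero_mul]
      exact Submodule.zero_mem _

theorem triL2_isHierarchicalBasis :
    IsHierarchicalBasis (simplex 2) triL2 (fun p => polyP 2 (p - 1))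
      (fun p => p * (p + 1) / 2) := by
  have hdim : ∀ n, (n + 1) * (n + 1 + 1) / 2 = (n + 2).choose 2 := fun n => by
    rw [Nat.choose_two_right, mul_comm]
    rfl
  refine .of_span (fun p hp => span_triL2 p) (fun p _ F hF h => ?_) (fun p hp => ?_)
    (fun p hp => ?_) (fun p p' _ hpp' => ?_)
  · exact eq_zero_of_mem_polyAll (polyP_le_polyAll _ _ hF) infinite_quarter_interval
      fun x hx => h x (box_subset_simplex_two hx)
  · obtain ⟨n, rfl⟩ : ∃ n, p = n + 1 := ⟨p - 1, by omega⟩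
    rw [hdim, Nat.card_eq_fintype_card, Fintype.card_coe, card_triIdx]
    rfl
  · obtain ⟨n, rfl⟩ : ∃ n, p = n + 1 := ⟨p - 1, by omega⟩
    rw [hdim, finrank_polyP_two]
    rfl
  · rintro _ ⟨q, rfl⟩
    exact ⟨⟨q.1, triIdx_mono (Nat.sub_le_sub_right hpp' 1) q.2⟩, rfl⟩

/-! ### Tetrahedron -/

theorem lam_mem_polyP (a : Fin 4) : lam a ∈ polyP 3 1 := by
  rw [lam_eq_bary]
  exact bary_mem_polyP a

theorem sum_lam : ∑ a, lam a = 1 := by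
  rw [lam_eq_bary]
  exact sum_bary 3

theorem span_lam_pow (n : ℕ) : Submodule.span ℝ (Set.range lam) ^ n = polyP 3 n := by
  rw [lam_eq_bary, span_bary, polyP_one_pow]

theorem one_sub_lam_mem_polyP (a : Fin 4) : 1 - lam a ∈ polyP 3 1 :=
  Submodule.sub_mem _ (one_mem_polyP 1) (lam_mem_polyP a)

theorem jacobiL_hom_lam_mem (m : ℕ) {k : ℕ} (hk : 1 ≤ k) (d : Fin 4) :
    hom (jacobiL (m : ℝ) k) (1 - lam d) (lam d) ∈ polyP 3 k := by
  rw [← polyP_one_pow]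
  exact jacobiL_hom_mem (one_sub_lam_mem_polyP d) (lam_mem_polyP d) m hk

theorem span_tetH1 {p : ℕ} (hp : 1 ≤ p) :
    Submodule.span ℝ (Set.range (tetH1 p)) = polyP 3 p := by
  apply le_antisymm
  · rw [Submodule.span_le]
    rintro _ ⟨a | ⟨e, i⟩ | ⟨f, q⟩ | q, rfl⟩
    · exact polyP_mono hp (lam_mem_polyP a)
    · obtain ⟨hi, hip⟩ := mem_Icc.mp i.2
      exact phiE_pick2_mem lam_mem_polyP hi hip _ _
    · obtain ⟨hi, hj, hij⟩ := mem_triIdx.mp q.2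
      exact phiT_pick3_mem lam_mem_polyP hi hj hij _ _ _
    · obtain ⟨hi, hj, hk, hijk⟩ := mem_tetIdx.mp q.2
      exact polyP_mono hijk (polyP_mul_le _ _ (Submodule.mul_mem_mul
        (phiT_pick3_mem lam_mem_polyP hi hj le_rfl _ _ _) (jacobiL_hom_lam_mem _ hk 3)))
  · rw [← span_lam_pow]
    refine span_pow_le_of_H1 sum_lam hp (fun a => ?_) (fun a b hab i hi hip => ?_)
      (fun a b c hab hbc i j hi hj hij => ?_) fun i j k hi hj hk h => ?_ <;>
      apply Submodule.subset_span
    · exact ⟨.inl a, rfl⟩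
    · exact ⟨.inr (.inl (⟨(a, b), hab⟩, ⟨i, mem_Icc.mpr ⟨hi, hip⟩⟩)), rfl⟩
    · exact ⟨.inr (.inr (.inl (⟨(a, b, c), hab, hbc⟩,
        ⟨(i, j), mem_triIdx.mpr ⟨hi, hj, hij⟩⟩))), rfl⟩
    · exact ⟨.inr (.inr (.inr ⟨(i, j, k), mem_tetIdx.mpr ⟨hi, hj, hk, h⟩⟩)), rfl⟩

theorem tetH1_isHierarchicalBasis :
    IsHierarchicalBasis (simplex 3) tetH1 (fun p => polyP 3 p)
      (fun p => (p + 3) * (p + 2) * (p + 1) / 6) := by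
  have hdim : ∀ p, (p + 3) * (p + 2) * (p + 1) / 6 = (p + 3).choose 3 := fun p => by
    refine Nat.div_eq_of_eq_mul_right (by norm_num) ?_
    rw [six_mul_choose_three (p + 1)]
  refine .of_span (fun p hp => span_tetH1 hp) (fun p _ F hF h => ?_) (fun p hp => ?_)
    (fun p _ => ?_) (fun p p' _ hpp' => ?_)
  · exact eq_zero_of_mem_polyAll (polyP_le_polyAll _ _ hF) infinite_quarter_interval
      fun x hx => h x (box_subset_simplex_three hx)
  · obtain ⟨n, rfl⟩ : ∃ n, p = n + 1 := ⟨p - 1, by omega⟩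
    rw [hdim, Nat.card_sum, Nat.card_sum, Nat.card_sum, Nat.card_prod, Nat.card_prod,
      card_edges_four, card_faces_four]
    simp only [Nat.card_eq_fintype_card, Fintype.card_fin, Fintype.card_coe, card_triIdx,
      card_tetIdx _ _ _ _ le_rfl, Nat.card_Icc]
    rw [show n + 1 + 2 - 2 - 1 = n by omega, show n + 1 + 3 - 2 - 1 - 1 = n by omega]
    simp [Nat.choose_succ_succ']
    ring
  · rw [hdim, finrank_polyP_three]
  · rintro _ ⟨a | ⟨e, i⟩ | ⟨f, q⟩ | q, rfl⟩
    · exact ⟨.inl a, rfl⟩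
    · exact ⟨.inr (.inl (e, ⟨i.1, Icc_two_mono hpp' i.2⟩)), rfl⟩
    · exact ⟨.inr (.inr (.inl (f, ⟨q.1, triIdx_mono hpp' q.2⟩))), rfl⟩
    · exact ⟨.inr (.inr (.inr ⟨q.1, tetIdx_mono hpp' q.2⟩)), rfl⟩

theorem exists_castSucc_eq {a : Fin 4} (ha : a ≠ 3) : ∃ m : Fin 3, m.castSucc = a := by
  revert a
  decide

theorem mulVec_mem_of_forall {N : ℕ} {W : Submodule ℝ (Vec N)} {F : Vec N} {g f : Scal N}
    {k l n : ℕ} (hF : ∀ f ∈ polyP N n, mulVec f F ∈ W) (hg : g ∈ polyP N k) (hf : f ∈ polyP N l)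
    (h : k + l ≤ n) : mulVec g (mulVec f F) ∈ W := by
  rw [mulVec_mulVec]
  exact hF _ (polyP_mono h (polyP_mul_le k l (Submodule.mul_mem_mul hg hf)))

theorem mulVec_fieldT_lam_mem {W : Submodule ℝ (Vec 3)} {n : ℕ}
    (hW : ∀ a b, ∀ f ∈ polyP 3 n, mulVec f (whitneyEdge lam a b) ∈ W) {i j k : ℕ} (hj : 1 ≤ j)
    {g : Scal 3} (hg : g ∈ polyP 3 k) (h : i + j + k ≤ n) (a b c : Fin 4) :
    mulVec g (fieldT i j (pick3 lam a b c)) ∈ W := by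
  have h1 : fieldT i j (pick3 lam a b c) = mulVec (hom (jacobiL ((2 * i + 1 : ℕ) : ℝ) j)
      (lam a + lam b) (lam c) * hom (legendreP i) (lam a) (lam b)) (whitneyEdge lam a b) :=
    mulVec_mulVec _ _ _
  rw [h1]
  refine mulVec_mem_of_forall (hW a b) hg (polyP_mul_le j i (Submodule.mul_mem_mul ?_ ?_))
    (by omega)
  · rw [← polyP_one_pow j]
    exact jacobiL_hom_mem (Submodule.add_mem _ (lam_mem_polyP a) (lam_mem_polyP b))
      (lam_mem_polyP c) _ hj
  · rw [← polyP_one_pow i]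
    exact legendreP_hom_mem (lam_mem_polyP a) (lam_mem_polyP b) i

theorem tetCurl_interior {p : ℕ} (m : Fin 3) (q : tetIdx 0 1 1 (p - 1)) :
    tetCurl p (.inr (.inr (.inr (m, q)))) =
      mulVec (hom (jacobiL ((2 * (q.1.1 + q.1.2.1) : ℕ) : ℝ) q.1.2.2)
          (1 - lam (m.castSucc + 3)) (lam (m.castSucc + 3)))
        (fieldT q.1.1 q.1.2.1 (pick3 lam m.castSucc (m.castSucc + 1) (m.castSucc + 2))) := rfl

theorem span_tetCurl {p : ℕ} (hp : 1 ≤ p) :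
    Submodule.span ℝ (Set.range (tetCurl p)) = nedelec 3 p := by
  obtain ⟨n, rfl⟩ : ∃ n, p = n + 1 := ⟨p - 1, by omega⟩
  apply le_antisymm
  · rw [Submodule.span_le]
    have hW : ∀ a b, ∀ f ∈ polyP 3 n, mulVec f (whitneyEdge lam a b) ∈ nedelec 3 (n + 1) := by
      intro a b f hf
      rw [lam_eq_bary]
      exact mulVec_whitneyEdge_bary_mem hf a b
    rintro _ ⟨⟨e, i⟩ | ⟨f, q⟩ | ⟨f, q⟩ | ⟨m, q⟩, rfl⟩
    · exact fieldE_pick2_mem lam_mem_polyP hW (Nat.lt_succ_iff.mp i.2) _ _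
    · obtain ⟨-, hj, hij⟩ := mem_triIdx.mp q.2
      exact fieldT_pick3_mem lam_mem_polyP hW hj hij _ _ _
    · obtain ⟨-, hj, hij⟩ := mem_triIdx.mp q.2
      exact fieldT_pick3_mem lam_mem_polyP hW hj hij _ _ _
    · obtain ⟨-, hj, hk, hijk⟩ := mem_tetIdx.mp q.2
      rw [tetCurl_interior]
      exact mulVec_fieldT_lam_mem hW hj (jacobiL_hom_lam_mem _ hk _) hijk _ _ _
  · refine nedelec_le_of_whitneyEdge fun a b f hf => ?_
    rw [← lam_eq_bary]
    refine mulVec_whitneyEdge_mem_of_curl (n := n) sum_lam (fun a b hab i hi => ?_)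
      (fun a b c hab hbc i j hj hij => ?_) (fun a b c hab hbc i j hj hij => ?_)
      (fun a ha i j k hj hk hijk => ?_) a b f (by rwa [span_lam_pow]) <;>
      apply Submodule.subset_span
    · exact ⟨.inl (⟨(a, b), hab⟩, ⟨i, Nat.lt_succ_iff.mpr hi⟩), rfl⟩
    · exact ⟨.inr (.inl (⟨(a, b, c), hab, hbc⟩,
        ⟨(i, j), mem_triIdx.mpr ⟨Nat.zero_le _, hj, hij⟩⟩)), rfl⟩
    · exact ⟨.inr (.inr (.inl (⟨(a, b, c), hab, hbc⟩,
        ⟨(i, j), mem_triIdx.mpr ⟨Nat.zero_le _, hj, hij⟩⟩))), rfl⟩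
    · obtain ⟨m, rfl⟩ := exists_castSucc_eq ha
      exact ⟨.inr (.inr (.inr (m,
        ⟨(i, j, k), mem_tetIdx.mpr ⟨Nat.zero_le _, hj, hk, hijk⟩⟩))), tetCurl_interior m _⟩

theorem tetCurl_isHierarchicalBasis :
    IsHierarchicalBasis (simplex 3) tetCurl (fun p => nedelec 3 p)
      (fun p => p * (p + 2) * (p + 3) / 2) := by
  refine .of_span (fun p hp => span_tetCurl hp) (fun p _ F hF h => ?_) (fun p hp => ?_)
    (fun p hp => ?_) (fun p p' _ hpp' => ?_)
  · exact eq_zero_of_mem_compSpace_polyAll (nedelec_le_compSpace_polyAll _ hF)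
      infinite_quarter_interval fun x hx => h x (box_subset_simplex_three hx)
  · obtain ⟨n, rfl⟩ : ∃ n, p = n + 1 := ⟨p - 1, by omega⟩
    rw [Nat.card_sum, Nat.card_sum, Nat.card_sum, Nat.card_prod, Nat.card_prod, Nat.card_prod,
      card_edges_four, card_faces_four]
    simp only [Nat.card_eq_fintype_card, Fintype.card_fin, Fintype.card_coe, card_triIdx,
      card_tetIdx _ _ _ _ le_rfl, Nat.add_sub_cancel]
    rw [show n + 2 - 0 - 1 = n + 1 by omega, show n + 3 - 0 - 1 - 1 = n + 1 by omega]
    have h2 := two_mul_choose_two n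
    have h3 := six_mul_choose_three n
    have h4 : (n + 2).choose 3 = (n + 1).choose 2 + (n + 1).choose 3 := Nat.choose_succ_succ' _ _
    refine (Nat.div_eq_of_eq_mul_left two_pos ?_).symm
    nlinarith
  · obtain ⟨n, rfl⟩ : ∃ n, p = n + 1 := ⟨p - 1, by omega⟩
    have h := le_finrank_nedelec (N := 3) n
    have h2 := two_mul_choose_two (n + 2)
    have h3 := six_mul_choose_three (n + 1)
    have h4 := two_mul_choose_two (n + 3)
    rw [finrank_polyP_three, finrank_polyHom_three, finrank_polyHom_three] at h
    refine Nat.div_le_of_le_mul ?_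
    nlinarith
  · have hn : p - 1 ≤ p' - 1 := Nat.sub_le_sub_right hpp' 1
    rintro _ ⟨⟨e, i⟩ | ⟨f, q⟩ | ⟨f, q⟩ | ⟨m, q⟩, rfl⟩
    · exact ⟨.inl (e, ⟨i.1, i.2.trans_le hpp'⟩), rfl⟩
    · exact ⟨.inr (.inl (f, ⟨q.1, triIdx_mono hn q.2⟩)), rfl⟩
    · exact ⟨.inr (.inr (.inl (f, ⟨q.1, triIdx_mono hn q.2⟩))), rfl⟩
    · exact ⟨.inr (.inr (.inr (m, ⟨q.1, tetIdx_mono hn q.2⟩))), rfl⟩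

theorem grad_lam_zero : grad (lam 0) = -fun _ _ => 1 := by
  rw [lam_eq_bary]
  exact grad_bary_zero

theorem grad_lam_one : grad (lam 1) = unitVec 0 := grad_coord 0

theorem grad_lam_two : grad (lam 2) = unitVec 1 := grad_coord 1

theorem grad_lam_three : grad (lam 3) = unitVec 2 := grad_coord 2

/-- Face fields of the unit simplex are affine: x itself for the face opposite the origin, ±(e_k -
x) for the others. Hence they generate the same module as x and the constant fields. -/
theorem whitneyFace_lam :
    whitneyFace lam 0 1 2 = unitVec 2 - (fun x => x) ∧
    whitneyFace lam 0 1 3 = (fun x => x) - unitVec 1 ∧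
    whitneyFace lam 0 2 3 = unitVec 0 - (fun x => x) ∧ whitneyFace lam 1 2 3 = fun x => x := by
  simp only [whitneyFace, grad_lam_zero, grad_lam_one, grad_lam_two, grad_lam_three]
  refine ⟨?_, ?_, ?_, ?_⟩ <;> funext x i <;> fin_cases i <;>
    simp [mulVec, cross3, crossProduct, unitVec, lam] <;> ring

theorem whitneyFace_rotate {m : ℕ} (s : Fin m → Scal 3) (a b c : Fin m) :
    whitneyFace s b c a = whitneyFace s a b c := by
  simp only [whitneyFace]
  abel

theorem mulVec_whitneyFace_lam_mem {n : ℕ} {f : Scal 3} (hf : f ∈ polyP 3 n) {a b c : Fin 4}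
    (hab : a < b) (hbc : b < c) :
    mulVec f (whitneyFace lam a b c) ∈ raviartThomas 3 (n + 1) := by
  obtain ⟨h012, h013, h023, h123⟩ := whitneyFace_lam
  have hx := mulVec_id_mem_raviartThomas hf
  have hc := mulVec_unitVec_mem_raviartThomas hf
  have h : (a = 0 ∧ b = 1 ∧ c = 2) ∨ (a = 0 ∧ b = 1 ∧ c = 3) ∨ (a = 0 ∧ b = 2 ∧ c = 3) ∨
      (a = 1 ∧ b = 2 ∧ c = 3) := by omega
  rcases h with ⟨rfl, rfl, rfl⟩ | ⟨rfl, rfl, rfl⟩ | ⟨rfl, rfl, rfl⟩ | ⟨rfl, rfl, rfl⟩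
  · rw [h012, mulVec_sub]
    exact Submodule.sub_mem _ (hc 2) hx
  · rw [h013, mulVec_sub]
    exact Submodule.sub_mem _ hx (hc 1)
  · rw [h023, mulVec_sub]
    exact Submodule.sub_mem _ (hc 0) hx
  · rw [h123]
    exact hx

theorem raviartThomas_le_of_whitneyFace {W : Submodule ℝ (Vec 3)} {n : ℕ}
    (h : ∀ a b c, a < b → b < c → ∀ f ∈ polyP 3 n, mulVec f (whitneyFace lam a b c) ∈ W) :
    raviartThomas 3 (n + 1) ≤ W := by
  obtain ⟨h012, h013, h023, h123⟩ := whitneyFace_lam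
  have hx : ∀ f ∈ polyP 3 n, mulVec f (fun x => x) ∈ W := by
    rw [← h123]
    exact h 1 2 3 (by decide) (by decide)
  refine raviartThomas_le (fun k f hf => ?_) hx
  fin_cases k
  · have := W.add_mem (h 0 2 3 (by decide) (by decide) f hf) (hx f hf)
    rwa [h023, ← mulVec_add, sub_add_cancel] at this
  · have := W.sub_mem (hx f hf) (h 0 1 3 (by decide) (by decide) f hf)
    rwa [h013, ← mulVec_sub, sub_sub_cancel] at this
  · have := W.add_mem (h 0 1 2 (by decide) (by decide) f hf) (hx f hf)
    rwa [h012, ← mulVec_add, sub_add_cancel] at this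

theorem fluxT_pick3_mem {W : Submodule ℝ (Vec 3)} {n : ℕ} {a b c : Fin 4}
    (hW : ∀ f ∈ polyP 3 n, mulVec f (whitneyFace lam a b c) ∈ W) {i j : ℕ} (h : i + j ≤ n) :
    fluxT i j (pick3 lam a b c) ∈ W :=
  hW _ (polyT_pick3_mem lam_mem_polyP h a b c)

theorem span_tetDiv {p : ℕ} (hp : 1 ≤ p) :
    Submodule.span ℝ (Set.range (tetDiv p)) = raviartThomas 3 p := by
  obtain ⟨n, rfl⟩ : ∃ n, p = n + 1 := ⟨p - 1, by omega⟩
  apply le_antisymm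
  · rw [Submodule.span_le]
    have hW : ∀ m : Fin 3, ∀ f ∈ polyP 3 n, mulVec f (whitneyFace lam m.castSucc
        (m.castSucc + 1) (m.castSucc + 2)) ∈ raviartThomas 3 (n + 1) := by
      intro m f hf
      fin_cases m
      · exact mulVec_whitneyFace_lam_mem hf (a := 0) (b := 1) (c := 2) (by decide) (by decide)
      · exact mulVec_whitneyFace_lam_mem hf (a := 1) (b := 2) (c := 3) (by decide) (by decide)
      · change mulVec f (whitneyFace lam 2 3 0) ∈ _
        rw [whitneyFace_rotate]
        exact mulVec_whitneyFace_lam_mem hf (by decide) (by decide)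
    rintro _ ⟨⟨f, q⟩ | ⟨m, q⟩, rfl⟩
    · exact fluxT_pick3_mem (fun g hg => mulVec_whitneyFace_lam_mem hg f.2.1 f.2.2)
        (mem_triIdx.mp q.2).2.2
    · obtain ⟨-, -, hk, hijk⟩ := mem_tetIdx.mp q.2
      refine mulVec_mem_of_forall (hW m) (jacobiL_hom_lam_mem _ hk _)
        (polyT_pick3_mem lam_mem_polyP le_rfl _ _ _) ?_
      rw [add_comm]
      exact hijk
  · refine raviartThomas_le_of_whitneyFace fun a b c hab hbc f hf => ?_
    refine mulVec_whitneyFace_mem_of_div (n := n) sum_lam (fun a b c hab hbc i j hij => ?_)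
      (fun a ha i j k hk hijk => ?_) a b c hab hbc f (by rwa [span_lam_pow]) <;>
      apply Submodule.subset_span
    · exact ⟨.inl (⟨(a, b, c), hab, hbc⟩,
        ⟨(i, j), mem_triIdx.mpr ⟨Nat.zero_le _, Nat.zero_le _, hij⟩⟩), rfl⟩
    · obtain ⟨m, rfl⟩ := exists_castSucc_eq ha
      exact ⟨.inr (m,
        ⟨(i, j, k), mem_tetIdx.mpr ⟨Nat.zero_le _, Nat.zero_le _, hk, hijk⟩⟩), rfl⟩

theorem tetDiv_isHierarchicalBasis :
    IsHierarchicalBasis (simplex 3) tetDiv (fun p => raviartThomas 3 p)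
      (fun p => p * (p + 1) * (p + 3) / 2) := by
  refine .of_span (fun p hp => span_tetDiv hp) (fun p _ F hF h => ?_) (fun p hp => ?_)
    (fun p hp => ?_) (fun p p' _ hpp' => ?_)
  · exact eq_zero_of_mem_compSpace_polyAll (raviartThomas_le_compSpace_polyAll _ hF)
      infinite_quarter_interval fun x hx => h x (box_subset_simplex_three hx)
  · obtain ⟨n, rfl⟩ : ∃ n, p = n + 1 := ⟨p - 1, by omega⟩
    rw [Nat.card_sum, Nat.card_prod, Nat.card_prod, card_faces_four]
    simp only [Nat.card_eq_fintype_card, Fintype.card_fin, Fintype.card_coe, card_triIdx,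
      card_tetIdx _ _ _ _ le_rfl, Nat.add_sub_cancel]
    rw [show n + 2 - 0 - 0 = n + 2 by omega, show n + 3 - 0 - 0 - 1 = n + 2 by omega]
    have h2 := two_mul_choose_two (n + 1)
    have h3 := six_mul_choose_three n
    refine (Nat.div_eq_of_eq_mul_left two_pos ?_).symm
    nlinarith
  · obtain ⟨n, rfl⟩ : ∃ n, p = n + 1 := ⟨p - 1, by omega⟩
    have h2 := two_mul_choose_two (n + 1)
    have h3 := six_mul_choose_three (n + 1)
    rw [finrank_raviartThomas n (0 : Fin 3), finrank_polyP_three, finrank_polyHom_three]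
    refine Nat.div_le_of_le_mul ?_
    nlinarith
  · have hn : p - 1 ≤ p' - 1 := Nat.sub_le_sub_right hpp' 1
    rintro _ ⟨⟨f, q⟩ | ⟨m, q⟩, rfl⟩
    · exact ⟨.inl (f, ⟨q.1, triIdx_mono hn q.2⟩), rfl⟩
    · exact ⟨.inr (m, ⟨q.1, tetIdx_mono hn q.2⟩), rfl⟩

theorem tetL2_apply {p : ℕ} (q : TetL2Idx p) : tetL2 p q = polyT q.1.1 q.1.2.1 (pick3 lam 0 1 2)
    * hom (jacobiP ((2 * (q.1.1 + q.1.2.1 + 1) : ℕ) : ℝ) q.1.2.2) (1 - lam 3) (lam 3) := by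
  have : dotF (cross3 (grad (lam 1)) (grad (lam 2))) (grad (lam 3)) = 1 := by
    rw [grad_lam_one, grad_lam_two, grad_lam_three]
    funext x
    simp [dotF, cross3, crossProduct, unitVec]
  rw [tetL2, this, mul_one]

theorem span_tetL2 (p : ℕ) : Submodule.span ℝ (Set.range (tetL2 p)) = polyP 3 (p - 1) := by
  apply le_antisymm
  · rw [Submodule.span_le]
    rintro _ ⟨q, rfl⟩
    rw [tetL2_apply]
    refine polyP_mono (mem_tetIdx.mp q.2).2.2.2 (polyP_mul_le _ _ (Submodule.mul_mem_mul
      (polyT_pick3_mem lam_mem_polyP le_rfl _ _ _) ?_))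
    rw [← polyP_one_pow]
    exact jacobiP_hom_mem (one_sub_lam_mem_polyP 3) (lam_mem_polyP 3) _ _
  · rw [← span_lam_pow]
    refine span_pow_le_of_L2 sum_lam fun i j k h => Submodule.subset_span
      ⟨⟨(i, j, k), mem_tetIdx.mpr ⟨Nat.zero_le _, Nat.zero_le _, Nat.zero_le _, h⟩⟩, ?_⟩
    rw [tetL2_apply]

theorem tetL2_isHierarchicalBasis :
    IsHierarchicalBasis (simplex 3) tetL2 (fun p => polyP 3 (p - 1))
      (fun p => p * (p + 1) * (p + 2) / 6) := by
  have hdim : ∀ n, (n + 1) * (n + 1 + 1) * (n + 1 + 2) / 6 = (n + 3).choose 3 := fun n => by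
    refine Nat.div_eq_of_eq_mul_right (by norm_num) ?_
    rw [six_mul_choose_three (n + 1)]
    ring
  refine .of_span (fun p hp => span_tetL2 p) (fun p _ F hF h => ?_) (fun p hp => ?_)
    (fun p hp => ?_) (fun p p' _ hpp' => ?_)
  · exact eq_zero_of_mem_polyAll (polyP_le_polyAll _ _ hF) infinite_quarter_interval
      fun x hx => h x (box_subset_simplex_three hx)
  · obtain ⟨n, rfl⟩ : ∃ n, p = n + 1 := ⟨p - 1, by omega⟩
    rw [hdim, Nat.card_eq_fintype_card, Fintype.card_coe, card_tetIdx _ _ _ _ zero_le_one]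
    rfl
  · obtain ⟨n, rfl⟩ : ∃ n, p = n + 1 := ⟨p - 1, by omega⟩
    rw [hdim, finrank_polyP_three]
    rfl
  · rintro _ ⟨q, rfl⟩
    exact ⟨⟨q.1, tetIdx_mono (Nat.sub_le_sub_right hpp' 1) q.2⟩, rfl⟩

/-! ### Prism -/

/-- A function of `(x, y)`, regarded as a function on the prism. -/
def pullT (f : Scal 2) : Scal 3 := fun x => f ![x 0, x 1]

/-- A function of `z`, regarded as a function on the prism. -/
def pullZ (g : Scal 1) : Scal 3 := fun x => g ![x 2]

/-- A planar vector function, regarded as a horizontal vector function on the prism. -/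
def pullV (F : Vec 2) : Vec 3 := fun x => ![F ![x 0, x 1] 0, F ![x 0, x 1] 1, 0]

/-- Horizontal vector functions on the prism. -/
def liftH : ((Fin 3 → ℝ) → (Fin 2 → ℝ)) →ₗ[ℝ] Vec 3 where
  toFun F := fun x => ![F x 0, F x 1, 0]
  map_add' F G := by
    funext x i
    fin_cases i <;> simp
  map_smul' c F := by
    funext x i
    fin_cases i <;> simp

/-- Vertical vector functions on the prism. -/
def liftV : Scal 3 →ₗ[ℝ] Vec 3 where
  toFun f := mulVec f (unitVec 2)
  map_add' f g := by
    funext x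
    simp [mulVec, add_smul]
  map_smul' c f := by
    funext x
    simp [mulVec, mul_smul]

theorem tensorMul_eq (g : Scal 1) (f : Scal 2) : tensorMul ℝ g f = pullZ g * pullT f := rfl

theorem liftH_tensorMul (g : Scal 1) (F : Vec 2) :
    liftH (tensorMul (Fin 2 → ℝ) g F) = mulVec (pullZ g) (pullV F) := by
  funext x i
  fin_cases i <;> simp [liftH, tensorMul_apply, mulVec, pullZ, pullV]

theorem mulVec_pullT_pullV (f : Scal 2) (F : Vec 2) :
    mulVec (pullT f) (pullV F) = pullV (mulVec f F) := by
  funext x i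
  fin_cases i <;> simp [mulVec, pullT, pullV]

theorem liftV_tensorMul (g : Scal 1) (f : Scal 2) :
    liftV (tensorMul ℝ g f) = mulVec (pullZ g * pullT f) (unitVec 2) := rfl

theorem prismProd_le {T : Submodule ℝ ((Fin 3 → ℝ) → (Fin 2 → ℝ))} {S : Submodule ℝ (Scal 3)}
    {U : Submodule ℝ (Vec 3)} (hT : T ≤ U.comap liftH) (hS : S ≤ U.comap liftV) :
    prismProd T S ≤ U := by
  rintro F ⟨h1, h2⟩
  have e : F = liftH (fun x => ![F x 0, F x 1]) + liftV fun x => F x 2 := by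
    funext x i
    fin_cases i <;> simp [liftH, liftV, mulVec, unitVec]
  rw [e]
  exact U.add_mem (hT h1) (hS h2)

theorem liftH_mem {T : Submodule ℝ ((Fin 3 → ℝ) → (Fin 2 → ℝ))} {S : Submodule ℝ (Scal 3)}
    {F : (Fin 3 → ℝ) → (Fin 2 → ℝ)} (hF : F ∈ T) : liftH F ∈ prismProd T S := by
  refine ⟨?_, S.zero_mem⟩
  convert hF using 1
  funext x i
  fin_cases i <;> rfl

theorem liftV_mem {T : Submodule ℝ ((Fin 3 → ℝ) → (Fin 2 → ℝ))} {S : Submodule ℝ (Scal 3)}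
    {f : Scal 3} (hf : f ∈ S) : liftV f ∈ prismProd T S := by
  refine ⟨?_, ?_⟩
  · convert T.zero_mem using 1
    funext x i
    fin_cases i <;> simp [liftV, mulVec, unitVec]
  · convert hf using 1
    funext x
    simp [liftV, mulVec, unitVec]

theorem nu_eq_pullT (a : Fin 3) : nu (N := 3) 0 1 a = pullT (nu 0 1 a) := by
  fin_cases a <;> rfl

theorem mu_eq_pullZ (c : Fin 2) : mu (2 : Fin 3) c = pullZ (mu 0 c) := by
  fin_cases c <;> rfl

theorem phiE_nu_eq_pullT (i : ℕ) (a b : Fin 3) :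
    phiE i (pick2 (nu (N := 3) 0 1) a b) = pullT (phiE i (pick2 (nu 0 1) a b)) := by
  change hom (legendreL i) (nu 0 1 a) (nu 0 1 b) = _
  rw [nu_eq_pullT, nu_eq_pullT]
  rfl

theorem phiT_nu_eq_pullT (i j : ℕ) : phiT i j (nu (N := 3) 0 1) = pullT (phiT i j (nu 0 1)) := rfl

theorem grad_nu_zero {N : ℕ} (k l : Fin N) : grad (nu k l 0) = -unitVec k - unitVec l := by
  have h := grad_sub ((differentiable_const (1 : ℝ)).sub (differentiable_coord k))
    (differentiable_coord l)
  have h' := grad_sub (differentiable_const (1 : ℝ)) (differentiable_coord k)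
  rw [grad_const, zero_sub] at h'
  rw [grad_coord] at h h'
  exact h.trans (by rw [← h']; rfl)

theorem grad_nu_eq_pullV (a : Fin 3) :
    grad (nu (N := 3) 0 1 a) = pullV (grad (nu 0 1 a)) := by
  fin_cases a
  · change grad (nu 0 1 0) = pullV (grad (nu 0 1 0))
    rw [grad_nu_zero, grad_nu_zero]
    funext x i
    fin_cases i <;> simp [pullV, unitVec]
  · change grad (fun x => x 0) = pullV (grad fun x => x 0)
    rw [grad_coord, grad_coord]
    funext x i
    fin_cases i <;> simp [pullV, unitVec]
  · change grad (fun x => x 1) = pullV (grad fun x => x 1)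
    rw [grad_coord, grad_coord]
    funext x i
    fin_cases i <;> simp [pullV, unitVec]

theorem fieldE_nu_eq_pullV (i : ℕ) (a b : Fin 3) :
    fieldE i (pick2 (nu (N := 3) 0 1) a b) = pullV (fieldE i (pick2 (nu 0 1) a b)) := by
  change mulVec (hom (legendreP i) (nu 0 1 a) (nu 0 1 b)) (mulVec (nu 0 1 a) (grad (nu 0 1 b))
    - mulVec (nu 0 1 b) (grad (nu 0 1 a))) = _
  rw [grad_nu_eq_pullV, grad_nu_eq_pullV, nu_eq_pullT, nu_eq_pullT, mulVec_pullT_pullV,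
    mulVec_pullT_pullV]
  funext x k
  fin_cases k <;> simp [pullV, mulVec, fieldE, pick2, hom, pullT]

/-- The vertex cycles of the two families of triangle functions. -/
noncomputable def triCycle (m : Fin 2) : Fin 3 → Scal 2 :=
  ![pick3 (nu 0 1) 0 1 2, pick3 (nu 0 1) 1 2 0] m

theorem fieldT_nu_eq_pullV (i j : ℕ) (a b c : Fin 3) :
    fieldT i j (pick3 (nu (N := 3) 0 1) a b c) = pullV (fieldT i j (pick3 (nu 0 1) a b c)) := by
  change mulVec (hom (jacobiL ((2 * i + 1 : ℕ) : ℝ) j) (nu 0 1 a + nu 0 1 b) (nu 0 1 c))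
    (fieldE i (pick2 (nu 0 1) a b)) = _
  rw [fieldE_nu_eq_pullV, nu_eq_pullT, nu_eq_pullT, nu_eq_pullT]
  exact mulVec_pullT_pullV (hom (jacobiL ((2 * i + 1 : ℕ) : ℝ) j) (nu 0 1 a + nu 0 1 b) (nu 0 1 c))
    (fieldE i (pick2 (nu 0 1) a b))

theorem priFieldT_eq_pullV (m : Fin 2) (i j : ℕ) :
    priFieldT m i j = pullV (fieldT i j (triCycle m)) := by
  fin_cases m
  · exact fieldT_nu_eq_pullV i j 0 1 2
  · exact fieldT_nu_eq_pullV i j 1 2 0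

theorem fieldE_mu_eq {q : ℕ} (k : Fin q) :
    fieldE k.1 (mu (2 : Fin 3)) = mulVec (pullZ (segL2 q k)) (unitVec 2) := by
  rw [fieldE_mu, segL2_apply]
  rfl

/-- The cross product of a horizontal field with the vertical unit vector is its planar rotation, so
the horizontal H(div) functions on the prism come from planar H(div). -/
theorem cross3_pullV_vertical (F : Vec 2) (g : Scal 1) :
    cross3 (pullV F) (mulVec (pullZ g) (unitVec 2)) = mulVec (pullZ g) (pullV (rot F)) := by
  funext x i
  fin_cases i <;> simp [cross3, crossProduct, pullV, mulVec, pullZ, unitVec, rot, mul_comm]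

/-- Since ν₀ + ν₁ + ν₂ = 1, the three terms of the face field add up to ∇ν₁ × ∇ν₂, the vertical unit
vector. -/
theorem fluxT_nu (i j : ℕ) :
    fluxT i j (nu 0 1) = mulVec (pullT (polyT i j (nu 0 1))) (unitVec 2) := by
  have h : mulVec (nu 0 1 0) (cross3 (grad (nu 0 1 1)) (grad (nu 0 1 2)))
      + mulVec (nu 0 1 1) (cross3 (grad (nu 0 1 2)) (grad (nu 0 1 0)))
      + mulVec (nu 0 1 2) (cross3 (grad (nu 0 1 0)) (grad (nu 0 1 1))) = (unitVec 2 : Vec 3) := by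
    have h1 : grad (nu (N := 3) 0 1 1) = unitVec 0 := grad_coord 0
    have h2 : grad (nu (N := 3) 0 1 2) = unitVec 1 := grad_coord 1
    rw [grad_nu_zero, h1, h2]
    funext x k
    fin_cases k <;> simp [mulVec, cross3, crossProduct, unitVec, nu]
    ring
  rw [fluxT, h]
  rfl

theorem box_subset_prism :
    Set.pi .univ (fun _ : Fin 3 => Set.Ioo (0 : ℝ) (1 / 4)) ⊆ prism := by
  intro x hx
  obtain ⟨h0, h0'⟩ := hx 0 trivial
  obtain ⟨h1, h1'⟩ := hx 1 trivial
  obtain ⟨h2, h2'⟩ := hx 2 trivial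
  exact ⟨h0, h1, by linarith, h2, by linarith⟩

theorem exists_eq_add_one_prod {P : ℕ × ℕ} (hP : 1 ≤ P) : ∃ m n, P = (m + 1, n + 1) :=
  ⟨P.1 - 1, P.2 - 1, Prod.ext (Nat.sub_add_cancel hP.1).symm (Nat.sub_add_cancel hP.2).symm⟩

theorem span_priH1 {P : ℕ × ℕ} (hP : 1 ≤ P) :
    Submodule.span ℝ (Set.range (priH1 P)) = tensorZ (polyP 2 P.1) P.2 := by
  -- The prism functions are exactly the products of triangle and segment functions; `e` and `e'`
  -- match the index sets in both directions.
  have e : ∀ i j, ∃ k, priH1 P k = tensorMul ℝ (segH1 P.2 j) (triH1 P.1 i) := by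
    simp only [tensorMul_eq]
    rintro (a | ⟨e, i⟩ | q) (c | k)
    · exact ⟨.inl (a, c), by rw [mul_comm]; exact congrArg₂ (· * ·) (nu_eq_pullT a) (mu_eq_pullZ c)⟩
    · exact ⟨.inr (.inr (.inl (a, k))), by rw [mul_comm]; exact congrArg₂ (· * ·) (nu_eq_pullT a) rfl⟩
    · exact ⟨.inr (.inl (c, e, i)), congrArg₂ (· * ·) (mu_eq_pullZ c) (phiE_nu_eq_pullT _ _ _)⟩
    · exact ⟨.inr (.inr (.inr (.inr (.inl (e, i, k))))), by
        rw [mul_comm]; exact congrArg₂ (· * ·) (phiE_nu_eq_pullT _ _ _) rfl⟩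
    · exact ⟨.inr (.inr (.inr (.inl (c, q)))), congrArg₂ (· * ·) (mu_eq_pullZ c) rfl⟩
    · exact ⟨.inr (.inr (.inr (.inr (.inr (q, k))))), mul_comm _ _⟩
  have e' : ∀ k, ∃ i j, priH1 P k = tensorMul ℝ (segH1 P.2 j) (triH1 P.1 i) := by
    simp only [tensorMul_eq]
    rintro (⟨a, c⟩ | ⟨c, e, i⟩ | ⟨a, k⟩ | ⟨c, q⟩ | ⟨e, i, k⟩ | ⟨q, k⟩)
    · exact ⟨.inl a, .inl c, by rw [mul_comm]; exact congrArg₂ (· * ·) (nu_eq_pullT a) (mu_eq_pullZ c)⟩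
    · exact ⟨.inr (.inl (e, i)), .inl c, congrArg₂ (· * ·) (mu_eq_pullZ c) (phiE_nu_eq_pullT _ _ _)⟩
    · exact ⟨.inl a, .inr k, by rw [mul_comm]; exact congrArg₂ (· * ·) (nu_eq_pullT a) rfl⟩
    · exact ⟨.inr (.inr q), .inl c, congrArg₂ (· * ·) (mu_eq_pullZ c) rfl⟩
    · exact ⟨.inr (.inl (e, i)), .inr k, by
        rw [mul_comm]; exact congrArg₂ (· * ·) (phiE_nu_eq_pullT _ _ _) rfl⟩
    · exact ⟨.inr (.inr q), .inr k, mul_comm _ _⟩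
  apply le_antisymm
  · rw [Submodule.span_le]
    rintro _ ⟨k, rfl⟩
    obtain ⟨i, j, h⟩ := e' k
    rw [h]
    exact tensorMul_mem (segH1_isHierarchicalBasis.mem _ hP.2 j)
      (triH1_isHierarchicalBasis.mem _ hP.1 i)
  · refine tensorZ_le (span_triH1 hP.1) (span_segH1 hP.2) fun i j => ?_
    obtain ⟨k, hk⟩ := e i j
    rw [← hk]
    exact Submodule.subset_span ⟨k, rfl⟩

theorem priH1_isHierarchicalBasis :
    IsHierarchicalBasis prism priH1 (fun P => tensorZ (polyP 2 P.1) P.2)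
      (fun P => (P.1 + 2) * (P.1 + 1) * (P.2 + 1) / 2) := by
  refine .of_span (fun P hP => span_priH1 hP) (fun P _ F hF h => ?_) (fun P hP => ?_)
    (fun P hP => ?_) (fun P P' _ hPP' => ?_)
  · exact eq_zero_of_mem_polyAll (tensorZ_le_polyAll (polyP_le_polyAll _ _) _ hF)
      infinite_quarter_interval fun x hx => h x (box_subset_prism hx)
  · obtain ⟨m, n, rfl⟩ := exists_eq_add_one_prod hP
    rw [Nat.card_sum, Nat.card_sum, Nat.card_sum, Nat.card_sum, Nat.card_sum, Nat.card_prod,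
      Nat.card_prod, Nat.card_prod, Nat.card_prod, Nat.card_prod, Nat.card_prod, Nat.card_prod,
      Nat.card_prod, card_edges_three]
    simp only [Nat.card_eq_fintype_card, Fintype.card_fin, Fintype.card_coe, card_triIdx,
      Nat.card_Icc]
    rw [show m + 1 + 2 - 2 - 1 = m by omega, show m + 1 + 1 - 2 = m by omega,
      show n + 1 + 1 - 2 = n by omega]
    have h2 := two_mul_choose_two (m + 2)
    have h3 : (m + 2 + 1).choose 2 = m.choose 2 + 3 * m + 3 := by
      simp [Nat.choose_succ_succ']
      ring
    refine (Nat.div_eq_of_eq_mul_left two_pos ?_).symm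
    nlinarith
  · have h := finrank_mul_le_finrank_tensorZ (polyP 2 P.1) P.2
    have h2 := two_mul_choose_two (P.1 + 1)
    rw [finrank_polyP_two] at h
    refine Nat.div_le_of_le_mul ?_
    nlinarith
  · rintro _ ⟨⟨a, c⟩ | ⟨c, e, i⟩ | ⟨a, k⟩ | ⟨c, q⟩ | ⟨e, i, k⟩ | ⟨q, k⟩, rfl⟩
    · exact ⟨.inl (a, c), rfl⟩
    · exact ⟨.inr (.inl (c, e, ⟨i.1, Icc_two_mono hPP'.1 i.2⟩)), rfl⟩
    · exact ⟨.inr (.inr (.inl (a, ⟨k.1, Icc_two_mono hPP'.2 k.2⟩))), rfl⟩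
    · exact ⟨.inr (.inr (.inr (.inl (c, ⟨q.1, triIdx_mono hPP'.1 q.2⟩)))), rfl⟩
    · exact ⟨.inr (.inr (.inr (.inr (.inl (e, ⟨i.1, Icc_two_mono hPP'.1 i.2⟩,
        ⟨k.1, Icc_two_mono hPP'.2 k.2⟩))))), rfl⟩
    · exact ⟨.inr (.inr (.inr (.inr (.inr (⟨q.1, triIdx_mono hPP'.1 q.2⟩,
        ⟨k.1, Icc_two_mono hPP'.2 k.2⟩))))), rfl⟩

theorem exists_triCurl_eq {p : ℕ} (m : Fin 2) (q : triIdx 0 1 (p - 1)) :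
    ∃ i, triCurl p i = fieldT q.1.1 q.1.2 (triCycle m) := by
  fin_cases m
  · exact ⟨.inr (.inl q), rfl⟩
  · exact ⟨.inr (.inr q), rfl⟩

/-- Horizontal functions are triangle H(curl) times segment H¹, vertical ones triangle H¹ times
segment L²; each of the seven families belongs to one of these tensor products. -/
theorem span_priCurl {P : ℕ × ℕ} (hP : 1 ≤ P) : Submodule.span ℝ (Set.range (priCurl P))
    = prismProd (tensorZ (nedelec 2 P.1) P.2) (tensorZ (polyP 2 P.1) (P.2 - 1)) := by
  have e1 : ∀ c e i, priCurl P (.inl (c, e, i))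
      = liftH (tensorMul (Fin 2 → ℝ) (segH1 P.2 (.inl c)) (triCurl P.1 (.inl (e, i)))) := by
    intro c e i
    rw [liftH_tensorMul]
    exact congrArg₂ mulVec (mu_eq_pullZ c) (fieldE_nu_eq_pullV _ _ _)
  have e2 : ∀ a i, priCurl P (.inr (.inl (a, i)))
      = liftV (tensorMul ℝ (segL2 P.2 i) (triH1 P.1 (.inl a))) := by
    intro a i
    change mulVec (nu 0 1 a) (fieldE i.1 (mu 2)) = _
    rw [liftV_tensorMul, fieldE_mu_eq, mulVec_mulVec, mul_comm, nu_eq_pullT]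
    rfl
  have e3 : ∀ c m q, priCurl P (.inr (.inr (.inl (c, m, q))))
      = mulVec (pullZ (segH1 P.2 (.inl c))) (pullV (fieldT q.1.1 q.1.2 (triCycle m))) :=
    fun c m q => congrArg₂ mulVec (mu_eq_pullZ c) (priFieldT_eq_pullV _ _ _)
  have e4 : ∀ e i j, priCurl P (.inr (.inr (.inr (.inl (e, i, j)))))
      = liftH (tensorMul (Fin 2 → ℝ) (segH1 P.2 (.inr j)) (triCurl P.1 (.inl (e, i)))) := by
    intro e i j
    rw [liftH_tensorMul]
    exact congrArg₂ mulVec rfl (fieldE_nu_eq_pullV _ _ _)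
  have e5 : ∀ e i j, priCurl P (.inr (.inr (.inr (.inr (.inl (e, i, j))))))
      = liftV (tensorMul ℝ (segL2 P.2 i) (triH1 P.1 (.inr (.inl (e, j))))) := by
    intro e i j
    change mulVec (phiE j.1 (pick2 (nu 0 1) e.1.1 e.1.2)) (fieldE i.1 (mu 2)) = _
    rw [liftV_tensorMul, fieldE_mu_eq, mulVec_mulVec, mul_comm, phiE_nu_eq_pullT]
    rfl
  have e6 : ∀ m q k, priCurl P (.inr (.inr (.inr (.inr (.inr (.inl (m, q, k)))))))
      = mulVec (pullZ (segH1 P.2 (.inr k))) (pullV (fieldT q.1.1 q.1.2 (triCycle m))) :=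
    fun m q k => congrArg₂ mulVec rfl (priFieldT_eq_pullV _ _ _)
  have e7 : ∀ q k, priCurl P (.inr (.inr (.inr (.inr (.inr (.inr (q, k)))))))
      = liftV (tensorMul ℝ (segL2 P.2 k) (triH1 P.1 (.inr (.inr q)))) := by
    intro q k
    change mulVec (phiT q.1.1 q.1.2 (nu 0 1)) (fieldE k.1 (mu 2)) = _
    rw [liftV_tensorMul, fieldE_mu_eq, mulVec_mulVec, mul_comm, phiT_nu_eq_pullT]
    rfl
  apply le_antisymm
  · rw [Submodule.span_le]
    have kH : ∀ i j, liftH (tensorMul (Fin 2 → ℝ) (segH1 P.2 j) (triCurl P.1 i)) ∈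
        prismProd (tensorZ (nedelec 2 P.1) P.2) (tensorZ (polyP 2 P.1) (P.2 - 1)) :=
      fun i j => liftH_mem (tensorMul_mem (segH1_isHierarchicalBasis.mem _ hP.2 j)
        (triCurl_isHierarchicalBasis.mem _ hP.1 i))
    have kV : ∀ i j, liftV (tensorMul ℝ (segL2 P.2 j) (triH1 P.1 i)) ∈
        prismProd (tensorZ (nedelec 2 P.1) P.2) (tensorZ (polyP 2 P.1) (P.2 - 1)) :=
      fun i j => liftV_mem (tensorMul_mem (segL2_isHierarchicalBasis.mem _ hP.2 j)
        (triH1_isHierarchicalBasis.mem _ hP.1 i))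
    rintro _ ⟨⟨c, e, i⟩ | ⟨a, i⟩ | ⟨c, m, q⟩ | ⟨e, i, j⟩ | ⟨e, i, j⟩ | ⟨m, q, k⟩ | ⟨q, k⟩, rfl⟩
    · rw [e1]
      exact kH _ _
    · rw [e2]
      exact kV _ _
    · obtain ⟨i, hi⟩ := exists_triCurl_eq m q
      rw [e3, ← hi, ← liftH_tensorMul]
      exact kH _ _
    · rw [e4]
      exact kH _ _
    · rw [e5]
      exact kV _ _
    · obtain ⟨i, hi⟩ := exists_triCurl_eq m q
      rw [e6, ← hi, ← liftH_tensorMul]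
      exact kH _ _
    · rw [e7]
      exact kV _ _
  · refine prismProd_le (tensorZ_le (span_triCurl hP.1) (span_segH1 hP.2) fun i j => ?_)
      (tensorZ_le (span_triH1 hP.1) (span_segL2 hP.2) fun i j => ?_)
    · apply Submodule.subset_span
      rcases i with ⟨e, i⟩ | q | q <;> rcases j with c | k
      · exact ⟨_, e1 c e i⟩
      · exact ⟨_, e4 e i k⟩
      · exact ⟨_, (e3 c 0 q).trans (liftH_tensorMul _ _).symm⟩
      · exact ⟨_, (e6 0 q k).trans (liftH_tensorMul _ _).symm⟩
      · exact ⟨_, (e3 c 1 q).trans (liftH_tensorMul _ _).symm⟩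
      · exact ⟨_, (e6 1 q k).trans (liftH_tensorMul _ _).symm⟩
    · apply Submodule.subset_span
      rcases i with a | ⟨e, i⟩ | q
      · exact ⟨_, e2 a j⟩
      · exact ⟨_, e5 e j i⟩
      · exact ⟨_, e7 q j⟩

theorem priCurl_isHierarchicalBasis :
    IsHierarchicalBasis prism priCurl
      (fun P => prismProd (tensorZ (nedelec 2 P.1) P.2) (tensorZ (polyP 2 P.1) (P.2 - 1)))
      (fun P => P.1 * (P.1 + 2) * (P.2 + 1) + (P.1 + 2) * (P.1 + 1) * P.2 / 2) := by
  refine .of_span (fun P hP => span_priCurl hP) (fun P _ F hF h => ?_) (fun P hP => ?_)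
    (fun P hP => ?_) (fun P P' _ hPP' => ?_)
  · exact eq_zero_of_mem_compSpace_polyAll (prismProd_le_compSpace_polyAll
      (nedelec_le_compSpace_polyAll _) (polyP_le_polyAll _ _) _ _ hF)
      infinite_quarter_interval fun x hx => h x (box_subset_prism hx)
  · obtain ⟨m, n, rfl⟩ := exists_eq_add_one_prod hP
    rw [Nat.card_sum, Nat.card_sum, Nat.card_sum, Nat.card_sum, Nat.card_sum, Nat.card_sum]
    simp only [Nat.card_prod, card_edges_three]
    simp only [Nat.card_eq_fintype_card, Fintype.card_fin, Fintype.card_coe, card_triIdx,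
      Nat.card_Icc]
    rw [show m + 1 + 2 - 2 - 1 = m by omega, show m + 1 + 1 - 2 = m by omega,
      show n + 1 + 1 - 2 = n by omega, show m + 1 - 1 + 2 - 0 - 1 = m + 1 by omega]
    have h2 := two_mul_choose_two (m + 2)
    have h3 : (m + 2 + 1).choose 2 = m.choose 2 + 3 * m + 3 := by
      simp [Nat.choose_succ_succ']
      ring
    have h4 := two_mul_choose_two m
    -- The product is even, so the natural-number division is exact.
    have h5 : (m + 1 + 2) * (m + 1 + 1) * (n + 1) / 2 = (m + 2 + 1).choose 2 * (n + 1) := by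
      refine Nat.div_eq_of_eq_mul_left two_pos ?_
      nlinarith
    rw [h5, h3]
    nlinarith
  · have h := finrank_mul_le_finrank_tensorZ (nedelec 2 P.1) P.2
    have h' := finrank_mul_le_finrank_tensorZ (polyP 2 P.1) (P.2 - 1)
    have h2 := two_mul_choose_two (P.1 + 1)
    have h3 : P.2 - 1 + 1 = P.2 := Nat.sub_add_cancel hP.2
    rw [finrank_polyP_two, h3] at h'
    rw [triCurl_isHierarchicalBasis.finrank_eq _ hP.1] at h
    rw [finrank_prismProd]
    refine add_le_add h (le_trans (Nat.div_le_of_le_mul ?_) h')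
    nlinarith
  · have hn : P.1 - 1 ≤ P'.1 - 1 := Nat.sub_le_sub_right hPP'.1 1
    rintro _ ⟨⟨c, e, i⟩ | ⟨a, i⟩ | ⟨c, m, q⟩ | ⟨e, i, j⟩ | ⟨e, i, j⟩ | ⟨m, q, k⟩ | ⟨q, k⟩, rfl⟩
    · exact ⟨.inl (c, e, ⟨i.1, i.2.trans_le hPP'.1⟩), rfl⟩
    · exact ⟨.inr (.inl (a, ⟨i.1, i.2.trans_le hPP'.2⟩)), rfl⟩
    · exact ⟨.inr (.inr (.inl (c, m, ⟨q.1, triIdx_mono hn q.2⟩))), rfl⟩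
    · exact ⟨.inr (.inr (.inr (.inl (e, ⟨i.1, i.2.trans_le hPP'.1⟩,
        ⟨j.1, Icc_two_mono hPP'.2 j.2⟩)))), rfl⟩
    · exact ⟨.inr (.inr (.inr (.inr (.inl (e, ⟨i.1, i.2.trans_le hPP'.2⟩,
        ⟨j.1, Icc_two_mono hPP'.1 j.2⟩))))), rfl⟩
    · exact ⟨.inr (.inr (.inr (.inr (.inr (.inl (m, ⟨q.1, triIdx_mono hn q.2⟩,
        ⟨k.1, Icc_two_mono hPP'.2 k.2⟩)))))), rfl⟩
    · exact ⟨.inr (.inr (.inr (.inr (.inr (.inr (⟨q.1, triIdx_mono hPP'.1 q.2⟩,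
        ⟨k.1, k.2.trans_le hPP'.2⟩)))))), rfl⟩

theorem span_triDiv {p : ℕ} (hp : 1 ≤ p) :
    Submodule.span ℝ (Set.range (triDiv p)) = raviartThomas 2 p :=
  triDiv_isHierarchicalBasis.span_eq p hp

/-- Horizontal functions are triangle H(div) times segment L², vertical ones triangle L² times
segment H¹. -/
theorem span_priDiv {P : ℕ × ℕ} (hP : 1 ≤ P) : Submodule.span ℝ (Set.range (priDiv P))
    = prismProd (tensorZ (raviartThomas 2 P.1) (P.2 - 1)) (tensorZ (polyP 2 (P.1 - 1)) P.2) := by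
  have e1 : ∀ c q, priDiv P (.inl (c, q))
      = liftV (tensorMul ℝ (segH1 P.2 (.inl c)) (triL2 P.1 q)) := by
    intro c q
    change mulVec (mu 2 c) (fluxT q.1.1 q.1.2 (nu 0 1)) = _
    rw [liftV_tensorMul, fluxT_nu, mulVec_mulVec, triL2_apply, mu_eq_pullZ]
    rfl
  have e2 : ∀ e i j, priDiv P (.inr (.inl (e, i, j)))
      = liftH (tensorMul (Fin 2 → ℝ) (segL2 P.2 j) (triDiv P.1 (.inl (e, i)))) := by
    intro e i j
    change cross3 (fieldE i.1 (pick2 (nu 0 1) e.1.1 e.1.2)) (fieldE j.1 (mu 2)) = _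
    rw [fieldE_nu_eq_pullV, fieldE_mu_eq, cross3_pullV_vertical, liftH_tensorMul]
    rfl
  have e3 : ∀ m q k, priDiv P (.inr (.inr (.inl (m, q, k))))
      = mulVec (pullZ (segL2 P.2 k)) (pullV (rot (fieldT q.1.1 q.1.2 (triCycle m)))) := by
    intro m q k
    change cross3 (priFieldT m q.1.1 q.1.2) (fieldE k.1 (mu 2)) = _
    rw [priFieldT_eq_pullV, fieldE_mu_eq, cross3_pullV_vertical]
  have e4 : ∀ q k, priDiv P (.inr (.inr (.inr (q, k))))
      = liftV (tensorMul ℝ (segH1 P.2 (.inr k)) (triL2 P.1 q)) := by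
    intro q k
    change mulVec (phiE k.1 (mu 2)) (fluxT q.1.1 q.1.2 (nu 0 1)) = _
    rw [liftV_tensorMul, fluxT_nu, mulVec_mulVec, triL2_apply]
    rfl
  apply le_antisymm
  · rw [Submodule.span_le]
    have kH : ∀ i j, liftH (tensorMul (Fin 2 → ℝ) (segL2 P.2 j) (triDiv P.1 i)) ∈ prismProd
        (tensorZ (raviartThomas 2 P.1) (P.2 - 1)) (tensorZ (polyP 2 (P.1 - 1)) P.2) :=
      fun i j => liftH_mem (tensorMul_mem (segL2_isHierarchicalBasis.mem _ hP.2 j)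
        (triDiv_isHierarchicalBasis.mem _ hP.1 i))
    have kV : ∀ i j, liftV (tensorMul ℝ (segH1 P.2 j) (triL2 P.1 i)) ∈ prismProd
        (tensorZ (raviartThomas 2 P.1) (P.2 - 1)) (tensorZ (polyP 2 (P.1 - 1)) P.2) :=
      fun i j => liftV_mem (tensorMul_mem (segH1_isHierarchicalBasis.mem _ hP.2 j)
        (triL2_isHierarchicalBasis.mem _ hP.1 i))
    rintro _ ⟨⟨c, q⟩ | ⟨e, i, j⟩ | ⟨m, q, k⟩ | ⟨q, k⟩, rfl⟩
    · rw [e1]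
      exact kV _ _
    · rw [e2]
      exact kH _ _
    · obtain ⟨i, hi⟩ := exists_triCurl_eq m q
      rw [e3, ← hi, ← liftH_tensorMul]
      exact kH i _
    · rw [e4]
      exact kV _ _
  · refine prismProd_le (tensorZ_le (span_triDiv hP.1) (span_segL2 hP.2) fun i j => ?_)
      (tensorZ_le (span_triL2 P.1) (span_segH1 hP.2) fun i j => ?_)
    · apply Submodule.subset_span
      rcases i with ⟨e, i⟩ | q | q
      · exact ⟨_, e2 e i j⟩
      · exact ⟨_, (e3 0 q j).trans (liftH_tensorMul _ _).symm⟩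
      · exact ⟨_, (e3 1 q j).trans (liftH_tensorMul _ _).symm⟩
    · apply Submodule.subset_span
      rcases j with c | k
      · exact ⟨_, e1 c i⟩
      · exact ⟨_, e4 i k⟩

theorem priDiv_isHierarchicalBasis :
    IsHierarchicalBasis prism priDiv
      (fun P => prismProd (tensorZ (raviartThomas 2 P.1) (P.2 - 1))
        (tensorZ (polyP 2 (P.1 - 1)) P.2))
      (fun P => P.1 * (P.1 + 2) * P.2 + P.1 * (P.1 + 1) * (P.2 + 1) / 2) := by
  refine .of_span (fun P hP => span_priDiv hP) (fun P _ F hF h => ?_) (fun P hP => ?_)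
    (fun P hP => ?_) (fun P P' _ hPP' => ?_)
  · exact eq_zero_of_mem_compSpace_polyAll (prismProd_le_compSpace_polyAll
      (raviartThomas_le_compSpace_polyAll _) (polyP_le_polyAll _ _) _ _ hF)
      infinite_quarter_interval fun x hx => h x (box_subset_prism hx)
  · obtain ⟨m, n, rfl⟩ := exists_eq_add_one_prod hP
    rw [Nat.card_sum, Nat.card_sum, Nat.card_sum]
    simp only [Nat.card_prod, card_edges_three]
    simp only [Nat.card_eq_fintype_card, Fintype.card_fin, Fintype.card_coe, card_triIdx,
      Nat.card_Icc]
    rw [show m + 1 - 1 + 2 - 0 - 0 = m + 2 by omega, show n + 1 + 1 - 2 = n by omega,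
      show m + 1 - 1 + 2 - 0 - 1 = m + 1 by omega]
    have h2 := two_mul_choose_two (m + 1)
    have h4 := two_mul_choose_two m
    have h5 : (m + 1) * (m + 1 + 1) * (n + 1 + 1) / 2 = (m + 2).choose 2 * (n + 2) := by
      refine Nat.div_eq_of_eq_mul_left two_pos ?_
      nlinarith
    rw [h5]
    nlinarith
  · have h := finrank_mul_le_finrank_tensorZ (raviartThomas 2 P.1) (P.2 - 1)
    have h' := finrank_mul_le_finrank_tensorZ (polyP 2 (P.1 - 1)) P.2
    have h2 := two_mul_choose_two (P.1 - 1 + 1)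
    have h3 : P.2 - 1 + 1 = P.2 := Nat.sub_add_cancel hP.2
    have h4 : P.1 - 1 + 1 = P.1 := Nat.sub_add_cancel hP.1
    rw [h3, triDiv_isHierarchicalBasis.finrank_eq _ hP.1] at h
    rw [finrank_polyP_two, show P.1 - 1 + 2 = P.1 + 1 by omega] at h'
    rw [h4] at h2
    rw [finrank_prismProd]
    refine add_le_add h (le_trans (Nat.div_le_of_le_mul ?_) h')
    nlinarith
  · have hn : P.1 - 1 ≤ P'.1 - 1 := Nat.sub_le_sub_right hPP'.1 1
    rintro _ ⟨⟨c, q⟩ | ⟨e, i, j⟩ | ⟨m, q, k⟩ | ⟨q, k⟩, rfl⟩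
    · exact ⟨.inl (c, ⟨q.1, triIdx_mono hn q.2⟩), rfl⟩
    · exact ⟨.inr (.inl (e, ⟨i.1, i.2.trans_le hPP'.1⟩, ⟨j.1, j.2.trans_le hPP'.2⟩)), rfl⟩
    · exact ⟨.inr (.inr (.inl (m, ⟨q.1, triIdx_mono hn q.2⟩, ⟨k.1, k.2.trans_le hPP'.2⟩))), rfl⟩
    · exact ⟨.inr (.inr (.inr (⟨q.1, triIdx_mono hn q.2⟩, ⟨k.1, Icc_two_mono hPP'.2 k.2⟩))), rfl⟩

theorem priL2_apply {P : ℕ × ℕ} (q : triIdx 0 0 (P.1 - 1)) (k : Fin P.2) :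
    priL2 P (q, k) = tensorMul ℝ (segL2 P.2 k) (triL2 P.1 q) := by
  have h : dotF (cross3 (grad (nu 0 1 1)) (grad (nu 0 1 2))) (grad (mu (2 : Fin 3) 1)) = 1 := by
    have h1 : grad (nu (N := 3) 0 1 1) = unitVec 0 := grad_coord 0
    have h2 : grad (nu (N := 3) 0 1 2) = unitVec 1 := grad_coord 1
    rw [h1, h2, grad_mu_one]
    funext x
    simp [dotF, cross3, crossProduct, unitVec]
  rw [priL2, h, mul_one, segL2_apply, triL2_apply, mul_comm, tensorMul_eq]
  rfl

theorem span_priL2 {P : ℕ × ℕ} (hP : 1 ≤ P) :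
    Submodule.span ℝ (Set.range (priL2 P)) = tensorZ (polyP 2 (P.1 - 1)) (P.2 - 1) := by
  apply le_antisymm
  · rw [Submodule.span_le]
    rintro _ ⟨⟨q, k⟩, rfl⟩
    rw [priL2_apply]
    exact tensorMul_mem (segL2_isHierarchicalBasis.mem _ hP.2 k)
      (triL2_isHierarchicalBasis.mem _ hP.1 q)
  · refine tensorZ_le (span_triL2 P.1) (span_segL2 hP.2) fun q k => ?_
    rw [← priL2_apply]
    exact Submodule.subset_span ⟨(q, k), rfl⟩

theorem priL2_isHierarchicalBasis :
    IsHierarchicalBasis prism priL2 (fun P => tensorZ (polyP 2 (P.1 - 1)) (P.2 - 1))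
      (fun P => P.1 * (P.1 + 1) * P.2 / 2) := by
  refine .of_span (fun P hP => span_priL2 hP) (fun P _ F hF h => ?_) (fun P hP => ?_)
    (fun P hP => ?_) (fun P P' _ hPP' => ?_)
  · exact eq_zero_of_mem_polyAll (tensorZ_le_polyAll (polyP_le_polyAll _ _) _ hF)
      infinite_quarter_interval fun x hx => h x (box_subset_prism hx)
  · obtain ⟨m, n, rfl⟩ := exists_eq_add_one_prod hP
    rw [Nat.card_prod]
    simp only [Nat.card_eq_fintype_card, Fintype.card_fin, Fintype.card_coe, card_triIdx]
    rw [show m + 1 - 1 + 2 - 0 - 0 = m + 2 by omega]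
    have h2 := two_mul_choose_two (m + 1)
    refine (Nat.div_eq_of_eq_mul_left two_pos ?_).symm
    nlinarith
  · obtain ⟨m, n, rfl⟩ := exists_eq_add_one_prod hP
    have h := finrank_mul_le_finrank_tensorZ (polyP 2 m) n
    have h2 := two_mul_choose_two (m + 1)
    rw [finrank_polyP_two] at h
    refine (Nat.div_le_of_le_mul ?_).trans h
    nlinarith
  · rintro _ ⟨⟨q, k⟩, rfl⟩
    exact ⟨(⟨q.1, triIdx_mono (Nat.sub_le_sub_right hPP'.1 1) q.2⟩, ⟨k.1, k.2.trans_le hPP'.2⟩),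
      rfl⟩

end ShapeFunctions

theorem mainTheorem2 :
    -- Segment
    (ShapeFunctions.IsHierarchicalBasis (ShapeFunctions.cube 1) ShapeFunctions.segH1
        (fun p => ShapeFunctions.polyP 1 p) (fun p => p + 1) ∧
      ShapeFunctions.IsHierarchicalBasis (ShapeFunctions.cube 1) ShapeFunctions.segL2
        (fun p => ShapeFunctions.polyP 1 (p - 1)) (fun p => p)) ∧
    -- Quadrilateral
    (ShapeFunctions.IsHierarchicalBasis (ShapeFunctions.cube 2) ShapeFunctions.quadH1
        (fun P => ShapeFunctions.polyQ P) (fun P => (P 0 + 1) * (P 1 + 1)) ∧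
      ShapeFunctions.IsHierarchicalBasis (ShapeFunctions.cube 2) ShapeFunctions.quadCurl
        (fun P => ShapeFunctions.compSpace
          ![ShapeFunctions.polyQ ![P 0 - 1, P 1], ShapeFunctions.polyQ ![P 0, P 1 - 1]])
        (fun P => P 0 * (P 1 + 1) + (P 0 + 1) * P 1) ∧
      ShapeFunctions.IsHierarchicalBasis (ShapeFunctions.cube 2) ShapeFunctions.quadDiv
        (fun P => ShapeFunctions.compSpace
          ![ShapeFunctions.polyQ ![P 0, P 1 - 1], ShapeFunctions.polyQ ![P 0 - 1, P 1]])
        (fun P => (P 0 + 1) * P 1 + P 0 * (P 1 + 1)) ∧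
      ShapeFunctions.IsHierarchicalBasis (ShapeFunctions.cube 2) ShapeFunctions.quadL2
        (fun P => ShapeFunctions.polyQ ![P 0 - 1, P 1 - 1]) (fun P => P 0 * P 1)) ∧
    -- Triangle
    (ShapeFunctions.IsHierarchicalBasis (ShapeFunctions.simplex 2) ShapeFunctions.triH1
        (fun p => ShapeFunctions.polyP 2 p) (fun p => (p + 2) * (p + 1) / 2) ∧
      ShapeFunctions.IsHierarchicalBasis (ShapeFunctions.simplex 2) ShapeFunctions.triCurl
        (fun p => ShapeFunctions.nedelec 2 p) (fun p => p * (p + 2)) ∧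
      ShapeFunctions.IsHierarchicalBasis (ShapeFunctions.simplex 2) ShapeFunctions.triDiv
        (fun p => ShapeFunctions.raviartThomas 2 p) (fun p => p * (p + 2)) ∧
      ShapeFunctions.IsHierarchicalBasis (ShapeFunctions.simplex 2) ShapeFunctions.triL2
        (fun p => ShapeFunctions.polyP 2 (p - 1)) (fun p => p * (p + 1) / 2)) ∧
    -- Hexahedron
    (ShapeFunctions.IsHierarchicalBasis (ShapeFunctions.cube 3) ShapeFunctions.hexH1
        (fun P => ShapeFunctions.polyQ P) (fun P => (P 0 + 1) * (P 1 + 1) * (P 2 + 1)) ∧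
      ShapeFunctions.IsHierarchicalBasis (ShapeFunctions.cube 3) ShapeFunctions.hexCurl
        (fun P => ShapeFunctions.compSpace
          ![ShapeFunctions.polyQ ![P 0 - 1, P 1, P 2], ShapeFunctions.polyQ ![P 0, P 1 - 1, P 2],
            ShapeFunctions.polyQ ![P 0, P 1, P 2 - 1]])
        (fun P => P 0 * (P 1 + 1) * (P 2 + 1) + (P 0 + 1) * P 1 * (P 2 + 1)
          + (P 0 + 1) * (P 1 + 1) * P 2) ∧
      ShapeFunctions.IsHierarchicalBasis (ShapeFunctions.cube 3) ShapeFunctions.hexDiv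
        (fun P => ShapeFunctions.compSpace
          ![ShapeFunctions.polyQ ![P 0, P 1 - 1, P 2 - 1],
            ShapeFunctions.polyQ ![P 0 - 1, P 1, P 2 - 1],
            ShapeFunctions.polyQ ![P 0 - 1, P 1 - 1, P 2]])
        (fun P => (P 0 + 1) * P 1 * P 2 + P 0 * (P 1 + 1) * P 2 + P 0 * P 1 * (P 2 + 1)) ∧
      ShapeFunctions.IsHierarchicalBasis (ShapeFunctions.cube 3) ShapeFunctions.hexL2
        (fun P => ShapeFunctions.polyQ ![P 0 - 1, P 1 - 1, P 2 - 1])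
        (fun P => P 0 * P 1 * P 2)) ∧
    -- Tetrahedron
    (ShapeFunctions.IsHierarchicalBasis (ShapeFunctions.simplex 3) ShapeFunctions.tetH1
        (fun p => ShapeFunctions.polyP 3 p) (fun p => (p + 3) * (p + 2) * (p + 1) / 6) ∧
      ShapeFunctions.IsHierarchicalBasis (ShapeFunctions.simplex 3) ShapeFunctions.tetCurl
        (fun p => ShapeFunctions.nedelec 3 p) (fun p => p * (p + 2) * (p + 3) / 2) ∧
      ShapeFunctions.IsHierarchicalBasis (ShapeFunctions.simplex 3) ShapeFunctions.tetDiv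
        (fun p => ShapeFunctions.raviartThomas 3 p) (fun p => p * (p + 1) * (p + 3) / 2) ∧
      ShapeFunctions.IsHierarchicalBasis (ShapeFunctions.simplex 3) ShapeFunctions.tetL2
        (fun p => ShapeFunctions.polyP 3 (p - 1)) (fun p => p * (p + 1) * (p + 2) / 6)) ∧
    -- Prism
    (ShapeFunctions.IsHierarchicalBasis ShapeFunctions.prism ShapeFunctions.priH1
        (fun P => ShapeFunctions.tensorZ (ShapeFunctions.polyP 2 P.1) P.2)
        (fun P => (P.1 + 2) * (P.1 + 1) * (P.2 + 1) / 2) ∧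
      ShapeFunctions.IsHierarchicalBasis ShapeFunctions.prism ShapeFunctions.priCurl
        (fun P => ShapeFunctions.prismProd
          (ShapeFunctions.tensorZ (ShapeFunctions.nedelec 2 P.1) P.2)
          (ShapeFunctions.tensorZ (ShapeFunctions.polyP 2 P.1) (P.2 - 1)))
        (fun P => P.1 * (P.1 + 2) * (P.2 + 1) + (P.1 + 2) * (P.1 + 1) * P.2 / 2) ∧
      ShapeFunctions.IsHierarchicalBasis ShapeFunctions.prism ShapeFunctions.priDiv
        (fun P => ShapeFunctions.prismProd
          (ShapeFunctions.tensorZ (ShapeFunctions.raviartThomas 2 P.1) (P.2 - 1))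
          (ShapeFunctions.tensorZ (ShapeFunctions.polyP 2 (P.1 - 1)) P.2))
        (fun P => P.1 * (P.1 + 2) * P.2 + P.1 * (P.1 + 1) * (P.2 + 1) / 2) ∧
      ShapeFunctions.IsHierarchicalBasis ShapeFunctions.prism ShapeFunctions.priL2
        (fun P => ShapeFunctions.tensorZ (ShapeFunctions.polyP 2 (P.1 - 1)) (P.2 - 1))
        (fun P => P.1 * (P.1 + 1) * P.2 / 2)) :=
  ⟨⟨ShapeFunctions.segH1_isHierarchicalBasis, ShapeFunctions.segL2_isHierarchicalBasis⟩,
    ⟨ShapeFunctions.quadH1_isHierarchicalBasis, ShapeFunctions.quadCurl_isHierarchicalBasis,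
      ShapeFunctions.quadDiv_isHierarchicalBasis, ShapeFunctions.quadL2_isHierarchicalBasis⟩,
    ⟨ShapeFunctions.triH1_isHierarchicalBasis, ShapeFunctions.triCurl_isHierarchicalBasis,
      ShapeFunctions.triDiv_isHierarchicalBasis, ShapeFunctions.triL2_isHierarchicalBasis⟩,
    ⟨ShapeFunctions.hexH1_isHierarchicalBasis, ShapeFunctions.hexCurl_isHierarchicalBasis,
      ShapeFunctions.hexDiv_isHierarchicalBasis, ShapeFunctions.hexL2_isHierarchicalBasis⟩,
    ⟨ShapeFunctions.tetH1_isHierarchicalBasis, ShapeFunctions.tetCurl_isHierarchicalBasis,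
      ShapeFunctions.tetDiv_isHierarchicalBasis, ShapeFunctions.tetL2_isHierarchicalBasis⟩,
    ⟨ShapeFunctions.priH1_isHierarchicalBasis, ShapeFunctions.priCurl_isHierarchicalBasis,
      ShapeFunctions.priDiv_isHierarchicalBasis, ShapeFunctions.priL2_isHierarchicalBasis⟩⟩
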